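/- **Theorem 1.2.** Let $R$ be an associative ring with $1$ and an involution $a\mapsto\bar a$ (an additive anti-automorphism of order dividing $2$), let $\lambda$ be a central element of $R$ with $\lambda\bar\lambda=1$, and let $\Lambda$ be a $\lambda$-form parameter: an additive subgroup with $\{a-\lambda\bar a : a\in R\}\subseteq\Lambda\subseteq\{a\in R : a=-\lambda\bar a\}$ and $\bar x\Lambda x\subseteq\Lambda$ for all $x\in R$. For a matrix $M$ over $R$ let $M^*$ be its conjugate transpose. A square matrix $M$ is $\Lambda$-Hermitian if $M=-\lambda M^*$ and its diagonal entries lie in $\Lambda$, and $\bar\Lambda$-Hermitian if $M=-\bar\lambda M^*$ and its diagonal entries lie in $\bar\Lambda=\{\bar a : a\in\Lambda\}$. Let $\mathrm{GQ}^\lambda(2n,R,\Lambda)$ be the group of invertible matrices $\sigma=\begin{pmatrix}a&b\\c&d\end{pmatrix}$, with $a,b,c,d\in \mathrm M_n(R)$, such that $\sigma^*\psi_n\sigma=\psi_n$ for $\psi_n=\begin{pmatrix}0&\mathrm I_n\\ \lambda \mathrm I_n&0\end{pmatrix}$ and the diagonal entries of $a^*c$ and $b^*d$ lie in $\Lambda$.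 For $u\in\mathrm{GL}_n(R)$ put $\mathbb H(u)=\begin{pmatrix}u&0\\0&(u^*)^{-1}\end{pmatrix}\in \mathrm{GQ}^\lambda(2n,R,\Lambda)$. Let $\mathrm{EQ}^\lambda(2n,R,\Lambda)$ be the subgroup generated by the matrices $\mathbb H(\alpha)$ with $\alpha$ in the elementary group $\mathrm E_n(R)$, $\begin{pmatrix}\mathrm I&\beta\\0&\mathrm I\end{pmatrix}$ with $\beta$ $\bar\Lambda$-Hermitian, and $\begin{pmatrix}\mathrm I&0\\\gamma&\mathrm I\end{pmatrix}$ with $\gamma$ $\Lambda$-Hermitian. Let $\mathrm{GQ}^\lambda(R,\Lambda)$ and $\mathrm{EQ}^\lambda(R,\Lambda)$ be the direct limits (unions) of these groups along the stabilization maps $\begin{pmatrix}a&b\\c&d\end{pmatrix}\mapsto\begin{pmatrix}a&0&b&0\\0&1&0&0\\c&0&d&0\\0&0&0&1\end{pmatrix}$, let $\mathrm K_1\mathrm{GQ}^\lambda(R,\Lambda)=\mathrm{GQ}^\lambda(R,\Lambda)/\mathrm{EQ}^\lambda(R,\Lambda)$, and let $[\sigma]$ be the class of $\sigma\in\mathrm{GQ}^\lambda(2n,R,\Lambda)$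 in this group. Suppose that $R=R_0\oplus R_1\oplus R_2\oplus\cdots$ is a graded ring, graded as a form ring: $\overline{R_i}\subseteq R_i$ for all $i$, $\lambda\in R_0$, and $\Lambda$ contains the homogeneous components of each of its elements. Let $k$ be a natural number that is a unit in $R_0$. Let $N=N_0+N_1+\dots+N_r$ be a nilpotent square matrix over $R$, where $N_i$ has all its entries in $R_i$. 1. If $N\in\mathrm M_{2n}(R)$, $\mathrm I+N\in\mathrm{GQ}^\lambda(2n,R,\Lambda)$ and $[\mathrm I+N]^k=[\mathrm I]$ in $\mathrm K_1\mathrm{GQ}^\lambda(R,\Lambda)$, then $\mathrm I+N_0\in\mathrm{GQ}^\lambda(2n,R,\Lambda)$ and $[\mathrm I+N]=[\mathrm I+N_0]$. 2. If $N\in\mathrm M_n(R)$ and $[\mathbb H(\mathrm I+N)]^k=[\mathrm I]$ in $\mathrm K_1\mathrm{GQ}^\lambda(R,\Lambda)$, then $\mathrm I+N_0\in\mathrm{GL}_n(R)$ and $[\mathbb H(\mathrm I+N)]=[\mathbb H(\mathrm I+N_0)]$. -/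

import Mathlib

open Matrix

set_option linter.unusedSectionVars false
set_option linter.unusedSimpArgs false

/-- A form ring structure on a ring `R` with involution `star`: a central element `lam` with
`lam * star lam = 1` and a `lam`-form parameter `Lam`. -/
structure FormRing (R : Type*) [Ring R] [StarRing R] where
  lam : R
  lam_central : ∀ x : R, lam * x = x * lam
  lam_mul_star : lam * star lam = 1
  Lam : AddSubgroup R
  min_le : ∀ a : R, a - lam * star a ∈ Lam
  le_max : ∀ a ∈ Lam, a = -(lam * star a)
  conj_mem : ∀ x : R, ∀ a ∈ Lam, star x * a * x ∈ Lam

/-- Compatibility of a form ring structure with a grading of `R`: the involution preserves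
degrees, `lam` has degree `0`, and the form parameter is a homogeneous subgroup. -/
structure FormRing.IsGraded {R : Type*} [Ring R] [StarRing R] (F : FormRing R)
    (𝒜 : ℕ → AddSubgroup R) [GradedRing 𝒜] : Prop where
  star_mem : ∀ i : ℕ, ∀ a ∈ 𝒜 i, star a ∈ 𝒜 i
  lam_mem : F.lam ∈ 𝒜 0
  proj_mem : ∀ a ∈ F.Lam, ∀ i : ℕ, (DirectSum.decompose 𝒜 a i : R) ∈ F.Lam

namespace FormRing

section Matrices

variable {R : Type*} [Ring R] [StarRing R] (F : FormRing R)
variable {ι κ μ : Type*} [Fintype ι] [Fintype κ] [Fintype μ]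
  [DecidableEq ι] [DecidableEq κ] [DecidableEq μ]

/-- `Λ`-Hermitian matrices. -/
def IsHerm {n : Type*} (M : Matrix n n R) : Prop :=
  M = -(F.lam • Mᴴ) ∧ ∀ i, M i i ∈ F.Lam

/-- `Λ̄`-Hermitian matrices, where `Λ̄ = {star a | a ∈ Λ}`. -/
def IsHermBar {n : Type*} (M : Matrix n n R) : Prop :=
  M = -(star F.lam • Mᴴ) ∧ ∀ i, ∃ a ∈ F.Lam, M i i = star a

/-- The matrix `ψ` of the hyperbolic form. -/
def psi (ι : Type*) [DecidableEq ι] : Matrix (ι ⊕ ι) (ι ⊕ ι) R :=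
  fromBlocks 0 1 (F.lam • (1 : Matrix ι ι R)) 0

/-- `Λ`-quadratic matrices: the matrix preserves `ψ`, and for its blocks `a, b, c, d` the
diagonal entries of `a^* c` and `b^* d` lie in `Λ`. -/
def IsQuad (σ : Matrix (ι ⊕ ι) (ι ⊕ ι) R) : Prop :=
  σᴴ * F.psi ι * σ = F.psi ι ∧
    (∀ i, (σ.toBlocks₁₁ᴴ * σ.toBlocks₂₁) i i ∈ F.Lam) ∧
    (∀ i, (σ.toBlocks₁₂ᴴ * σ.toBlocks₂₂) i i ∈ F.Lam)

/-! Auxiliary facts: `Λ`-quadratic matrices form a group. -/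

theorem star_lam_central (x : R) : star F.lam * x = x * star F.lam := by
  have := congrArg star (F.lam_central (star x))
  simpa using this.symm

theorem star_lam_mul : star F.lam * F.lam = 1 := by
  rw [F.star_lam_central, F.lam_mul_star]

theorem mul_lam_smul {l m n : Type*} [Fintype m] (A : Matrix l m R) (B : Matrix m n R) :
    A * (F.lam • B) = F.lam • (A * B) := by
  ext i j
  simp only [Matrix.mul_apply, Matrix.smul_apply, smul_eq_mul, Finset.mul_sum]
  refine Finset.sum_congr rfl fun k _ => ?_
  rw [← mul_assoc, ← F.lam_central, mul_assoc]

theorem conjTranspose_lam_smul {m n : Type*} (A : Matrix m n R) :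
    (F.lam • A)ᴴ = star F.lam • Aᴴ := by
  ext i j
  simp [conjTranspose_apply, F.star_lam_central]

theorem sum_mem {α : Type*} [DecidableEq α] (s : Finset α) (T : α → α → R)
    (hT : ∀ a b, T a b = -(F.lam * star (T b a))) (hd : ∀ a, T a a ∈ F.Lam) :
    ∑ a ∈ s, ∑ b ∈ s, T a b ∈ F.Lam := by
  induction s using Finset.induction_on with
  | empty => simp
  | insert a s ha ih =>
    have h : ∑ x ∈ insert a s, ∑ y ∈ insert a s, T x y
        = T a a + (∑ b ∈ s, (T b a - F.lam * star (T b a))) + ∑ x ∈ s, ∑ y ∈ s, T x y := by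
      have : ∀ b, T b a - F.lam * star (T b a) = T b a + T a b := by
        intro b; rw [hT a b]; abel
      simp only [Finset.sum_insert ha, this, Finset.sum_add_distrib]
      abel
    rw [h]
    exact F.Lam.add_mem (F.Lam.add_mem (hd a) (F.Lam.sum_mem fun b _ => F.min_le _)) ih

variable {F}

theorem IsHerm.add {n : Type*} {M N : Matrix n n R} (hM : F.IsHerm M) (hN : F.IsHerm N) :
    F.IsHerm (M + N) := by
  refine ⟨?_, fun i => F.Lam.add_mem (hM.2 i) (hN.2 i)⟩
  conv_lhs => rw [hM.1, hN.1]
  rw [conjTranspose_add, smul_add, neg_add]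

theorem IsHerm.neg {n : Type*} {M : Matrix n n R} (hM : F.IsHerm M) : F.IsHerm (-M) := by
  refine ⟨?_, fun i => F.Lam.neg_mem (hM.2 i)⟩
  conv_lhs => rw [hM.1]
  rw [conjTranspose_neg, smul_neg]

theorem IsHerm.conj {m n : Type*} [Fintype n] [DecidableEq n] {M : Matrix n n R}
    (hM : F.IsHerm M) (X : Matrix n m R) : F.IsHerm (Xᴴ * M * X) := by
  constructor
  · conv_lhs => rw [hM.1]
    simp only [conjTranspose_mul, conjTranspose_conjTranspose, Matrix.mul_neg, Matrix.neg_mul,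
      F.mul_lam_smul, Matrix.smul_mul, Matrix.mul_assoc]
  · intro j
    have key := F.sum_mem Finset.univ (fun a b => star (X b j) * M b a * X a j) (by
      intro a b
      have h : M b a = -(F.lam * star (M a b)) := congrFun (congrFun hM.1 b) a
      rw [h]
      simp only [star_mul, star_star, mul_neg, neg_mul, neg_inj]
      simp only [mul_assoc]
      rw [← mul_assoc, ← F.lam_central, mul_assoc]) (fun a => F.conj_mem _ _ (hM.2 a))
    simpa [mul_apply, Finset.sum_mul] using key

theorem isHermBar_iff {n : Type*} {M : Matrix n n R} : F.IsHermBar M ↔ F.IsHerm Mᴴ := by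
  have e : M = -(star F.lam • Mᴴ) ↔ Mᴴ = -(F.lam • M) := by
    constructor <;> intro h
    · conv_rhs => rw [h]
      rw [smul_neg, smul_smul, F.lam_mul_star, one_smul, neg_neg]
    · conv_rhs => rw [h]
      rw [smul_neg, smul_smul, F.star_lam_mul, one_smul, neg_neg]
  unfold IsHermBar IsHerm
  rw [e, conjTranspose_conjTranspose]
  refine and_congr_right fun _ => forall_congr' fun i => ?_
  rw [conjTranspose_apply]
  exact ⟨by rintro ⟨a, ha, h⟩; rw [h, star_star]; exact ha, fun h => ⟨_, h, by rw [star_star]⟩⟩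

/-- The sesquilinear form whose hermitianization is `ψ`. -/
def halfForm (R ι : Type*) [Ring R] [DecidableEq ι] : Matrix (ι ⊕ ι) (ι ⊕ ι) R :=
  fromBlocks 0 1 0 0

theorem halfForm_add : F.psi ι = halfForm R ι + F.lam • (halfForm R ι)ᴴ := by
  simp [psi, halfForm, fromBlocks_conjTranspose, fromBlocks_smul, fromBlocks_add]

theorem isQuad_iff (σ : Matrix (ι ⊕ ι) (ι ⊕ ι) R) :
    F.IsQuad σ ↔ F.IsHerm (σᴴ * halfForm R ι * σ - halfForm R ι) := by
  have e1 : σᴴ * F.psi ι * σ = F.psi ι ↔ σᴴ * halfForm R ι * σ - halfForm R ι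
      = -(F.lam • (σᴴ * halfForm R ι * σ - halfForm R ι)ᴴ) := by
    rw [halfForm_add]
    simp only [Matrix.mul_add, Matrix.add_mul, conjTranspose_sub, conjTranspose_mul,
      conjTranspose_conjTranspose, F.mul_lam_smul, Matrix.smul_mul, smul_sub, Matrix.mul_assoc]
    constructor <;> intro h
    · rw [neg_sub, sub_eq_sub_iff_add_eq_add, h, add_comm]
    · rw [neg_sub, sub_eq_sub_iff_add_eq_add] at h
      rw [h, add_comm]
  unfold IsQuad IsHerm
  rw [e1, Sum.forall]
  have h11 : ∀ i, (σᴴ * halfForm R ι * σ - halfForm R ι) (Sum.inl i) (Sum.inl i)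
      = (σ.toBlocks₁₁ᴴ * σ.toBlocks₂₁) i i := by
    intro i
    conv_lhs => rw [← fromBlocks_toBlocks σ]
    simp [halfForm, fromBlocks_conjTranspose, fromBlocks_multiply]
  have h22 : ∀ i, (σᴴ * halfForm R ι * σ - halfForm R ι) (Sum.inr i) (Sum.inr i)
      = (σ.toBlocks₁₂ᴴ * σ.toBlocks₂₂) i i := by
    intro i
    conv_lhs => rw [← fromBlocks_toBlocks σ]
    simp [halfForm, fromBlocks_conjTranspose, fromBlocks_multiply]
  simp only [h11, h22]

theorem IsQuad.mul {σ τ : Matrix (ι ⊕ ι) (ι ⊕ ι) R} (hσ : F.IsQuad σ) (hτ : F.IsQuad τ) :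
    F.IsQuad (σ * τ) := by
  rw [isQuad_iff] at *
  have := (hσ.conj τ).add hτ
  convert this using 1
  simp only [conjTranspose_mul, Matrix.mul_sub, Matrix.sub_mul, Matrix.mul_assoc]
  abel

theorem IsQuad.of_mul_eq_one {σ τ : Matrix (ι ⊕ ι) (ι ⊕ ι) R} (hσ : F.IsQuad σ)
    (h : σ * τ = 1) : F.IsQuad τ := by
  rw [isQuad_iff] at *
  have := (hσ.conj τ).neg
  convert this using 1
  have h' : τᴴ * σᴴ = 1 := by rw [← conjTranspose_mul, h, conjTranspose_one]
  have : τᴴ * (σᴴ * halfForm R ι * σ) * τ = halfForm R ι := by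
    calc _ = (τᴴ * σᴴ) * halfForm R ι * (σ * τ) := by simp only [Matrix.mul_assoc]
      _ = _ := by rw [h, h', Matrix.one_mul, Matrix.mul_one]
  rw [Matrix.mul_sub, Matrix.sub_mul, this]
  abel

theorem isQuad_one : F.IsQuad (1 : Matrix (ι ⊕ ι) (ι ⊕ ι) R) := by
  rw [isQuad_iff]
  simp [IsHerm]

variable (F)

/-- The group `GQ^λ` of invertible `Λ`-quadratic matrices; for `ι = Fin n` this is
`GQ^λ(2n, R, Λ)`. -/
def GQ (ι : Type*) [Fintype ι] [DecidableEq ι] : Subgroup (Matrix (ι ⊕ ι) (ι ⊕ ι) R)ˣ where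
  carrier := {σ | F.IsQuad (σ : Matrix (ι ⊕ ι) (ι ⊕ ι) R)}
  mul_mem' hσ hτ := by
    simp only [Set.mem_ofPred_eq, Units.val_mul] at *
    exact hσ.mul hτ
  one_mem' := isQuad_one
  inv_mem' {σ} hσ := IsQuad.of_mul_eq_one hσ σ.mul_inv

theorem mem_GQ (σ : (Matrix (ι ⊕ ι) (ι ⊕ ι) R)ˣ) :
    σ ∈ F.GQ ι ↔ F.IsQuad (σ : Matrix (ι ⊕ ι) (ι ⊕ ι) R) := Iff.rfl

/-- The underlying matrix of an element of `GQ^λ`. -/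
def GQ.mat {F : FormRing R} (σ : F.GQ ι) : Matrix (ι ⊕ ι) (ι ⊕ ι) R :=
  ((σ : (Matrix (ι ⊕ ι) (ι ⊕ ι) R)ˣ) : Matrix (ι ⊕ ι) (ι ⊕ ι) R)

/-- The elementary group `E(n, R)`, generated by the matrices `1 + r e_{ij}`, `i ≠ j`. -/
def elemGroup (R ι : Type*) [Ring R] [Fintype ι] [DecidableEq ι] :
    Subgroup (Matrix ι ι R)ˣ :=
  Subgroup.closure {u | ∃ (i j : ι) (r : R), i ≠ j ∧ (u : Matrix ι ι R) = 1 + single i j r}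

/-- The hyperbolic matrix `H(u) = diag(u, (u^*)⁻¹)`. -/
def hyp (ι : Type*) [Fintype ι] [DecidableEq ι] : (Matrix ι ι R)ˣ →* F.GQ ι where
  toFun u := ⟨⟨fromBlocks u 0 0 ((u⁻¹ : (Matrix ι ι R)ˣ) : Matrix ι ι R)ᴴ,
      fromBlocks ((u⁻¹ : (Matrix ι ι R)ˣ) : Matrix ι ι R) 0 0 (u : Matrix ι ι R)ᴴ,
      by simp [fromBlocks_multiply, ← conjTranspose_mul],
      by simp [fromBlocks_multiply, ← conjTranspose_mul]⟩, by
    show F.IsQuad (fromBlocks _ _ _ _)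
    rw [isQuad_iff]
    simp [halfForm, fromBlocks_multiply, fromBlocks_conjTranspose, IsHerm,
      ← conjTranspose_mul]⟩
  map_one' := by
    apply Subtype.ext; apply Units.ext; simp
  map_mul' u v := by
    apply Subtype.ext; apply Units.ext
    simp [fromBlocks_multiply, ← conjTranspose_mul]

/-- The group `EQ^λ`, generated by the `H(α)` with `α` in the elementary group, the
`T₁₂(β)` with `β` a `Λ̄`-Hermitian matrix, and the `T₂₁(γ)` with `γ` a `Λ`-Hermitian matrix. -/
def EQ (ι : Type*) [Fintype ι] [DecidableEq ι] : Subgroup (F.GQ ι) :=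
  Subgroup.closure ({σ | ∃ α ∈ elemGroup R ι, σ = F.hyp ι α} ∪
    {σ | ∃ β : Matrix ι ι R, F.IsHermBar β ∧ GQ.mat σ = fromBlocks 1 β 0 1} ∪
    {σ | ∃ γ : Matrix ι ι R, F.IsHerm γ ∧ GQ.mat σ = fromBlocks 1 0 γ 1})

/-! Stabilization. -/

/-- The `0`-`1` matrix of an embedding of index sets. -/
def embMat (R : Type*) [Ring R] {ι κ : Type*} [DecidableEq κ] (f : ι ↪ κ) : Matrix κ ι R :=
  of fun k i => if k = f i then 1 else 0

theorem embMat_star_mul (f : ι ↪ κ) : (embMat R f)ᴴ * embMat R f = 1 := by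
  ext i j
  simp [embMat, Matrix.mul_apply, Matrix.one_apply, eq_comm]
  split_ifs <;> simp

theorem embMat_star_mul_of_disjoint (f : ι ↪ κ) (g : μ ↪ κ) (h : ∀ i j, f i ≠ g j) :
    (embMat R f)ᴴ * embMat R g = 0 := by
  ext i j
  simp [embMat, Matrix.mul_apply, (h i j).symm]

theorem embMat_trans (f : ι ↪ κ) (g : κ ↪ μ) :
    embMat R (f.trans g) = embMat R g * embMat R f := by
  ext i j
  simp [embMat, Matrix.mul_apply]

theorem embMat_refl : embMat R (Function.Embedding.refl ι) = 1 := by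
  ext i j
  simp [embMat, Matrix.one_apply]

theorem embMat_sumMap (f : ι ↪ κ) :
    embMat R (f.sumMap f) = fromBlocks (embMat R f) 0 0 (embMat R f) := by
  ext (i | i) (j | j) <;> simp [embMat]

/-- Extension of a matrix along an embedding of index sets: it is the given matrix on the image
and the identity outside. -/
def extend (f : ι ↪ κ) : Matrix ι ι R →* Matrix κ κ R where
  toFun A := 1 + embMat R f * (A - 1) * (embMat R f)ᴴ
  map_one' := by simp
  map_mul' A B := by
    have h : ∀ X : Matrix ι κ R, (embMat R f)ᴴ * (embMat R f * X) = X := fun X => by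
      rw [← Matrix.mul_assoc, embMat_star_mul, Matrix.one_mul]
    simp only [Matrix.mul_add, Matrix.add_mul, Matrix.mul_sub, Matrix.sub_mul, Matrix.mul_assoc,
      Matrix.one_mul, Matrix.mul_one, h]
    abel

theorem extend_apply (f : ι ↪ κ) (A : Matrix ι ι R) :
    extend f A = 1 + embMat R f * (A - 1) * (embMat R f)ᴴ := rfl

theorem extend_refl (A : Matrix ι ι R) : extend (Function.Embedding.refl ι) A = A := by
  simp [extend_apply, embMat_refl]

theorem extend_trans (f : ι ↪ κ) (g : κ ↪ μ) (A : Matrix ι ι R) :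
    extend (f.trans g) A = extend g (extend f A) := by
  simp [extend_apply, embMat_trans, Matrix.mul_assoc]

theorem extend_conjTranspose (f : ι ↪ κ) (A : Matrix ι ι R) :
    (extend f A)ᴴ = extend f Aᴴ := by
  simp [extend_apply, Matrix.mul_assoc]

theorem extend_fromBlocks (f : ι ↪ κ) (a b c d : Matrix ι ι R) :
    extend (f.sumMap f) (fromBlocks a b c d) =
      fromBlocks (extend f a) (embMat R f * b * (embMat R f)ᴴ)
        (embMat R f * c * (embMat R f)ᴴ) (extend f d) := by
  simp only [extend_apply, embMat_sumMap, ← fromBlocks_one, sub_eq_add_neg, fromBlocks_neg,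
    fromBlocks_conjTranspose, fromBlocks_add, fromBlocks_multiply]
  simp

theorem IsQuad.extend {F : FormRing R} (f : ι ↪ κ) {σ : Matrix (ι ⊕ ι) (ι ⊕ ι) R}
    (h : F.IsQuad σ) : F.IsQuad (FormRing.extend (f.sumMap f) σ) := by
  rw [isQuad_iff] at *
  have := h.conj (embMat R (f.sumMap f))ᴴ
  convert this using 1
  rw [← fromBlocks_toBlocks σ, extend_fromBlocks]
  have h : ∀ X : Matrix ι κ R, (embMat R f)ᴴ * (embMat R f * X) = X := fun X => by
      rw [← Matrix.mul_assoc, embMat_star_mul, Matrix.one_mul]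
  simp only [embMat_sumMap, halfForm, fromBlocks_conjTranspose, fromBlocks_multiply,
    sub_eq_add_neg, fromBlocks_neg, fromBlocks_add, extend_apply,
    conjTranspose_add, conjTranspose_neg, conjTranspose_one,
    conjTranspose_mul, conjTranspose_conjTranspose, conjTranspose_zero]
  congr 1 <;>
  · simp only [Matrix.mul_add, Matrix.add_mul, Matrix.mul_neg, Matrix.neg_mul, Matrix.mul_assoc,
      Matrix.one_mul, Matrix.mul_one, Matrix.mul_zero, Matrix.zero_mul, h, add_zero, zero_add,
      neg_zero]
    try abel

/-- The stabilization homomorphism along an embedding of index sets. -/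
def stab (f : ι ↪ κ) : F.GQ ι →* F.GQ κ where
  toFun σ := ⟨Units.map (extend (f.sumMap f)) σ.1, by
    rw [mem_GQ, Units.coe_map]
    exact IsQuad.extend f ((F.mem_GQ σ.1).1 σ.2)⟩
  map_one' := Subtype.ext (map_one _)
  map_mul' σ τ := Subtype.ext (map_mul _ σ.1 τ.1)

/-! Auxiliary facts: the elementary group is normal in the stable quadratic group. -/

variable {F}

theorem GQ.ext_mat {σ τ : F.GQ ι} (h : GQ.mat σ = GQ.mat τ) : σ = τ :=
  Subtype.ext (Units.ext h)

theorem GQ.mat_mul (σ τ : F.GQ ι) : GQ.mat (σ * τ) = GQ.mat σ * GQ.mat τ := rfl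

theorem GQ.mat_mul_inv (σ : F.GQ ι) : GQ.mat σ * GQ.mat σ⁻¹ = 1 := by
  rw [← GQ.mat_mul, mul_inv_cancel]; rfl

theorem GQ.mat_stab (f : ι ↪ κ) (σ : F.GQ ι) :
    GQ.mat (F.stab f σ) = extend (f.sumMap f) (GQ.mat σ) := rfl

theorem GQ.mat_hyp (u : (Matrix ι ι R)ˣ) : GQ.mat (F.hyp ι u)
    = fromBlocks u 0 0 ((u⁻¹ : (Matrix ι ι R)ˣ) : Matrix ι ι R)ᴴ := rfl

theorem GQ.isQuad_mat (σ : F.GQ ι) : F.IsQuad (GQ.mat σ) := σ.2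

theorem stab_refl (σ : F.GQ ι) : F.stab (Function.Embedding.refl ι) σ = σ := by
  apply GQ.ext_mat
  rw [GQ.mat_stab]
  have : (Function.Embedding.refl ι).sumMap (Function.Embedding.refl ι)
      = Function.Embedding.refl (ι ⊕ ι) := by ext (x | x) <;> rfl
  rw [this, extend_refl]

theorem stab_trans (f : ι ↪ κ) (g : κ ↪ μ) (σ : F.GQ ι) :
    F.stab (f.trans g) σ = F.stab g (F.stab f σ) := by
  apply GQ.ext_mat
  rw [GQ.mat_stab, GQ.mat_stab, GQ.mat_stab, ← extend_trans]
  congr 2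
  ext (x | x) <;> rfl

theorem stab_hyp (f : ι ↪ κ) (u : (Matrix ι ι R)ˣ) :
    F.stab f (F.hyp ι u) = F.hyp κ (Units.map (extend f) u) := by
  apply GQ.ext_mat
  rw [GQ.mat_stab, GQ.mat_hyp, GQ.mat_hyp, extend_fromBlocks, ← extend_conjTranspose]
  simp

theorem extend_elem (f : ι ↪ κ) {u : (Matrix ι ι R)ˣ} (hu : u ∈ elemGroup R ι) :
    Units.map (extend f) u ∈ elemGroup R κ := by
  have : elemGroup R ι ≤ (elemGroup R κ).comap (Units.map (extend f)) := by
    unfold elemGroup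
    rw [Subgroup.closure_le]
    rintro u ⟨i, j, r, hij, hu⟩
    refine Subgroup.subset_closure ⟨f i, f j, r, fun h => hij (f.injective h), ?_⟩
    rw [Units.coe_map, hu]
    change extend f _ = _
    rw [extend_apply, add_sub_cancel_left]
    congr 1
    ext a b
    simp [embMat, Matrix.mul_apply, Matrix.single_apply, ite_and, eq_comm]
    split_ifs <;> simp
  exact this hu

theorem stab_EQ (f : ι ↪ κ) {σ : F.GQ ι} (hσ : σ ∈ F.EQ ι) : F.stab f σ ∈ F.EQ κ := by
  have : F.EQ ι ≤ (F.EQ κ).comap (F.stab f) := by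
    conv_lhs => unfold EQ
    rw [Subgroup.closure_le]
    rintro σ ((⟨α, hα, rfl⟩ | ⟨β, hβ, h⟩) | ⟨γ, hγ, h⟩)
    · refine Subgroup.subset_closure (Or.inl (Or.inl ⟨_, extend_elem f hα, stab_hyp f α⟩))
    · refine Subgroup.subset_closure (Or.inl (Or.inr ⟨embMat R f * β * (embMat R f)ᴴ, ?_, ?_⟩))
      · rw [isHermBar_iff] at *
        have := hβ.conj (embMat R f)ᴴ
        simpa [Matrix.mul_assoc] using this
      · rw [GQ.mat_stab, h, extend_fromBlocks]; simp
    · refine Subgroup.subset_closure (Or.inr ⟨embMat R f * γ * (embMat R f)ᴴ, ?_, ?_⟩)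
      · simpa using hγ.conj (embMat R f)ᴴ
      · rw [GQ.mat_stab, h, extend_fromBlocks]; simp
  exact this hσ

theorem IsHerm.blocks {P Q S T : Matrix ι ι R} (h : F.IsHerm (fromBlocks P Q S T)) :
    F.IsHerm P ∧ F.IsHerm T ∧ Q = -(F.lam • Sᴴ) := by
  obtain ⟨h1, h2⟩ := h
  rw [fromBlocks_conjTranspose, fromBlocks_smul, fromBlocks_neg, fromBlocks_inj] at h1
  exact ⟨⟨h1.1, fun i => h2 (Sum.inl i)⟩, ⟨h1.2.2.2, fun i => h2 (Sum.inr i)⟩, h1.2.1⟩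

theorem mem_EQ_of_upper {τ : F.GQ ι} {A : (Matrix ι ι R)ˣ} (hA : A ∈ elemGroup R ι)
    {B D : Matrix ι ι R} (h : GQ.mat τ = fromBlocks A B 0 D) : τ ∈ F.EQ ι := by
  have hH : F.hyp ι A ∈ F.EQ ι := Subgroup.subset_closure (Or.inl (Or.inl ⟨A, hA, rfl⟩))
  suffices hr : (F.hyp ι A⁻¹) * τ ∈ F.EQ ι by
    have := (F.EQ ι).mul_mem hH hr
    rwa [map_inv, mul_inv_cancel_left] at this
  have hm : ∃ b d, GQ.mat (F.hyp ι A⁻¹ * τ) = fromBlocks 1 b 0 d := by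
    rw [GQ.mat_mul, GQ.mat_hyp, h, fromBlocks_multiply]
    exact ⟨_, _, by simp; exact ⟨rfl, rfl⟩⟩
  obtain ⟨b, d, hbd⟩ := hm
  have hq := GQ.isQuad_mat (F.hyp ι A⁻¹ * τ)
  rw [hbd, isQuad_iff] at hq
  simp only [halfForm, fromBlocks_conjTranspose, fromBlocks_multiply, sub_eq_add_neg,
    fromBlocks_neg, fromBlocks_add] at hq
  obtain ⟨-, h2, h3⟩ := hq.blocks
  have hd : d = 1 := by simpa [add_neg_eq_zero] using h3
  subst hd
  refine Subgroup.subset_closure (Or.inl (Or.inr ⟨b, ?_, hbd⟩))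
  rw [isHermBar_iff]
  simpa using h2

theorem mem_EQ_of_lower {τ : F.GQ ι} {A : (Matrix ι ι R)ˣ} (hA : A ∈ elemGroup R ι)
    {C D : Matrix ι ι R} (h : GQ.mat τ = fromBlocks A 0 C D) : τ ∈ F.EQ ι := by
  have hH : F.hyp ι A ∈ F.EQ ι := Subgroup.subset_closure (Or.inl (Or.inl ⟨A, hA, rfl⟩))
  suffices hr : τ * (F.hyp ι A⁻¹) ∈ F.EQ ι by
    have := (F.EQ ι).mul_mem hr hH
    rwa [map_inv, inv_mul_cancel_right] at this
  have hm : ∃ c d, GQ.mat (τ * F.hyp ι A⁻¹) = fromBlocks 1 0 c d := by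
    rw [GQ.mat_mul, GQ.mat_hyp, h, fromBlocks_multiply]
    exact ⟨_, _, by simp; exact ⟨rfl, rfl⟩⟩
  obtain ⟨c, d, hcd⟩ := hm
  have hq := GQ.isQuad_mat (τ * F.hyp ι A⁻¹)
  rw [hcd, isQuad_iff] at hq
  simp only [halfForm, fromBlocks_conjTranspose, fromBlocks_multiply, sub_eq_add_neg,
    fromBlocks_neg, fromBlocks_add] at hq
  obtain ⟨h1, -, h3⟩ := hq.blocks
  have hd : d = 1 := by simpa [add_neg_eq_zero] using h3
  subst hd
  refine Subgroup.subset_closure (Or.inr ⟨c, ?_, hcd⟩)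
  simpa using h1

/-- The unit `1 + f x g^*` for embeddings with disjoint images. -/
def transv (f g : ι ↪ κ) (h : ∀ i j, g i ≠ f j) (x : Matrix ι ι R) : (Matrix κ κ R)ˣ where
  val := 1 + embMat R f * x * (embMat R g)ᴴ
  inv := 1 - embMat R f * x * (embMat R g)ᴴ
  val_inv := by
    have : ∀ X : Matrix ι κ R, (embMat R g)ᴴ * (embMat R f * X) = 0 := fun X => by
      rw [← Matrix.mul_assoc, embMat_star_mul_of_disjoint _ _ h, Matrix.zero_mul]
    simp [Matrix.mul_sub, Matrix.add_mul, Matrix.mul_assoc, this]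
  inv_val := by
    have : ∀ X : Matrix ι κ R, (embMat R g)ᴴ * (embMat R f * X) = 0 := fun X => by
      rw [← Matrix.mul_assoc, embMat_star_mul_of_disjoint _ _ h, Matrix.zero_mul]
    simp [Matrix.mul_add, Matrix.sub_mul, Matrix.mul_assoc, this]

theorem transv_mem (f g : ι ↪ κ) (h : ∀ i j, g i ≠ f j) (x : Matrix ι ι R) :
    transv f g h x ∈ elemGroup R κ := by
  have hmul : ∀ x y : Matrix ι ι R, transv f g h (x + y) = transv f g h x * transv f g h y := by
    intro x y
    apply Units.ext
    have : ∀ X : Matrix ι κ R, (embMat R g)ᴴ * (embMat R f * X) = 0 := fun X => by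
      rw [← Matrix.mul_assoc, embMat_star_mul_of_disjoint _ _ h, Matrix.zero_mul]
    simp [transv, Matrix.mul_add, Matrix.add_mul, Matrix.mul_assoc, this]
    abel
  induction x using Matrix.induction_on' with
  | h_zero =>
    have : transv f g h (0 : Matrix ι ι R) = 1 := by apply Units.ext; simp [transv]
    rw [this]; exact one_mem _
  | h_add p q hp hq => rw [hmul]; exact mul_mem hp hq
  | h_std_basis i j r =>
    refine Subgroup.subset_closure ⟨f i, g j, r, (h j i).symm, ?_⟩
    simp only [transv]
    congr 1
    ext a b
    simp [embMat, Matrix.mul_apply, Matrix.single_apply, ite_and, eq_comm]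
    split_ifs <;> simp

/-- Auxiliary: matrices of Eichler transvections. -/
def eichler (f : ι ↪ κ) (e e' : ι ↪ κ ⊕ κ) (v : Matrix (ι ⊕ ι) ι R) (v' : Matrix ι (ι ⊕ ι) R)
    (w : Matrix ι ι R) : Matrix (κ ⊕ κ) (κ ⊕ κ) R :=
  1 + embMat R (f.sumMap f) * v * (embMat R e')ᴴ + embMat R e * v' * (embMat R (f.sumMap f))ᴴ
    + embMat R e * w * (embMat R e')ᴴ

theorem embMat_inl (g : ι ↪ κ) :
    embMat R (g.trans (Function.Embedding.inl : κ ↪ κ ⊕ κ)) = fromRows (embMat R g) 0 := by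
  ext (i | i) j <;> simp [embMat]

theorem embMat_inr (g : ι ↪ κ) :
    embMat R (g.trans (Function.Embedding.inr : κ ↪ κ ⊕ κ)) = fromRows 0 (embMat R g) := by
  ext (i | i) j <;> simp [embMat]

theorem eichler_upper (f g : ι ↪ κ) (x y x' y' w : Matrix ι ι R) :
    eichler f (g.trans Function.Embedding.inl) (g.trans Function.Embedding.inr)
      (fromRows x y) (fromCols x' y') w
    = fromBlocks (1 + embMat R g * x' * (embMat R f)ᴴ)
        (embMat R f * x * (embMat R g)ᴴ + embMat R g * y' * (embMat R f)ᴴ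
          + embMat R g * w * (embMat R g)ᴴ) 0 (1 + embMat R f * y * (embMat R g)ᴴ) := by
  simp only [eichler, embMat_inl, embMat_inr, embMat_sumMap, fromBlocks_conjTranspose,
    conjTranspose_fromRows_eq_fromCols_conjTranspose, fromBlocks_mul_fromRows,
    fromRows_mul _ _ w, fromRows_mul_fromCols, ← fromBlocks_one, fromBlocks_add,
    fromBlocks_multiply]
  simp

theorem eichler_lower (f g : ι ↪ κ) (x y x' y' w : Matrix ι ι R) :
    eichler f (g.trans Function.Embedding.inr) (g.trans Function.Embedding.inl)
      (fromRows x y) (fromCols x' y') w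
    = fromBlocks (1 + embMat R f * x * (embMat R g)ᴴ) 0
        (embMat R f * y * (embMat R g)ᴴ + embMat R g * x' * (embMat R f)ᴴ
          + embMat R g * w * (embMat R g)ᴴ) (1 + embMat R g * y' * (embMat R f)ᴴ) := by
  simp only [eichler, embMat_inl, embMat_inr, embMat_sumMap, fromBlocks_conjTranspose,
    conjTranspose_fromRows_eq_fromCols_conjTranspose, fromBlocks_mul_fromRows,
    fromRows_mul _ _ w, fromRows_mul_fromCols, ← fromBlocks_one, fromBlocks_add,
    fromBlocks_multiply]
  simp

theorem eichler_conj (f : ι ↪ κ) (e e' : ι ↪ κ ⊕ κ) (he : ∀ i j, (f.sumMap f) i ≠ e j)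
    (he' : ∀ i j, e' i ≠ (f.sumMap f) j) (s t : Matrix (ι ⊕ ι) (ι ⊕ ι) R) (hst : s * t = 1)
    (v : Matrix (ι ⊕ ι) ι R) (v' : Matrix ι (ι ⊕ ι) R) (w : Matrix ι ι R) :
    extend (f.sumMap f) s * eichler f e e' v v' w * extend (f.sumMap f) t
      = eichler f e e' (s * v) (v' * t) w := by
  have h0 : extend (f.sumMap f) s * extend (f.sumMap f) t = 1 := by
    rw [← map_mul, hst, map_one]
  have h1 : extend (f.sumMap f) s * embMat R (f.sumMap f) = embMat R (f.sumMap f) * s := by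
    rw [extend_apply, Matrix.add_mul, Matrix.mul_assoc, embMat_star_mul]
    simp [Matrix.mul_sub]
  have h2 : (embMat R (f.sumMap f))ᴴ * extend (f.sumMap f) t
      = t * (embMat R (f.sumMap f))ᴴ := by
    rw [extend_apply, Matrix.mul_add, Matrix.mul_assoc, ← Matrix.mul_assoc _ (embMat R _),
      embMat_star_mul]
    simp [Matrix.sub_mul]
  have h3 : extend (f.sumMap f) s * embMat R e = embMat R e := by
    rw [extend_apply, Matrix.add_mul, Matrix.mul_assoc, embMat_star_mul_of_disjoint _ _ he]
    simp
  have h4 : (embMat R e')ᴴ * extend (f.sumMap f) t = (embMat R e')ᴴ := by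
    rw [extend_apply, Matrix.mul_add, Matrix.mul_assoc, ← Matrix.mul_assoc _ (embMat R _),
      embMat_star_mul_of_disjoint _ _ he']
    simp
  calc _ = extend (f.sumMap f) s * extend (f.sumMap f) t
        + (extend (f.sumMap f) s * embMat R (f.sumMap f)) * v
            * ((embMat R e')ᴴ * extend (f.sumMap f) t)
        + (extend (f.sumMap f) s * embMat R e) * v'
            * ((embMat R (f.sumMap f))ᴴ * extend (f.sumMap f) t)
        + (extend (f.sumMap f) s * embMat R e) * w
            * ((embMat R e')ᴴ * extend (f.sumMap f) t) := by
          simp only [eichler, Matrix.mul_add, Matrix.add_mul, Matrix.mul_assoc, Matrix.mul_one]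
    _ = _ := by
          rw [h0, h1, h2, h3, h4]
          simp only [eichler, Matrix.mul_assoc]

/-- Auxiliary: the subgroup generated by the Eichler transvections. -/
def eichGroup (F : FormRing R) (f g : ι ↪ κ) : Subgroup (F.GQ κ) :=
  Subgroup.closure ({τ | ∃ v v' w, GQ.mat τ = eichler f (g.trans Function.Embedding.inl)
      (g.trans Function.Embedding.inr) v v' w} ∪
    {τ | ∃ v v' w, GQ.mat τ = eichler f (g.trans Function.Embedding.inr)
      (g.trans Function.Embedding.inl) v v' w})

theorem eichGroup_le (f g : ι ↪ κ) (h : ∀ i j, f i ≠ g j) : eichGroup F f g ≤ F.EQ κ := by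
  unfold eichGroup
  rw [Subgroup.closure_le]
  rintro τ (⟨v, v', w, hτ⟩ | ⟨v, v', w, hτ⟩)
  · rw [← fromRows_toRows v, ← fromCols_toCols v', eichler_upper] at hτ
    exact mem_EQ_of_upper (transv_mem g f h _) hτ
  · rw [← fromRows_toRows v, ← fromCols_toCols v', eichler_lower] at hτ
    exact mem_EQ_of_lower (transv_mem f g (fun i j => (h j i).symm) _) hτ

theorem eichGroup_conj (f g : ι ↪ κ) (h : ∀ i j, f i ≠ g j) (σ : F.GQ ι) {τ : F.GQ κ}
    (hτ : τ ∈ eichGroup F f g) : F.stab f σ * τ * (F.stab f σ)⁻¹ ∈ eichGroup F f g := by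
  have : eichGroup F f g ≤ (eichGroup F f g).comap (MulAut.conj (F.stab f σ)).toMonoidHom := by
    conv_lhs => unfold eichGroup
    rw [Subgroup.closure_le]
    have hst : GQ.mat σ * GQ.mat σ⁻¹ = 1 := GQ.mat_mul_inv σ
    rintro τ (⟨v, v', w, hτ⟩ | ⟨v, v', w, hτ⟩)
    · refine Subgroup.subset_closure (Or.inl ⟨GQ.mat σ * v, v' * GQ.mat σ⁻¹, w, ?_⟩)
      change GQ.mat (F.stab f σ * τ * (F.stab f σ)⁻¹) = _
      rw [← map_inv, GQ.mat_mul, GQ.mat_mul, GQ.mat_stab, GQ.mat_stab, hτ]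
      refine eichler_conj f _ _ ?_ ?_ _ _ hst v v' w
      · rintro (i | i) j <;> simp [h]
      · rintro i (j | j) <;> simp [(h _ _).symm]
    · refine Subgroup.subset_closure (Or.inr ⟨GQ.mat σ * v, v' * GQ.mat σ⁻¹, w, ?_⟩)
      change GQ.mat (F.stab f σ * τ * (F.stab f σ)⁻¹) = _
      rw [← map_inv, GQ.mat_mul, GQ.mat_mul, GQ.mat_stab, GQ.mat_stab, hτ]
      refine eichler_conj f _ _ ?_ ?_ _ _ hst v v' w
      · rintro (i | i) j <;> simp [h]
      · rintro i (j | j) <;> simp [(h _ _).symm]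
  exact this hτ

theorem upper_mem (f g : ι ↪ κ) {τ : F.GQ κ} (x y x' y' w : Matrix ι ι R)
    (h : GQ.mat τ = fromBlocks (1 + embMat R g * x' * (embMat R f)ᴴ)
        (embMat R f * x * (embMat R g)ᴴ + embMat R g * y' * (embMat R f)ᴴ
          + embMat R g * w * (embMat R g)ᴴ) 0 (1 + embMat R f * y * (embMat R g)ᴴ)) :
    τ ∈ eichGroup F f g :=
  Subgroup.subset_closure (Or.inl ⟨_, _, _, h.trans (eichler_upper f g x y x' y' w).symm⟩)

theorem lower_mem (f g : ι ↪ κ) {τ : F.GQ κ} (x y x' y' w : Matrix ι ι R)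
    (h : GQ.mat τ = fromBlocks (1 + embMat R f * x * (embMat R g)ᴴ) 0
        (embMat R f * y * (embMat R g)ᴴ + embMat R g * x' * (embMat R f)ᴴ
          + embMat R g * w * (embMat R g)ᴴ) (1 + embMat R g * y' * (embMat R f)ᴴ)) :
    τ ∈ eichGroup F f g :=
  Subgroup.subset_closure (Or.inr ⟨_, _, _, h.trans (eichler_lower f g x y x' y' w).symm⟩)

theorem hyp_transv_mem (f g : ι ↪ κ) (h : ∀ i j, f i ≠ g j) (x : Matrix ι ι R) :
    F.hyp κ (transv g f h x) ∈ eichGroup F f g := by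
  refine upper_mem f g 0 (-xᴴ) x 0 0 ?_
  rw [GQ.mat_hyp]
  simp [transv, Matrix.mul_assoc, sub_eq_add_neg]

theorem hyp_transv_mem' (f g : ι ↪ κ) (h : ∀ i j, g i ≠ f j) (x : Matrix ι ι R) :
    F.hyp κ (transv f g h x) ∈ eichGroup F f g := by
  refine lower_mem f g x 0 0 (-xᴴ) 0 ?_
  rw [GQ.mat_hyp]
  simp [transv, Matrix.mul_assoc, sub_eq_add_neg]

theorem GQ.mat_inv_eq {σ : F.GQ ι} {M : Matrix (ι ⊕ ι) (ι ⊕ ι) R} (h : GQ.mat σ * M = 1) :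
    GQ.mat σ⁻¹ = M := by
  have h' : GQ.mat σ⁻¹ * GQ.mat σ = 1 := by rw [← GQ.mat_mul, inv_mul_cancel]; rfl
  calc _ = GQ.mat σ⁻¹ * (GQ.mat σ * M) := by rw [h, Matrix.mul_one]
    _ = M := by rw [← Matrix.mul_assoc, h', Matrix.one_mul]

theorem stab_mem_eichGroup (f g : ι ↪ κ) (h : ∀ i j, f i ≠ g j) {ε : F.GQ ι}
    (hε : ε ∈ F.EQ ι) : F.stab f ε ∈ eichGroup F f g := by
  have h' : ∀ i j, g i ≠ f j := fun i j => (h j i).symm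
  have hFF : ∀ X : Matrix ι κ R, (embMat R f)ᴴ * (embMat R f * X) = X := fun X => by
    rw [← Matrix.mul_assoc, embMat_star_mul, Matrix.one_mul]
  have hGG : ∀ X : Matrix ι κ R, (embMat R g)ᴴ * (embMat R g * X) = X := fun X => by
    rw [← Matrix.mul_assoc, embMat_star_mul, Matrix.one_mul]
  have hFG : ∀ X : Matrix ι κ R, (embMat R f)ᴴ * (embMat R g * X) = 0 := fun X => by
    rw [← Matrix.mul_assoc, embMat_star_mul_of_disjoint _ _ h, Matrix.zero_mul]
  have hGF : ∀ X : Matrix ι κ R, (embMat R g)ᴴ * (embMat R f * X) = 0 := fun X => by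
    rw [← Matrix.mul_assoc, embMat_star_mul_of_disjoint _ _ h', Matrix.zero_mul]
  have : F.EQ ι ≤ (eichGroup F f g).comap (F.stab f) := by
    unfold EQ
    rw [Subgroup.closure_le]
    rintro σ ((⟨α, hα, rfl⟩ | ⟨β, hβ, hσ⟩) | ⟨γ, hγ, hσ⟩)
    · have : elemGroup R ι ≤ (eichGroup F f g).comap ((F.stab f).comp (F.hyp ι)) := by
        unfold elemGroup
        rw [Subgroup.closure_le]
        rintro u ⟨i, j, r, hij, hu⟩
        change F.stab f (F.hyp ι u) ∈ eichGroup F f g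
        have key : Units.map (extend f) u
            = transv f g h' (single i j r) * transv g f h (single j j 1)
              * (transv f g h' (single i j r))⁻¹ * (transv g f h (single j j 1))⁻¹ := by
          rw [eq_mul_inv_iff_mul_eq, eq_mul_inv_iff_mul_eq]
          apply Units.ext
          have hyx : ∀ X : Matrix ι κ R, single j j (1 : R) * (single i j r * X) = 0 := by
            intro X
            rw [← Matrix.mul_assoc, single_mul_single_of_ne (h := hij.symm), Matrix.zero_mul]
          have hxy : ∀ X : Matrix ι κ R, single i j r * (single j j (1 : R) * X)
              = single i j r * X := by
            intro X
            rw [← Matrix.mul_assoc, single_mul_single_same, mul_one]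
          have hxx : ∀ X : Matrix ι κ R, single i j r * (single i j r * X) = 0 := by
            intro X
            rw [← Matrix.mul_assoc, single_mul_single_of_ne (h := hij.symm), Matrix.zero_mul]
          simp only [Units.val_mul, Units.coe_map, hu, transv]
          change extend f _ * _ * _ = _
          rw [extend_apply, add_sub_cancel_left]
          simp only [Matrix.mul_add, Matrix.add_mul, Matrix.mul_assoc, hFF, hGG, hFG, hGF, hyx,
            hxy, hxx, Matrix.mul_zero, Matrix.zero_mul, Matrix.one_mul, Matrix.mul_one]
          abel
        rw [stab_hyp, key]
        simp only [map_mul, map_inv]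
        exact mul_mem (mul_mem (mul_mem (hyp_transv_mem' f g h' _) (hyp_transv_mem f g h _))
          (inv_mem (hyp_transv_mem' f g h' _))) (inv_mem (hyp_transv_mem f g h _))
      exact this hα
    · have hρ : GQ.mat (F.stab g σ) = fromBlocks 1 (embMat R g * β * (embMat R g)ᴴ) 0 1 := by
        rw [GQ.mat_stab, hσ, extend_fromBlocks]; simp
      have hi : GQ.mat (F.stab f σ)⁻¹ = fromBlocks 1 (-(embMat R f * β * (embMat R f)ᴴ)) 0 1 := by
        apply GQ.mat_inv_eq
        rw [GQ.mat_stab, hσ, extend_fromBlocks]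
        simp [fromBlocks_multiply]
      have hτ : F.stab g σ ∈ eichGroup F f g :=
        upper_mem f g 0 0 0 0 β (by rw [hρ]; simp)
      have hu := hyp_transv_mem' (F := F) f g h' 1
      have hc := mul_mem (mul_mem hu hτ) (inv_mem hu)
      have hδ : F.hyp κ (transv f g h' 1) * F.stab g σ * (F.hyp κ (transv f g h' 1))⁻¹
          * (F.stab f σ)⁻¹ ∈ eichGroup F f g := by
        refine upper_mem f g β 0 0 β β ?_
        rw [GQ.mat_mul, GQ.mat_mul, GQ.mat_mul, ← map_inv, GQ.mat_hyp, GQ.mat_hyp, hρ, hi]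
        simp [fromBlocks_multiply, transv, Matrix.mul_add, Matrix.add_mul, Matrix.mul_sub,
          Matrix.sub_mul, Matrix.mul_assoc, hFF, hGG, hFG, hGF]
        try abel
      have := mul_mem (inv_mem hδ) hc
      simpa [mul_assoc] using this
    · have hρ : GQ.mat (F.stab g σ) = fromBlocks 1 0 (embMat R g * γ * (embMat R g)ᴴ) 1 := by
        rw [GQ.mat_stab, hσ, extend_fromBlocks]; simp
      have hi : GQ.mat (F.stab f σ)⁻¹ = fromBlocks 1 0 (-(embMat R f * γ * (embMat R f)ᴴ)) 1 := by
        apply GQ.mat_inv_eq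
        rw [GQ.mat_stab, hσ, extend_fromBlocks]
        simp [fromBlocks_multiply]
      have hτ : F.stab g σ ∈ eichGroup F f g :=
        lower_mem f g 0 0 0 0 γ (by rw [hρ]; simp)
      have hu := hyp_transv_mem (F := F) f g h (-1)
      have hc := mul_mem (mul_mem hu hτ) (inv_mem hu)
      have hδ : F.hyp κ (transv g f h (-1)) * F.stab g σ * (F.hyp κ (transv g f h (-1)))⁻¹
          * (F.stab f σ)⁻¹ ∈ eichGroup F f g := by
        refine lower_mem f g 0 γ γ 0 γ ?_
        rw [GQ.mat_mul, GQ.mat_mul, GQ.mat_mul, ← map_inv, GQ.mat_hyp, GQ.mat_hyp, hρ, hi]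
        simp [fromBlocks_multiply, transv, Matrix.mul_add, Matrix.add_mul, Matrix.mul_sub,
          Matrix.sub_mul, Matrix.mul_assoc, hFF, hGG, hFG, hGF]
        try abel
      have := mul_mem (inv_mem hδ) hc
      simpa [mul_assoc] using this
  exact this hε

theorem stab_conj_mem (f g : ι ↪ κ) (h : ∀ i j, f i ≠ g j) (σ : F.GQ ι) {ε : F.GQ ι}
    (hε : ε ∈ F.EQ ι) : F.stab f (σ * ε * σ⁻¹) ∈ F.EQ κ := by
  rw [map_mul, map_mul, map_inv]
  exact eichGroup_le f g h (eichGroup_conj f g h σ (stab_mem_eichGroup f g h hε))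

end Matrices

section Stable

variable {R : Type*} [Ring R] [StarRing R] (F : FormRing R)

instance : DirectedSystem (fun n : ℕ => F.GQ (Fin n))
    (fun _ _ h => F.stab (Fin.castLEEmb h)) where
  map_self _ x := stab_refl x
  map_map _ _ _ hij hjk x := (stab_trans (Fin.castLEEmb hij) (Fin.castLEEmb hjk) x).symm

/-- The stable group `GQ^λ(R, Λ)`, the direct limit of the groups `GQ^λ(2n, R, Λ)` along the
stabilization maps. -/
abbrev StableGQ : Type _ :=
  DirectLimit (fun n : ℕ => F.GQ (Fin n)) (fun _ _ h => F.stab (Fin.castLEEmb h))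

/-- The canonical map `GQ^λ(2n, R, Λ) → GQ^λ(R, Λ)`. -/
noncomputable def toStable (n : ℕ) : F.GQ (Fin n) →* F.StableGQ where
  toFun σ := ⟦⟨n, σ⟩⟧
  map_one' := (DirectLimit.one_def (G := fun n : ℕ => F.GQ (Fin n))
    (f := fun _ _ h => F.stab (Fin.castLEEmb h)) n).symm
  map_mul' σ τ := (DirectLimit.mul_def (G := fun n : ℕ => F.GQ (Fin n))
    (f := fun _ _ h => F.stab (Fin.castLEEmb h)) n σ τ).symm

variable {F} in
theorem toStable_stab {n m : ℕ} (h : n ≤ m) (σ : F.GQ (Fin n)) :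
    F.toStable m (F.stab (Fin.castLEEmb h) σ) = F.toStable n σ :=
  (DirectLimit.eq_of_le (F := fun n : ℕ => F.GQ (Fin n))
    (f := fun _ _ h => F.stab (Fin.castLEEmb h)) ⟨n, σ⟩ m h).symm

/-- The stable elementary group `EQ^λ(R, Λ)`, the union of the groups `EQ^λ(2n, R, Λ)`. -/
def StableEQ : Subgroup F.StableGQ where
  carrier := {x | ∃ (n : ℕ) (ε : F.GQ (Fin n)), ε ∈ F.EQ (Fin n) ∧ x = F.toStable n ε}
  one_mem' := ⟨0, 1, one_mem _, (map_one _).symm⟩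
  inv_mem' := by
    rintro _ ⟨n, ε, hε, rfl⟩
    exact ⟨n, ε⁻¹, inv_mem hε, (map_inv _ _).symm⟩
  mul_mem' := by
    rintro _ _ ⟨n, ε, hε, rfl⟩ ⟨m, δ, hδ, rfl⟩
    refine ⟨max n m, _, mul_mem (stab_EQ (Fin.castLEEmb (le_max_left n m)) hε)
      (stab_EQ (Fin.castLEEmb (le_max_right n m)) hδ), ?_⟩
    rw [map_mul, toStable_stab, toStable_stab]

instance : F.StableEQ.Normal where
  conj_mem := by
    rintro _ ⟨n, ε, hε, rfl⟩ x
    obtain ⟨m, σ, rfl⟩ : ∃ (m : ℕ) (σ : F.GQ (Fin m)), x = F.toStable m σ :=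
      DirectLimit.exists_eq_mk (F := fun n : ℕ => F.GQ (Fin n))
        (f := fun _ _ h => F.stab (Fin.castLEEmb h)) x
    rw [← toStable_stab (le_max_left n m) ε, ← toStable_stab (le_max_right n m) σ,
      ← map_inv, ← map_mul, ← map_mul, ← toStable_stab (Nat.le_add_right (max n m) (max n m))]
    refine ⟨_, _, ?_, rfl⟩
    refine stab_conj_mem _ (Fin.natAddEmb (max n m)) ?_ _ (stab_EQ _ hε)
    intro i j hij
    have := congrArg Fin.val hij
    simp at this
    omega

/-- The group `K₁GQ^λ(R, Λ) = GQ^λ(R, Λ) / EQ^λ(R, Λ)`. -/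
abbrev K1GQ : Type _ := F.StableGQ ⧸ F.StableEQ

/-- The class `[σ]` in `K₁GQ^λ(R, Λ)` of a matrix `σ` in `GQ^λ(2n, R, Λ)`. -/
noncomputable def cls (n : ℕ) : F.GQ (Fin n) →* F.K1GQ :=
  (QuotientGroup.mk' F.StableEQ).comp (F.toStable n)

end Stable

end FormRing

/-! Replacing a homogeneous entry `x` of degree `i` by `x X ^ i` turns `σ` into a quadratic matrix
`σ(X)` over `R[X]`, whose value `σ(0) = σ₀` is the degree zero part. For a suitable central scalar
`z`, `σ(z)` is the image of `σ` under the graded endomorphism that multiplies degree `i` by `z ^ i`.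
If `[σ(k ^ N)] = [σ₀]` for one `N`, the endomorphism attached to the inverse of `k ^ N`, which fixes
`σ₀`, yields `[σ] = [σ₀]`. With `τ(X) = σ(X) σ₀⁻¹`, the task is to find `N` with `[τ(k ^ N)] = 1`,
knowing that every `[τ(k ^ i)]` has order dividing `k`.

Higman's trick makes the upper left block of `τ` equal to `1 - a X` (`StableHom.exists_linear`). An
elementary factor then makes the upper right block `b X ^ (2 p)`, where `b c = a ^ m` for some `c`
(`exists_mennickeRow`). At `X = k ^ i` a conjugation by a scalar hyperbolic matrix removes the
factor `k ^ (2 p i)` from `b`. The class of a quadratic matrix depends only on its upper half, so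
`[τ(k ^ i)]` is a function of the row `(1 - k ^ i a, b)`.

More generally, let `P` be a symmetric matrix over `ℤ[X]`, invertible modulo `X ^ m`, and consider
the row `(P(a), b)`. Because `a ^ m = b c`, elementary matrices change `P` by any symmetric multiple
of `X ^ m`; hyperbolic ones change it by elementary congruence. The class is thus an additive
invariant `Φ` of symmetric forms over `ℤ⟦X⟧` (`MennickeRow.invariant`), and `[τ(k ^ i)] = Φ⟨1 - k ^
i X⟩`.

What remains concerns such invariants (`FormInvariant.exists_iterate_eq_zero`). The map `Θ(u) =
Φ⟨u²⟩` is a homomorphism, and on values of `Θ` killed by `k` the repeated rescaling `X ↦ k X` is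
eventually zero, since `u(k X)` and `u ^ (k ^ j)` have the same leading term. For even `k` the
series `1 - k² X` is a square modulo `X ^ m`, so `Θ` is enough. For odd `k`, a relation between
diagonal forms of rank four shows that `2 Φ⟨u⟩ - Φ⟨u²⟩` is killed by a power of `2`; then a multiple
of `Φ⟨1 - X⟩` by a power of `2` is a value of `Θ`, and coprimality with `k` concludes. -/

/-! ### Additive invariants of symmetric forms and relations in small rank. -/

/-- An additive invariant of invertible symmetric matrices over `C`, unchanged under congruence by
elementary matrices. -/
structure FormInvariant (C K : Type*) [CommRing C] [AddCommGroup K] where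
  toFun : ∀ (s : Type) [Fintype s] [DecidableEq s], Matrix s s C → K
  sum : ∀ (s t : Type) [Fintype s] [DecidableEq s] [Fintype t] [DecidableEq t]
    (P : Matrix s s C) (Q : Matrix t t C), P.IsSymm → Q.IsSymm → IsUnit P.det → IsUnit Q.det →
    toFun (s ⊕ t) (fromBlocks P 0 0 Q) = toFun s P + toFun t Q
  congr : ∀ (s : Type) [Fintype s] [DecidableEq s] (P : Matrix s s C), P.IsSymm → IsUnit P.det →
    ∀ E ∈ FormRing.elemGroup C s,
      toFun s ((E : Matrix s s C)ᵀ * P * (E : Matrix s s C)) = toFun s P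

theorem FormRing.exists_elem_upper {C : Type*} [Ring C] {s t : Type*} [Fintype s] [DecidableEq s]
    [Fintype t] [DecidableEq t] (X : Matrix s t C) :
    ∃ E ∈ FormRing.elemGroup C (s ⊕ t), (E : Matrix (s ⊕ t) (s ⊕ t) C) = fromBlocks 1 X 0 1 := by
  induction X using Matrix.induction_on' with
  | h_zero => exact ⟨1, one_mem _, by simp⟩
  | h_add p q hp hq =>
    obtain ⟨E, hE, h⟩ := hp
    obtain ⟨E', hE', h'⟩ := hq
    exact ⟨E * E', mul_mem hE hE', by simp [h, h', fromBlocks_multiply, add_comm]⟩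
  | h_std_basis i j r =>
    have hu : ∀ r : C, (single (Sum.inl i) (Sum.inr j) r : Matrix (s ⊕ t) (s ⊕ t) C)
        = fromBlocks 0 (single i j r) 0 0 := by
      intro r
      ext (a | a) (b | b) <;> simp [single_apply]
    refine ⟨⟨fromBlocks 1 (single i j r) 0 1, fromBlocks 1 (-single i j r) 0 1,
      by simp [fromBlocks_multiply], by simp [fromBlocks_multiply]⟩,
      Subgroup.subset_closure ⟨Sum.inl i, Sum.inr j, r, by simp, ?_⟩, rfl⟩
    change fromBlocks _ _ _ _ = _
    rw [hu, ← fromBlocks_one, fromBlocks_add]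
    simp

theorem FormRing.exists_elem_lower {C : Type*} [Ring C] {s t : Type*} [Fintype s] [DecidableEq s]
    [Fintype t] [DecidableEq t] (X : Matrix t s C) :
    ∃ E ∈ FormRing.elemGroup C (s ⊕ t), (E : Matrix (s ⊕ t) (s ⊕ t) C) = fromBlocks 1 0 X 1 := by
  induction X using Matrix.induction_on' with
  | h_zero => exact ⟨1, one_mem _, by simp⟩
  | h_add p q hp hq =>
    obtain ⟨E, hE, h⟩ := hp
    obtain ⟨E', hE', h'⟩ := hq
    exact ⟨E * E', mul_mem hE hE', by simp [h, h', fromBlocks_multiply]⟩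
  | h_std_basis i j r =>
    have hu : ∀ r : C, (single (Sum.inr i) (Sum.inl j) r : Matrix (s ⊕ t) (s ⊕ t) C)
        = fromBlocks 0 0 (single i j r) 0 := by
      intro r
      ext (a | a) (b | b) <;> simp [single_apply]
    refine ⟨⟨fromBlocks 1 0 (single i j r) 1, fromBlocks 1 0 (-single i j r) 1,
      by simp [fromBlocks_multiply], by simp [fromBlocks_multiply]⟩,
      Subgroup.subset_closure ⟨Sum.inr i, Sum.inl j, r, by simp, ?_⟩, rfl⟩
    change fromBlocks _ _ _ _ = _
    rw [hu, ← fromBlocks_one, fromBlocks_add]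
    simp

namespace FormInvariant

section

variable {C K : Type*} [CommRing C] [AddCommGroup K] (Φ : FormInvariant C K)
variable {s t : Type} [Fintype s] [DecidableEq s] [Fintype t] [DecidableEq t]

/-- The invariant `S ↦ Φ (u S)`. -/
def twist (u : Cˣ) : FormInvariant C K where
  toFun s _ _ P := Φ.toFun s ((u : C) • P)
  sum s t _ _ _ _ P Q hP hQ hp hq := by
    have h1 : IsUnit ((u : C) • P).det := by
      rw [det_smul]; exact (u.isUnit.pow _).mul hp
    have h2 : IsUnit ((u : C) • Q).det := by
      rw [det_smul]; exact (u.isUnit.pow _).mul hq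
    rw [fromBlocks_smul, smul_zero, smul_zero]
    exact Φ.sum s t _ _ (hP.smul _) (hQ.smul _) h1 h2
  congr s _ _ P hP hp E hE := by
    have h1 : IsUnit ((u : C) • P).det := by
      rw [det_smul]; exact (u.isUnit.pow _).mul hp
    rw [← Φ.congr s _ (hP.smul _) h1 E hE]
    simp only [Matrix.mul_smul, Matrix.smul_mul]

/-- The value of the invariant on a form of rank one. -/
def rankOne (u : C) : K := Φ.toFun Unit (diagonal fun _ => u)

theorem twist_rankOne (u : Cˣ) (v : C) : (Φ.twist u).rankOne v = Φ.rankOne (u * v) := by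
  simp only [rankOne, twist]
  congr 1

/-- Completing the square: the unipotent congruence with corner `-A⁻¹ X` clears the off-diagonal
blocks and leaves the Schur complement. -/
theorem pivot {A Ai : Matrix s s C} (hA : A.IsSymm) (hAi : Ai * A = 1) {X : Matrix s t C}
    {D : Matrix t t C} (hD : D.IsSymm) (hu : IsUnit (fromBlocks A X Xᵀ D).det) :
    (D - Xᵀ * Ai * X).IsSymm ∧ IsUnit (D - Xᵀ * Ai * X).det ∧
    Φ.toFun (s ⊕ t) (fromBlocks A X Xᵀ D) = Φ.toFun s A + Φ.toFun t (D - Xᵀ * Ai * X) := by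
  have hAi' : A * Ai = 1 := mul_eq_one_comm.1 hAi
  have hAis : Aiᵀ = Ai := by
    calc Aiᵀ = Aiᵀ * (A * Ai) := by rw [hAi', Matrix.mul_one]
      _ = (Aiᵀ * Aᵀ) * Ai := by rw [hA.eq, Matrix.mul_assoc]
      _ = Ai := by rw [← transpose_mul, hAi', transpose_one, Matrix.one_mul]
  obtain ⟨E, hE, hE'⟩ := FormRing.exists_elem_upper (-(Ai * X))
  have hS : (fromBlocks A X Xᵀ D).IsSymm := by
    simp [IsSymm, fromBlocks_transpose, hA.eq, hD.eq]
  have key : (E : Matrix (s ⊕ t) (s ⊕ t) C)ᵀ * fromBlocks A X Xᵀ D * E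
      = fromBlocks A 0 0 (D - Xᵀ * Ai * X) := by
    have e1 : ∀ Y : Matrix s t C, A * (Ai * Y) = Y := fun Y => by
      rw [← Matrix.mul_assoc, hAi', Matrix.one_mul]
    have e2 : ∀ Y : Matrix s s C, Ai * (A * Y) = Y := fun Y => by
      rw [← Matrix.mul_assoc, hAi, Matrix.one_mul]
    rw [hE', fromBlocks_transpose, fromBlocks_multiply, fromBlocks_multiply]
    simp [Matrix.mul_assoc, e1, hAis, hAi, sub_eq_add_neg, add_comm]
  have hS' : (D - Xᵀ * Ai * X).IsSymm := by
    simp [IsSymm, hAis, hD.eq, Matrix.mul_assoc]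
  have hdet : IsUnit (A.det * (D - Xᵀ * Ai * X).det) := by
    rw [← det_fromBlocks_zero₂₁ A 0, ← key, det_mul, det_mul, det_transpose]
    have hEu : IsUnit (E : Matrix (s ⊕ t) (s ⊕ t) C).det :=
      (isUnit_iff_isUnit_det _).1 E.isUnit
    exact (hEu.mul hu).mul hEu
  have hu1 := isUnit_of_mul_isUnit_left hdet
  have hu2 := isUnit_of_mul_isUnit_right hdet
  exact ⟨hS', hu2, by rw [← Φ.congr _ _ hS hu E hE, key, Φ.sum _ _ _ _ hA hS' hu1 hu2]⟩

/-- Splitting off the vector `e + x` of `A ⊥ P`. -/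
theorem sum_split {A N Ni : Matrix s s C} {P : Matrix t t C} (hA : A.IsSymm) (hP : P.IsSymm)
    (hAu : IsUnit A.det) (hPu : IsUnit P.det) (x : Matrix t s C) (hN : N = A + xᵀ * P * x)
    (hNi : Ni * N = 1) :
    (P - P * x * Ni * xᵀ * P).IsSymm ∧ IsUnit (P - P * x * Ni * xᵀ * P).det ∧
    Φ.toFun s A + Φ.toFun t P = Φ.toFun s N + Φ.toFun t (P - P * x * Ni * xᵀ * P) := by
  -- This congruence replaces `e` by `e + x`, whose Gram matrix is `N`; pivoting on `N` then splits
  -- it off.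
  obtain ⟨E, hE, hE'⟩ := FormRing.exists_elem_lower x
  have hS : (fromBlocks A 0 0 P).IsSymm := by
    simp [IsSymm, fromBlocks_transpose, hA.eq, hP.eq]
  have hu : IsUnit (fromBlocks A 0 0 P).det := by
    rw [det_fromBlocks_zero₂₁]; exact hAu.mul hPu
  have key : (E : Matrix (s ⊕ t) (s ⊕ t) C)ᵀ * fromBlocks A 0 0 P * E
      = fromBlocks N (xᵀ * P) (xᵀ * P)ᵀ P := by
    rw [hE', fromBlocks_transpose, fromBlocks_multiply, fromBlocks_multiply, hN]
    simp [hP.eq, Matrix.mul_assoc]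
  have hNs : N.IsSymm := by
    rw [hN]; simp [IsSymm, hA.eq, hP.eq, Matrix.mul_assoc]
  have hu' : IsUnit (fromBlocks N (xᵀ * P) (xᵀ * P)ᵀ P).det := by
    rw [← key, det_mul, det_mul, det_transpose]
    have hEu : IsUnit (E : Matrix (s ⊕ t) (s ⊕ t) C).det :=
      (isUnit_iff_isUnit_det _).1 E.isUnit
    exact (hEu.mul hu).mul hEu
  obtain ⟨h1, h2, h3⟩ := Φ.pivot hNs hNi hP hu'
  have e : P - (xᵀ * P)ᵀ * Ni * (xᵀ * P) = P - P * x * Ni * xᵀ * P := by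
    simp [hP.eq, Matrix.mul_assoc]
  rw [e] at h1 h2 h3
  exact ⟨h1, h2, by rw [← h3, ← key, Φ.congr _ _ hS hu E hE, Φ.sum _ _ _ _ hA hP hAu hPu]⟩

theorem diagonal_isSymm (u : C) : (diagonal fun _ : Unit => u).IsSymm := diagonal_transpose _

/-- By Whitehead's lemma `diag(a, a⁻¹)` is a product of elementary matrices, and it carries `⟨g⟩ ⊥
⟨a²⟩` to `⟨a² g⟩ ⊥ ⟨1⟩`. -/
theorem rankOne_sq_mul (a g : Cˣ) :
    Φ.rankOne (a ^ 2 * g : C) + Φ.rankOne 1 = Φ.rankOne (a ^ 2 : C) + Φ.rankOne g := by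
  obtain ⟨U, hU, hU'⟩ := FormRing.exists_elem_upper (s := Unit) (t := Unit)
    (diagonal fun _ => (a : C))
  obtain ⟨L, hL, hL'⟩ := FormRing.exists_elem_lower (s := Unit) (t := Unit)
    (diagonal fun _ => -((a⁻¹ : Cˣ) : C))
  obtain ⟨U₁, hU₁, hU₁'⟩ := FormRing.exists_elem_upper (s := Unit) (t := Unit)
    (diagonal fun _ => (-1 : C))
  obtain ⟨L₁, hL₁, hL₁'⟩ := FormRing.exists_elem_lower (s := Unit) (t := Unit)
    (diagonal fun _ => (1 : C))
  have hE : U * L * U * U₁ * L₁ * U₁ ∈ FormRing.elemGroup C (Unit ⊕ Unit) :=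
    mul_mem (mul_mem (mul_mem (mul_mem (mul_mem hU hL) hU) hU₁) hL₁) hU₁
  have hEv : ((U * L * U * U₁ * L₁ * U₁ : (Matrix (Unit ⊕ Unit) (Unit ⊕ Unit) C)ˣ) :
      Matrix (Unit ⊕ Unit) (Unit ⊕ Unit) C)
      = fromBlocks (diagonal fun _ => (a : C)) 0 0 (diagonal fun _ => ((a⁻¹ : Cˣ) : C)) := by
    simp only [Units.val_mul, hU', hL', hU₁', hL₁', fromBlocks_multiply]
    congr 1 <;> ext i j <;> simp
  have h1 : IsUnit (diagonal fun _ : Unit => (a ^ 2 : C)).det := by simp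
  have h2 : IsUnit (diagonal fun _ : Unit => (g : C)).det := by simp
  have h3 : IsUnit (diagonal fun _ : Unit => (a ^ 2 * g : C)).det := by simp
  have h4 : IsUnit (diagonal fun _ : Unit => (1 : C)).det := by simp
  rw [rankOne, rankOne, rankOne, rankOne, add_comm (Φ.toFun Unit (diagonal fun _ => (a ^ 2 : C))),
    ← Φ.sum _ _ _ _ (diagonal_isSymm _) (diagonal_isSymm _) h3 h4,
    ← Φ.sum _ _ _ _ (diagonal_isSymm _) (diagonal_isSymm _) h2 h1]
  have hS : (fromBlocks (diagonal fun _ : Unit => (g : C)) 0 0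
      (diagonal fun _ : Unit => (a ^ 2 : C))).IsSymm := by
    simp [IsSymm]
  rw [← Φ.congr _ _ hS (by rw [det_fromBlocks_zero₂₁]; exact h2.mul h1) _ hE, hEv]
  congr 1
  rw [fromBlocks_transpose, fromBlocks_multiply, fromBlocks_multiply]
  have hi : (a : C) * ((a⁻¹ : Cˣ) : C) = 1 := a.mul_inv
  congr 1
  · ext i j; simp; ring
  · ext i j; simp
  · ext i j; simp
  · ext i j
    simp only [diagonal_transpose, diagonal_mul_diagonal, zero_mul,
      Matrix.mul_zero, transpose_zero, zero_add, diagonal_apply]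
    simp
    linear_combination (-(1:C) - (a : C) * ((a⁻¹ : Cˣ) : C)) * hi

/-- A binary form written as a matrix. -/
def binary (α β γ : C) : Matrix (Unit ⊕ Unit) (Unit ⊕ Unit) C :=
  fromBlocks (diagonal fun _ => α) (diagonal fun _ => β) (diagonal fun _ => β)
    (diagonal fun _ => γ)

theorem binary_isSymm (α β γ : C) : (binary α β γ).IsSymm := by
  simp [IsSymm, binary, fromBlocks_transpose]

/-- The case of `sum_split` in which `e` has value `u` and `x` is the vector `(x, y)` of a binary
form: `n` is the value of the sum, and the primed coefficients are the Gram matrix of its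
complement. -/
theorem rankOne_add_binary {u n ni α β γ α' β' γ' : C} (hu : IsUnit u)
    (hP : IsUnit (binary α β γ).det) (x y : C)
    (hn : n = u + α * x ^ 2 + 2 * β * x * y + γ * y ^ 2) (hni : ni * n = 1)
    (hα : α' = α - (α * x + β * y) ^ 2 * ni)
    (hβ : β' = β - (α * x + β * y) * (β * x + γ * y) * ni)
    (hγ : γ' = γ - (β * x + γ * y) ^ 2 * ni) :
    IsUnit (binary α' β' γ').det ∧ Φ.rankOne u + Φ.toFun _ (binary α β γ)
      = Φ.rankOne n + Φ.toFun _ (binary α' β' γ') := by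
  let v : Matrix (Unit ⊕ Unit) Unit C := of fun i _ => Sum.elim (fun _ => x) (fun _ => y) i
  have e1 : (diagonal fun _ : Unit => n) = (diagonal fun _ : Unit => u)
      + vᵀ * binary α β γ * v := by
    ext i j
    simp [v, binary, Matrix.mul_apply, hn]
    ring
  have e2 : (diagonal fun _ : Unit => ni) * (diagonal fun _ : Unit => n) = 1 := by
    ext i j
    simp [hni]
  have e3 : binary α β γ - binary α β γ * v * (diagonal fun _ : Unit => ni) * vᵀ * binary α β γ
      = binary α' β' γ' := by
    rw [hα, hβ, hγ]
    ext (i | i) (j | j) <;> simp [v, binary, Matrix.mul_apply] <;> ring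
  have := Φ.sum_split (diagonal_isSymm u) (binary_isSymm α β γ) (by simpa using hu) hP v e1 e2
  rw [e3] at this
  exact this.2

/-- The vector `(1, 1)` has the invertible value `n`; its complement has rank one and is determined
by the determinant. -/
theorem binary_split {α β γ n ni δ : C} (hP : IsUnit (binary α β γ).det)
    (hn : n = α + 2 * β + γ) (hni : ni * n = 1) (hδ : δ = (α * γ - β ^ 2) * ni) :
    Φ.toFun _ (binary α β γ) = Φ.rankOne n + Φ.rankOne δ := by
  obtain ⟨E, hE, hE'⟩ := FormRing.exists_elem_lower (s := Unit) (t := Unit)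
    (diagonal fun _ => (1 : C))
  have key : (E : Matrix (Unit ⊕ Unit) (Unit ⊕ Unit) C)ᵀ * binary α β γ *
      (E : Matrix (Unit ⊕ Unit) (Unit ⊕ Unit) C)
      = fromBlocks (diagonal fun _ => n) (diagonal fun _ => β + γ) (diagonal fun _ => β + γ)ᵀ
        (diagonal fun _ => γ) := by
    rw [hE', hn]
    ext (i | i) (j | j) <;> simp [binary, Matrix.mul_apply, one_apply]
    ring
  have hu : IsUnit (fromBlocks (diagonal fun _ : Unit => n) (diagonal fun _ : Unit => β + γ)
      (diagonal fun _ => β + γ)ᵀ (diagonal fun _ => γ)).det := by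
    rw [← key, det_mul, det_mul, det_transpose]
    have hEu : IsUnit (E : Matrix (Unit ⊕ Unit) (Unit ⊕ Unit) C).det :=
      (isUnit_iff_isUnit_det _).1 E.isUnit
    exact (hEu.mul hP).mul hEu
  have e2 : (diagonal fun _ : Unit => ni) * (diagonal fun _ : Unit => n) = 1 := by
    ext i j
    simp [hni]
  rw [← Φ.congr _ _ (binary_isSymm α β γ) hP E hE, key,
    (Φ.pivot (diagonal_isSymm n) e2 (diagonal_isSymm γ) hu).2.2, rankOne, rankOne]
  congr 2
  ext i j
  simp [hδ]
  linear_combination (-γ) * hni + ni * γ * hn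

/-- A relation between diagonal forms of rank four. -/
theorem rankOne_quaternary (p q r e w v : Cˣ) (he : (e : C) = q + r - 1)
    (hw : (w : C) = p * e + r * (q - 1)) (hv : (v : C) = p + r - p * r) :
    Φ.rankOne p + Φ.rankOne q + Φ.rankOne r + Φ.rankOne (-1)
      = Φ.rankOne e + Φ.rankOne (w * e⁻¹ : Cˣ) + Φ.rankOne (-(q * v * w⁻¹) : Cˣ)
        + Φ.rankOne (p * r * v⁻¹ : Cˣ) := by
  have hei : ((e⁻¹ : Cˣ) : C) * e = 1 := e.inv_mul
  have hwi : ((w⁻¹ : Cˣ) : C) * w = 1 := w.inv_mul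
  have hvi : ((v⁻¹ : Cˣ) : C) * v = 1 := v.inv_mul
  have hqi : ((q⁻¹ : Cˣ) : C) * q = 1 := q.inv_mul
  have hr : IsUnit (diagonal fun _ : Unit => (r : C)).det := by simp
  have h1 : IsUnit (diagonal fun _ : Unit => (-1 : C)).det := by simp
  have e0 : fromBlocks (diagonal fun _ : Unit => (r : C)) 0 0 (diagonal fun _ : Unit => (-1 : C))
      = binary (r : C) 0 (-1) := by simp [binary]
  have hB : IsUnit (binary (r : C) 0 (-1)).det := by
    rw [← e0, det_fromBlocks_zero₂₁]; exact hr.mul h1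
  have s0 : Φ.toFun _ (binary (r : C) 0 (-1)) = Φ.rankOne r + Φ.rankOne (-1) := by
    rw [← e0, Φ.sum _ _ _ _ (diagonal_isSymm _) (diagonal_isSymm _) hr h1]; rfl
  have e3 : ((w * e⁻¹ : Cˣ) : C) = w * ((e⁻¹ : Cˣ) : C) := rfl
  have e4 : ((-(q * v * w⁻¹) : Cˣ) : C) = -(q * v * ((w⁻¹ : Cˣ) : C)) := by simp
  have e5 : ((p * r * v⁻¹ : Cˣ) : C) = p * r * ((v⁻¹ : Cˣ) : C) := rfl
  rw [e3, e4, e5]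
  generalize ((e⁻¹ : Cˣ) : C) = ei at *
  generalize ((w⁻¹ : Cˣ) : C) = wi at *
  generalize ((v⁻¹ : Cˣ) : C) = vi at *
  generalize ((q⁻¹ : Cˣ) : C) = qi at *
  have hpu := p.isUnit
  have hqu := q.isUnit
  rw [hw, hv, he]
  rw [hw, he] at hwi
  rw [he] at hei
  rw [hv] at hvi
  generalize (p : C) = p at *
  generalize (q : C) = q at *
  generalize (r : C) = r at *
  -- The vector `(1, 1, 1)` of `⟨q, r, -1⟩` has value `q + r - 1 = e`.
  obtain ⟨hB1, s1⟩ := Φ.rankOne_add_binary (n := q + r - 1) (ni := ei) (α' := r * (q - 1) * ei)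
    (β' := r * ei) (γ' := -(q + r) * ei) hqu hB 1 1 (by ring) hei
    (by linear_combination r * hei) (by ring) (by linear_combination -hei)
  -- The first basis vector of the new binary form has value `r (q - 1) / e`; added to the basis
  -- vector of `⟨p⟩` it gives `w / e`.
  obtain ⟨hB2, s2⟩ := Φ.rankOne_add_binary (u := p) (n := (p * (q + r - 1) + r * (q - 1)) * ei)
    (ni := wi * (q + r - 1)) (α' := r * (q - 1) * p * wi) (β' := r * p * wi)
    (γ' := -(q + r) * ei - r ^ 2 * ei * wi) hpu hB1 1 0
    (by linear_combination p * hei)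
    (by linear_combination wi * (p * (q + r - 1) + r * (q - 1)) * hei + hwi)
    (by linear_combination (r * (q - 1) * ei) * hwi - r * (q - 1) * p * wi * hei
          + (r * (q - 1)) ^ 2 * ei * wi * hei)
    (by linear_combination (r * ei) * hwi - r * p * wi * hei + r ^ 2 * (q - 1) * ei * wi * hei)
    (by linear_combination r ^ 2 * ei * wi * hei)
  -- The remaining binary form takes the value `-q v / w` at `(1, 1)` and has determinant `-p q r /
  -- w`, which leaves `p r / v`.
  have s3 := Φ.binary_split (n := -(q * (p + r - p * r) * wi))
    (ni := -(qi * vi * (p * (q + r - 1) + r * (q - 1)))) (δ := p * r * vi) hB2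
    (by linear_combination (-(q + r) * ei) * hwi + wi * ((q + r) * p + r * q) * hei)
    (by linear_combination (q * qi * vi * (p + r - p * r)) * hwi + q * qi * hvi + hqi)
    (by
      have hd : r * (q - 1) * p * wi * (-(q + r) * ei - r ^ 2 * ei * wi) - (r * p * wi) ^ 2
          = -(p * q * r * wi) := by
        linear_combination r * p * wi * ((q - 1) * (q + r) * ei - q) * hwi
          - r * p * wi ^ 2 * (q - 1) * ((q + r) * p + r * q) * hei
      rw [hd]
      linear_combination (-p * r * vi * q * qi) * hwi - p * r * vi * hqi)
  calc _ = Φ.rankOne p + (Φ.rankOne q + Φ.toFun _ (binary r 0 (-1))) := by rw [s0]; abel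
    _ = _ := by rw [s1, add_left_comm, s2, s3]; abel

end

end FormInvariant

/-! ### Squares of units and the defect. -/

namespace FormInvariant

section

variable {C K : Type*} [CommRing C] [AddCommGroup K] (Φ : FormInvariant C K)

theorem rankOne_sq_mul' (h1 : Φ.rankOne 1 = 0) (a g : Cˣ) :
    Φ.rankOne (a ^ 2 * g : Cˣ) = Φ.rankOne (a ^ 2 : Cˣ) + Φ.rankOne g := by
  have := Φ.rankOne_sq_mul a g
  rw [h1, add_zero] at this
  exact_mod_cast this

/-- On squares of units the invariant of rank one forms is a homomorphism. -/
def sqHom (h1 : Φ.rankOne 1 = 0) : Cˣ →* Multiplicative K where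
  toFun u := Multiplicative.ofAdd (Φ.rankOne (u ^ 2 : Cˣ))
  map_one' := by simp [h1]
  map_mul' u v := by
    rw [mul_pow, Φ.rankOne_sq_mul' h1, ofAdd_add]

/-- Twice the invariant of a rank one form, made insensitive to squares. -/
def defect (u : Cˣ) : K := (2 : ℕ) • Φ.rankOne u - Φ.rankOne (u ^ 2 : Cˣ)

/-- The factor `a²` contributes `2 Φ⟨a²⟩` to `2 Φ⟨a² g⟩` and `Φ⟨a⁴⟩ = 2 Φ⟨a²⟩` to `Φ⟨a⁴ g²⟩`; the
two cancel. -/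
theorem defect_sq_mul (h1 : Φ.rankOne 1 = 0) (a g : Cˣ) :
    Φ.defect (a ^ 2 * g) = Φ.defect g := by
  simp only [defect]
  rw [mul_pow, Φ.rankOne_sq_mul' h1, Φ.rankOne_sq_mul' h1, sq (a ^ 2), Φ.rankOne_sq_mul' h1]
  abel

/-- The correction `Φ⟨u²⟩` is a homomorphism in `u`, so its total over a diagonal form depends only
on the product of the entries. A relation between values of `Φ` with equal determinants therefore
passes to defects. -/
theorem defect_sum (h1 : Φ.rankOne 1 = 0) {a b c d a' b' c' d' : Cˣ}
    (h : Φ.rankOne a + Φ.rankOne b + Φ.rankOne c + Φ.rankOne d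
      = Φ.rankOne a' + Φ.rankOne b' + Φ.rankOne c' + Φ.rankOne d')
    (hp : a * b * c * d = a' * b' * c' * d') :
    Φ.defect a + Φ.defect b + Φ.defect c + Φ.defect d
      = Φ.defect a' + Φ.defect b' + Φ.defect c' + Φ.defect d' := by
  have e : ∀ u : Cˣ, Φ.defect u = (2 : ℕ) • Φ.rankOne u - (Φ.sqHom h1 u).toAdd := fun _ => rfl
  have h' := congrArg (fun u => (Φ.sqHom h1 u).toAdd) hp
  simp only [map_mul, toAdd_mul] at h'
  simp only [e]
  calc _ = (2 : ℕ) • (Φ.rankOne a + Φ.rankOne b + Φ.rankOne c + Φ.rankOne d)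
        - ((Φ.sqHom h1 a).toAdd + (Φ.sqHom h1 b).toAdd + (Φ.sqHom h1 c).toAdd
          + (Φ.sqHom h1 d).toAdd) := by abel
    _ = _ := by rw [h, h']; abel

theorem defect_one (h1 : Φ.rankOne 1 = 0) : Φ.defect 1 = 0 := by
  simp [defect, h1]

/-- At `q = r = 1` the quaternary relation reduces to `d(-1) = d(-p⁻¹) + d(p)`, and `-p⁻¹` differs
from `-p` by a square. -/
theorem defect_neg (h1 : Φ.rankOne 1 = 0) (p : Cˣ) :
    Φ.defect (-p) = Φ.defect (-1) - Φ.defect p := by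
  have h := Φ.rankOne_quaternary p 1 1 1 p 1 (by simp) (by simp) (by simp)
  have h' := Φ.defect_sum h1 (a := p) (b := 1) (c := 1) (d := -1) (a' := 1) (b' := p * 1⁻¹)
    (c' := -(1 * 1 * p⁻¹)) (d' := p * 1 * 1⁻¹) (by simpa using h) (by simp)
  have h'' : Φ.defect (-p) = Φ.defect (-p⁻¹) := by
    rw [← Φ.defect_sq_mul h1 p (-p⁻¹)]
    congr 1
    simp [sq]
  simp only [Φ.defect_one h1, inv_one, mul_one, one_mul] at h'
  rw [h'', eq_sub_iff_add_eq]
  have : Φ.defect p + Φ.defect (-1) = Φ.defect p + (Φ.defect (-p⁻¹) + Φ.defect p) := by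
    rw [add_zero, add_zero, zero_add] at h'
    rw [h']; abel
  exact (add_left_cancel this).symm

/-- The quaternary relation at `p = q = r = z`, applied to the invariant twisted by `u`. -/
theorem twist_defect_relation (h1 : Φ.rankOne 1 = 0) (u z e w v : Cˣ)
    (he : (e : C) = z + z - 1) (hw : (w : C) = z * e + z * (z - 1)) (hv : (v : C) = z + z - z * z) :
    Φ.defect (u * z) + Φ.defect (u * z) + Φ.defect (u * z) + Φ.defect (u * -1)
      = Φ.defect (u * e) + Φ.defect (u * (w * e⁻¹)) + Φ.defect (u * -(z * v * w⁻¹))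
        + Φ.defect (u * (z * z * v⁻¹)) := by
  have h := (Φ.twist u).rankOne_quaternary z z z e w v he hw hv
  simp only [twist_rankOne] at h
  refine Φ.defect_sum h1 (by simpa only [Units.val_mul, Units.val_neg, Units.val_one] using h) ?_
  simp only [mul_neg, mul_one, neg_mul, neg_inj]
  calc u * z * (u * z) * (u * z) * u
      = u * z * (u * z) * (u * z) * u * ((e * e⁻¹) * (w * w⁻¹) * (v * v⁻¹)) := by simp
    _ = _ := by simp only [mul_comm, mul_left_comm, mul_assoc]

/-- The invariants induced by a homomorphism. -/
def map {L : Type*} [AddCommGroup L] (g : K →+ L) : FormInvariant C L where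
  toFun s _ _ P := g (Φ.toFun s P)
  sum s t _ _ _ _ P Q hP hQ hp hq := by rw [Φ.sum s t P Q hP hQ hp hq, map_add]
  congr s _ _ P hP hp E hE := by rw [Φ.congr s P hP hp E hE]

end

/-! ### Rank one forms over `ℤ⟦X⟧` under rescaling of the variable. -/

section PowerSeries

open PowerSeries

variable {K : Type*} [AddCommGroup K] (Φ : FormInvariant ℤ⟦X⟧ K)

theorem isUnit_of_X_dvd_sub_one {u : ℤ⟦X⟧} (h : X ∣ u - 1) : IsUnit u := by
  rw [PowerSeries.isUnit_iff_constantCoeff]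
  have := (PowerSeries.X_dvd_iff).1 h
  rw [map_sub, map_one, sub_eq_zero] at this
  rw [this]; exact isUnit_one

/-- Precision `j + 1` is lowered to `j`. Write `u' = u z`. Modulo `(z - 1)²`, hence modulo `X ^ (j +
1)`, each unit on the right of `twist_defect_relation` is `u` or `-u z` up to the square of a unit.
The relation becomes `3 d(u z) + d(-u) = 3 d(u) + d(-u z)`, and `defect_neg` turns it into `4 (d(u
z) - d(u)) = 0`. -/
theorem defect_eq_of_dvd (h1 : Φ.rankOne 1 = 0) (h2 : ∀ x : K, (2 : ℕ) • x = 0 → x = 0) {j : ℕ}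
    (hj : 1 ≤ j) (H : ∀ u u' : ℤ⟦X⟧ˣ, X ^ (j + 1) ∣ (u - u' : ℤ⟦X⟧) → Φ.defect u = Φ.defect u')
    {u u' : ℤ⟦X⟧ˣ} (h : X ^ j ∣ (u' - u : ℤ⟦X⟧)) : Φ.defect u' = Φ.defect u := by
  obtain ⟨z, rfl⟩ : ∃ z, u' = u * z := ⟨u⁻¹ * u', by simp⟩
  have hz : X ^ j ∣ (z - 1 : ℤ⟦X⟧) := by
    have : (z - 1 : ℤ⟦X⟧) = ((u⁻¹ : ℤ⟦X⟧ˣ) : ℤ⟦X⟧) * ((u * z : ℤ⟦X⟧ˣ) - u) := by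
      rw [mul_sub, Units.val_mul, Units.inv_mul_cancel_left, Units.inv_mul]
    rw [this]; exact h.mul_left _
  have hX : X ∣ (z - 1 : ℤ⟦X⟧) := (dvd_pow_self _ (by omega)).trans hz
  have hz2 : X ^ (j + 1) ∣ ((z - 1) ^ 2 : ℤ⟦X⟧) := by
    rw [sq, pow_succ]; exact mul_dvd_mul hz hX
  obtain ⟨e, he⟩ : IsUnit (z + z - 1 : ℤ⟦X⟧) := isUnit_of_X_dvd_sub_one (by
    have : (z + z - 1 - 1 : ℤ⟦X⟧) = 2 * (z - 1) := by ring
    rw [this]; exact hX.mul_left _)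
  obtain ⟨w, hw⟩ : IsUnit (z * e + z * (z - 1) : ℤ⟦X⟧) := isUnit_of_X_dvd_sub_one (by
    have : (z * e + z * (z - 1) - 1 : ℤ⟦X⟧) = (3 * z + 1) * (z - 1) := by rw [he]; ring
    rw [this]; exact hX.mul_left _)
  obtain ⟨v, hv⟩ : IsUnit (z + z - z * z : ℤ⟦X⟧) := isUnit_of_X_dvd_sub_one (by
    have : (z + z - z * z - 1 : ℤ⟦X⟧) = (-(z - 1)) * (z - 1) := by ring
    rw [this]; exact hX.mul_left _)
  have hrel := Φ.twist_defect_relation h1 u z e w v he hw hv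
  have hei : ((e⁻¹ : ℤ⟦X⟧ˣ) : ℤ⟦X⟧) * e = 1 := e.inv_mul
  have hwi : ((w⁻¹ : ℤ⟦X⟧ˣ) : ℤ⟦X⟧) * w = 1 := w.inv_mul
  have hvi : ((v⁻¹ : ℤ⟦X⟧ˣ) : ℤ⟦X⟧) * v = 1 := v.inv_mul
  have hzi : ((z⁻¹ : ℤ⟦X⟧ˣ) : ℤ⟦X⟧) * z = 1 := z.inv_mul
  have c1 : Φ.defect (u * e) = Φ.defect u := by
    rw [← Φ.defect_sq_mul h1 z u]
    refine H _ _ ?_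
    have : ((u * e : ℤ⟦X⟧ˣ) - (z ^ 2 * u : ℤ⟦X⟧ˣ) : ℤ⟦X⟧) = (-u) * (z - 1) ^ 2 := by
      push_cast; rw [he]; ring
    rw [this]; exact hz2.mul_left _
  have c2 : Φ.defect (u * (w * e⁻¹)) = Φ.defect u := by
    rw [← Φ.defect_sq_mul h1 z u]
    refine H _ _ ?_
    have : ((u * (w * e⁻¹) : ℤ⟦X⟧ˣ) - (z ^ 2 * u : ℤ⟦X⟧ˣ) : ℤ⟦X⟧)
        = (-2 * u * z * (e⁻¹ : ℤ⟦X⟧ˣ)) * (z - 1) ^ 2 := by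
      push_cast; rw [hw]; rw [he] at hei ⊢
      linear_combination (z ^ 2 * u : ℤ⟦X⟧) * hei
    rw [this]; exact hz2.mul_left _
  have c3 : Φ.defect (u * -(z * v * w⁻¹)) = Φ.defect (-(u * z)) := by
    -- Modulo `(z - 1)²` one has `v ≡ 1` and `w ≡ z ^ 4`, so the square to be removed is `z ^ (-4)`.
    rw [← Φ.defect_sq_mul h1 (z⁻¹ ^ 2) (-(u * z))]
    refine H _ _ ?_
    have : ((u * -(z * v * w⁻¹) : ℤ⟦X⟧ˣ) - ((z⁻¹ ^ 2) ^ 2 * -(u * z) : ℤ⟦X⟧ˣ) : ℤ⟦X⟧)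
        = (u * z * (w⁻¹ : ℤ⟦X⟧ˣ) * (z⁻¹ : ℤ⟦X⟧ˣ) ^ 4 * (z ^ 4 - z ^ 2 - 2 * z)) * (z - 1) ^ 2 := by
      push_cast; rw [hv]; rw [hw, he] at hwi
      have hz4 : ((z⁻¹ : ℤ⟦X⟧ˣ) : ℤ⟦X⟧) ^ 4 * z ^ 4 = 1 := by rw [← mul_pow, hzi, one_pow]
      linear_combination (-((z⁻¹ : ℤ⟦X⟧ˣ) : ℤ⟦X⟧) ^ 4 * u * z) * hwi
        + (u * z * (w⁻¹ : ℤ⟦X⟧ˣ) * (2 * z - z ^ 2) : ℤ⟦X⟧) * hz4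
    rw [this]; exact hz2.mul_left _
  have c4 : Φ.defect (u * (z * z * v⁻¹)) = Φ.defect u := by
    rw [← Φ.defect_sq_mul h1 z u]
    refine H _ _ ?_
    have : ((u * (z * z * v⁻¹) : ℤ⟦X⟧ˣ) - (z ^ 2 * u : ℤ⟦X⟧ˣ) : ℤ⟦X⟧)
        = (u * z ^ 2 * (v⁻¹ : ℤ⟦X⟧ˣ)) * (z - 1) ^ 2 := by
      push_cast; rw [hv] at hvi
      linear_combination (u * z ^ 2 : ℤ⟦X⟧) * hvi
    rw [this]; exact hz2.mul_left _
  rw [c1, c2, c3, c4, mul_neg, mul_one, Φ.defect_neg h1 u, Φ.defect_neg h1 (u * z)] at hrel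
  have h4 : (2 : ℕ) • ((2 : ℕ) • (Φ.defect (u * z) - Φ.defect u)) = 0 := by
    have := sub_eq_zero.2 hrel
    rw [← this]; abel
  exact sub_eq_zero.1 (h2 _ (h2 _ h4))

/-- Downward induction on the precision: for `j ≥ m` the defect depends only on its argument modulo
`X ^ j` by `hm`, and `defect_eq_of_dvd` lowers `j` to `1`, where `u` may be replaced by `1`. -/
theorem defect_eq_zero (h1 : Φ.rankOne 1 = 0) (h2 : ∀ x : K, (2 : ℕ) • x = 0 → x = 0) {m : ℕ}
    (hm : ∀ u u' : ℤ⟦X⟧ˣ, X ^ m ∣ (u - u' : ℤ⟦X⟧) → Φ.rankOne u = Φ.rankOne u')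
    {u : ℤ⟦X⟧ˣ} (hu : X ∣ (u - 1 : ℤ⟦X⟧)) : Φ.defect u = 0 := by
  have key : ∀ i j : ℕ, 1 ≤ j → m ≤ i + j → ∀ u u' : ℤ⟦X⟧ˣ, X ^ j ∣ (u - u' : ℤ⟦X⟧) →
      Φ.defect u = Φ.defect u' := by
    intro i
    induction i with
    | zero =>
      intro j _ hj u u' h
      have h' : X ^ m ∣ (u - u' : ℤ⟦X⟧) := (pow_dvd_pow _ (by omega)).trans h
      have h'' : X ^ m ∣ ((u ^ 2 : ℤ⟦X⟧ˣ) - (u' ^ 2 : ℤ⟦X⟧ˣ) : ℤ⟦X⟧) := by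
        push_cast; rw [sq_sub_sq]; exact h'.mul_left _
      rw [defect, defect, hm _ _ h', hm _ _ h'']
    | succ i ih =>
      intro j hj hij u u' h
      exact Φ.defect_eq_of_dvd h1 h2 hj (ih (j + 1) (by omega) (by omega)) h
  rw [← Φ.defect_one h1]
  exact key m 1 le_rfl (by omega) u 1 (by simpa using hu)

theorem exists_pow_two_smul_defect (h1 : Φ.rankOne 1 = 0) {m : ℕ}
    (hm : ∀ u u' : ℤ⟦X⟧ˣ, X ^ m ∣ (u - u' : ℤ⟦X⟧) → Φ.rankOne u = Φ.rankOne u')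
    {u : ℤ⟦X⟧ˣ} (hu : X ∣ (u - 1 : ℤ⟦X⟧)) : ∃ e : ℕ, (2 ^ e : ℕ) • Φ.defect u = 0 := by
  -- Modulo the `2`-primary torsion `T` the group has no `2`-torsion left, so `defect_eq_zero`
  -- applies to the induced invariant.
  let T : AddSubgroup K :=
    { carrier := {x | ∃ e : ℕ, (2 ^ e : ℕ) • x = 0}
      zero_mem' := ⟨0, by simp⟩
      add_mem' := by
        rintro x y ⟨a, ha⟩ ⟨b, hb⟩
        refine ⟨a + b, ?_⟩
        rw [smul_add, pow_add, mul_comm, mul_smul, ha, mul_comm, mul_smul, hb, smul_zero,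
          smul_zero, add_zero]
      neg_mem' := by
        rintro x ⟨a, ha⟩
        exact ⟨a, by rw [smul_neg, ha, neg_zero]⟩ }
  let π : K →+ K ⧸ T := QuotientAddGroup.mk' T
  have h := (Φ.map π).defect_eq_zero (show π (Φ.rankOne 1) = 0 by rw [h1, map_zero]) (by
    intro x
    induction x using QuotientAddGroup.induction_on with
    | H x =>
      intro hx
      obtain ⟨e, he⟩ : (2 : ℕ) • x ∈ T := (QuotientAddGroup.eq_zero_iff _).1 hx
      refine (QuotientAddGroup.eq_zero_iff _).2 ⟨e + 1, ?_⟩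
      rw [pow_succ, mul_smul, he]) (fun u u' h => congrArg π (hm u u' h)) hu
  have h' : π (Φ.defect u) = 0 := by
    rw [← h]
    simp only [defect, map_sub, map_nsmul]
    rfl
  exact (QuotientAddGroup.eq_zero_iff _).1 h'

/-- With `X_pow_dvd_pow_sub` for the exponent `k ^ j`, this says that rescaling and taking the power
`k ^ j` both turn the leading term `c X ^ j` of `u - 1` into `k ^ j c X ^ j`. -/
theorem X_pow_dvd_rescale_sub {j : ℕ} {u : ℤ⟦X⟧} (k : ℕ) (h : X ^ j ∣ u - 1) :
    X ^ (j + 1) ∣ rescale (k : ℤ) u - 1 - (k ^ j : ℕ) • (u - 1) := by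
  rw [X_pow_dvd_iff] at h ⊢
  intro i hi
  rcases Nat.lt_succ_iff_lt_or_eq.1 hi with hi | rfl
  · have e := h i hi
    have e' : coeff i (rescale (k : ℤ) u - 1) = 0 := by
      have : rescale (k : ℤ) u - 1 = rescale (k : ℤ) (u - 1) := by simp
      rw [this, coeff_rescale, e, mul_zero]
    rw [map_sub, e', map_nsmul, e, smul_zero, sub_zero]
  · have : rescale (k : ℤ) u - 1 = rescale (k : ℤ) (u - 1) := by simp
    rw [map_sub, this, coeff_rescale, map_nsmul]
    simp

theorem X_pow_dvd_pow_sub {j : ℕ} (hj : 1 ≤ j) {u : ℤ⟦X⟧} (n : ℕ) (h : X ^ j ∣ u - 1) :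
    X ^ (j + 1) ∣ u ^ n - 1 - n • (u - 1) := by
  induction n with
  | zero => simp
  | succ n ih =>
    have : u ^ (n + 1) - 1 - (n + 1) • (u - 1)
        = u * (u ^ n - 1 - n • (u - 1)) + n • ((u - 1) * (u - 1)) := by
      simp only [nsmul_eq_mul]; push_cast; ring
    rw [this]
    refine dvd_add (ih.mul_left _) ?_
    rw [nsmul_eq_mul, pow_succ]
    exact (mul_dvd_mul h ((dvd_pow_self _ (by omega)).trans h)).mul_left _

/-- If `u ≡ 1` modulo `X ^ j` with `j ≥ 1`, then `u(k X) u ^ (-k ^ j) ≡ 1` modulo `X ^ (j + 1)`.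
Since `k` kills `Θ u`, the second factor does not affect `Θ`. Each application of `ψ` thus gains one
power of `X`, until `hm` makes the value trivial. -/
theorem iterate_eq_zero_of_torsion {Θ : ℤ⟦X⟧ˣ →* Multiplicative K} {ψ : K →+ K} {k m : ℕ}
    (hψ : ∀ u : ℤ⟦X⟧ˣ, ψ (Θ u).toAdd = (Θ (Units.map (rescale (k : ℤ)) u)).toAdd)
    (hm : ∀ u : ℤ⟦X⟧ˣ, X ^ m ∣ (u - 1 : ℤ⟦X⟧) → Θ u = 1) {s : ℤ⟦X⟧ˣ} (hs : X ∣ (s - 1 : ℤ⟦X⟧))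
    (hk : k • (Θ s).toAdd = 0) : ψ^[m] (Θ s).toAdd = 0 := by
  have key : ∀ j : ℕ, ∃ u : ℤ⟦X⟧ˣ, X ^ (j + 1) ∣ (u - 1 : ℤ⟦X⟧) ∧
      (Θ u).toAdd = ψ^[j] (Θ s).toAdd := by
    intro j
    induction j with
    | zero => exact ⟨s, by simpa using hs, rfl⟩
    | succ j ih =>
      obtain ⟨u, hu, hu'⟩ := ih
      have hku : k • (Θ u).toAdd = 0 := by
        rw [hu', ← iterate_map_nsmul, hk, iterate_map_zero]
      refine ⟨Units.map (rescale (k : ℤ)) u * (u ^ k ^ (j + 1))⁻¹, ?_, ?_⟩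
      · have e : ((Units.map (rescale (k : ℤ)) u * (u ^ k ^ (j + 1))⁻¹ : ℤ⟦X⟧ˣ) - 1 : ℤ⟦X⟧)
            = ((u ^ k ^ (j + 1))⁻¹ : ℤ⟦X⟧ˣ) *
              ((rescale (k : ℤ) (u : ℤ⟦X⟧) - 1 - (k ^ (j + 1) : ℕ) • (u - 1 : ℤ⟦X⟧)) -
              (u ^ k ^ (j + 1) - 1 - (k ^ (j + 1) : ℕ) • (u - 1 : ℤ⟦X⟧))) := by
          have hi : (((u ^ k ^ (j + 1))⁻¹ : ℤ⟦X⟧ˣ) : ℤ⟦X⟧) * (u : ℤ⟦X⟧) ^ k ^ (j + 1) = 1 := by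
            rw [← Units.val_pow_eq_pow_val, Units.inv_mul]
          rw [Units.val_mul, Units.coe_map]
          change rescale (k : ℤ) (u : ℤ⟦X⟧) * _ - 1 = _
          linear_combination hi
        rw [e]
        exact (dvd_sub (X_pow_dvd_rescale_sub k hu)
          (X_pow_dvd_pow_sub (by omega) _ hu)).mul_left _
      · rw [map_mul, map_inv, map_pow, toAdd_mul, toAdd_inv, toAdd_pow, pow_succ, mul_smul, hku,
          smul_zero, neg_zero, add_zero, ← hψ, hu', Function.iterate_succ_apply']
  obtain ⟨u, hu, hu'⟩ := key m
  rw [← hu', hm u ((pow_dvd_pow _ (by omega)).trans hu), toAdd_one]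

/-- With `y = X x`, the root is `1 - 2 p`, where `p = y + p²` defines the Catalan series in `y`,
which has integer coefficients. Iterating this fixed point equation gains a power of `X` at each
step. -/
theorem exists_sq_eq (x : ℤ⟦X⟧) (m : ℕ) :
    ∃ s : ℤ⟦X⟧, X ∣ s - 1 ∧ X ^ m ∣ s ^ 2 - (1 - 4 * (X * x)) := by
  have key : ∀ n : ℕ, ∃ p : ℤ⟦X⟧, X ∣ p ∧ X ^ (n + 1) ∣ p ^ 2 - p + X * x := by
    intro n
    induction n with
    | zero => exact ⟨0, dvd_zero _, by simp⟩
    | succ n ih =>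
      obtain ⟨p, hp, hp'⟩ := ih
      refine ⟨X * x + p ^ 2, dvd_add (dvd_mul_right _ _) (hp.trans (dvd_pow_self _ two_ne_zero)), ?_⟩
      have : (X * x + p ^ 2) ^ 2 - (X * x + p ^ 2) + X * x
          = (p ^ 2 - p + X * x) * (X * x + p ^ 2 + p) := by ring
      rw [this, pow_succ]
      exact mul_dvd_mul hp' (dvd_add (dvd_add (dvd_mul_right _ _)
        (hp.trans (dvd_pow_self _ two_ne_zero))) hp)
  obtain ⟨p, hp, hp'⟩ := key m
  refine ⟨1 - 2 * p, ?_, ?_⟩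
  · have : 1 - 2 * p - 1 = (-2) * p := by ring
    rw [this]; exact hp.mul_left _
  · have : (1 - 2 * p) ^ 2 - (1 - 4 * (X * x)) = 4 * (p ^ 2 - p + X * x) := by ring
    rw [this]; exact ((pow_dvd_pow _ (by omega)).trans hp').mul_left _

theorem exists_iterate_eq_zero (h1 : Φ.rankOne 1 = 0) {m : ℕ}
    (hm : ∀ u u' : ℤ⟦X⟧ˣ, X ^ m ∣ (u - u' : ℤ⟦X⟧) → Φ.rankOne u = Φ.rankOne u') {k : ℕ}
    {ψ : K →+ K} (hψ : ∀ u : ℤ⟦X⟧ˣ, ψ (Φ.rankOne u) = Φ.rankOne (rescale (k : ℤ) (u : ℤ⟦X⟧)))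
    (hk : k • Φ.rankOne (1 - X) = 0) : ∃ n, ψ^[n] (Φ.rankOne (1 - X)) = 0 := by
  have hψ' : ∀ u : ℤ⟦X⟧ˣ, ψ (Φ.sqHom h1 u).toAdd
      = (Φ.sqHom h1 (Units.map (rescale (k : ℤ)) u)).toAdd := by
    intro u
    refine (hψ (u ^ 2)).trans ?_
    simp [sqHom]
  have hm' : ∀ u : ℤ⟦X⟧ˣ, X ^ m ∣ (u - 1 : ℤ⟦X⟧) → Φ.sqHom h1 u = 1 := by
    intro u hu
    have : X ^ m ∣ ((u ^ 2 : ℤ⟦X⟧ˣ) - (1 : ℤ⟦X⟧ˣ) : ℤ⟦X⟧) := by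
      have e : ((u ^ 2 : ℤ⟦X⟧ˣ) - (1 : ℤ⟦X⟧ˣ) : ℤ⟦X⟧) = (u + 1) * (u - 1) := by push_cast; ring
      rw [e]; exact hu.mul_left _
    change Multiplicative.ofAdd _ = _
    rw [hm _ _ this, Units.val_one, h1]; rfl
  obtain ⟨z, hz⟩ : IsUnit (1 - X : ℤ⟦X⟧) := isUnit_of_X_dvd_sub_one ⟨-1, by ring⟩
  rw [← hz] at hk ⊢
  rcases Nat.even_or_odd k with ⟨l, hl⟩ | hodd
  -- For `k = 2 l`, two rescalings turn `1 - X` into `1 - 4 l² X`, a square modulo `X ^ m`; this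
  -- costs the two extra iterations of `ψ`.
  · obtain ⟨s, hs, hs'⟩ := exists_sq_eq ((l : ℤ⟦X⟧) ^ 2) m
    obtain ⟨s, rfl⟩ := isUnit_of_X_dvd_sub_one hs
    have e : ψ (ψ (Φ.rankOne z)) = (Φ.sqHom h1 s).toAdd := by
      have e1 := hψ (Units.map (rescale (k : ℤ)) z)
      rw [hψ]
      refine e1.trans ?_
      have e2 := hm (Units.map (rescale (k : ℤ)) (Units.map (rescale (k : ℤ)) z)) (s ^ 2) (by
        rw [← dvd_neg, neg_sub]
        convert hs' using 2
        · simp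
        · change rescale (k : ℤ) (rescale (k : ℤ) (z : ℤ⟦X⟧)) = _
          rw [hz, hl]
          simp only [map_sub, map_one, rescale_X, map_mul]
          simp
          ring)
      exact e2
    refine ⟨m + 2, ?_⟩
    rw [Function.iterate_add_apply]
    change ψ^[m] (ψ (ψ (Φ.rankOne z))) = 0
    rw [e]
    refine iterate_eq_zero_of_torsion hψ' hm' hs ?_
    rw [← e, ← map_nsmul, ← map_nsmul, hk, map_zero, map_zero]
  · have hzX : X ∣ (z - 1 : ℤ⟦X⟧) := by rw [hz]; exact ⟨-1, by ring⟩
    obtain ⟨e, he⟩ := Φ.exists_pow_two_smul_defect h1 hm hzX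
    -- For odd `k`, vanishing of `2 ^ e` times the defect makes `2 ^ (e + 1) Φ⟨z⟩` a value of the
    -- homomorphism. Hence `ψ^[m]` of `Φ⟨z⟩` is killed by `2 ^ (e + 1)` as well as by `k`.
    have he' : (Φ.sqHom h1 (z ^ 2 ^ e)).toAdd = (2 ^ (e + 1) : ℕ) • Φ.rankOne z := by
      rw [map_pow, toAdd_pow, pow_succ, mul_smul, eq_comm, ← sub_eq_zero, ← smul_sub]
      exact he
    have hX : X ∣ ((z ^ 2 ^ e : ℤ⟦X⟧ˣ) - 1 : ℤ⟦X⟧) := by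
      push_cast
      exact hzX.trans (by simpa using sub_dvd_pow_sub_pow (z : ℤ⟦X⟧) 1 (2 ^ e))
    have h := iterate_eq_zero_of_torsion hψ' hm' hX (by
      rw [he', smul_comm, hk, smul_zero])
    rw [he', iterate_map_nsmul] at h
    have h' : k • ψ^[m] (Φ.rankOne z) = 0 := by
      rw [← iterate_map_nsmul, hk, iterate_map_zero]
    have hc : Nat.Coprime (2 ^ (e + 1)) k := (Nat.coprime_two_left.2 hodd).pow_left _
    refine ⟨m, ?_⟩
    have ho := Nat.dvd_gcd (addOrderOf_dvd_of_nsmul_eq_zero h) (addOrderOf_dvd_of_nsmul_eq_zero h')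
    rw [hc.gcd_eq_one, Nat.dvd_one, AddMonoid.addOrderOf_eq_one_iff] at ho
    exact ho

end PowerSeries

end FormInvariant

/-! ### Homomorphisms on stable quadratic groups and commutativity of `K₁GQ`. -/

namespace FormRing

section StableHom

variable {R : Type*} [Ring R] [StarRing R]

/-- A compatible family of homomorphisms from the groups `GQ^λ` to a commutative group which
kills the elementary groups. -/
structure StableHom (F : FormRing R) (K : Type*) [CommGroup K] where
  hom : ∀ (ι : Type) [Fintype ι] [DecidableEq ι], F.GQ ι →* K
  map_EQ : ∀ (ι : Type) [Fintype ι] [DecidableEq ι] (σ : F.GQ ι), σ ∈ F.EQ ι → hom ι σ = 1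
  map_stab : ∀ (ι κ : Type) [Fintype ι] [DecidableEq ι] [Fintype κ] [DecidableEq κ] (f : ι ↪ κ)
    (σ : F.GQ ι), hom κ (F.stab f σ) = hom ι σ

/-- The upper half of `τ σ⁻¹` involves only the upper half of `τ`, so it equals that of `σ σ⁻¹ = 1`;
lower triangular quadratic matrices with identity upper left block are elementary. -/
theorem mul_inv_mem_EQ_of_upper_eq {F : FormRing R} {ι : Type*} [Fintype ι] [DecidableEq ι]
    {σ τ : F.GQ ι} (h₁ : (GQ.mat σ).toBlocks₁₁ = (GQ.mat τ).toBlocks₁₁)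
    (h₂ : (GQ.mat σ).toBlocks₁₂ = (GQ.mat τ).toBlocks₁₂) : τ * σ⁻¹ ∈ F.EQ ι := by
  refine mem_EQ_of_lower (one_mem (elemGroup R ι))
    (C := (GQ.mat (τ * σ⁻¹)).toBlocks₂₁) (D := (GQ.mat (τ * σ⁻¹)).toBlocks₂₂) ?_
  have h := GQ.mat_mul_inv σ
  rw [← fromBlocks_toBlocks (GQ.mat σ), ← fromBlocks_toBlocks (GQ.mat σ⁻¹), fromBlocks_multiply,
    ← fromBlocks_one, fromBlocks_inj, h₁, h₂] at h
  have e : GQ.mat (τ * σ⁻¹) = GQ.mat τ * GQ.mat σ⁻¹ := GQ.mat_mul _ _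
  rw [← fromBlocks_toBlocks (GQ.mat τ), ← fromBlocks_toBlocks (GQ.mat σ⁻¹), fromBlocks_multiply,
    h.1, h.2.1] at e
  rw [e]
  simp

theorem StableHom.eq_of_upper_eq {F : FormRing R} {K : Type*} [CommGroup K] (q : F.StableHom K)
    {ι : Type} [Fintype ι] [DecidableEq ι] {σ τ : F.GQ ι}
    (h₁ : (GQ.mat σ).toBlocks₁₁ = (GQ.mat τ).toBlocks₁₁)
    (h₂ : (GQ.mat σ).toBlocks₁₂ = (GQ.mat τ).toBlocks₁₂) : q.hom ι σ = q.hom ι τ := by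
  have := q.map_EQ ι _ (mul_inv_mem_EQ_of_upper_eq h₁ h₂)
  rw [map_mul, map_inv, mul_inv_eq_one] at this
  exact this.symm

theorem hyp_mem_EQ (F : FormRing R) {ι : Type*} [Fintype ι] [DecidableEq ι]
    {u : (Matrix ι ι R)ˣ} (hu : u ∈ elemGroup R ι) : F.hyp ι u ∈ F.EQ ι :=
  Subgroup.subset_closure (Or.inl (Or.inl ⟨u, hu, rfl⟩))

theorem exists_mem_EQ_swap {F : FormRing R} {ι κ : Type*} [Fintype ι] [DecidableEq ι] [Fintype κ]
    [DecidableEq κ] (f g : ι ↪ κ) (h : ∀ i j, f i ≠ g j) :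
    ∃ ε ∈ F.EQ κ, ∀ σ : F.GQ ι, ε * F.stab f σ = F.stab g σ * ε := by
  have h' : ∀ i j, g i ≠ f j := fun i j => (h j i).symm
  have hFF : ∀ X : Matrix ι κ R, (embMat R f)ᴴ * (embMat R f * X) = X := fun X => by
    rw [← Matrix.mul_assoc, embMat_star_mul, Matrix.one_mul]
  have hGG : ∀ X : Matrix ι κ R, (embMat R g)ᴴ * (embMat R g * X) = X := fun X => by
    rw [← Matrix.mul_assoc, embMat_star_mul, Matrix.one_mul]
  have hFG : ∀ X : Matrix ι κ R, (embMat R f)ᴴ * (embMat R g * X) = 0 := fun X => by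
    rw [← Matrix.mul_assoc, embMat_star_mul_of_disjoint _ _ h, Matrix.zero_mul]
  have hGF : ∀ X : Matrix ι κ R, (embMat R g)ᴴ * (embMat R f * X) = 0 := fun X => by
    rw [← Matrix.mul_assoc, embMat_star_mul_of_disjoint _ _ h', Matrix.zero_mul]
  let π : (Matrix κ κ R)ˣ := transv f g h' 1 * transv g f h (-1) * transv f g h' 1
  -- The signed permutation exchanging the two copies of `ι`. It equals its own inverse conjugate
  -- transpose, so the hyperbolic matrix is `diag(P, P)`; the sign disappears under conjugation.
  let P : Matrix κ κ R := 1 - embMat R f * (embMat R f)ᴴ - embMat R g * (embMat R g)ᴴ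
    + embMat R f * (embMat R g)ᴴ - embMat R g * (embMat R f)ᴴ
  have hπ : (π : Matrix κ κ R) = P := by
    simp only [π, P, transv, Units.val_mul, Matrix.mul_add, Matrix.add_mul, Matrix.mul_assoc,
      Matrix.mul_one, Matrix.one_mul, Matrix.mul_neg, Matrix.neg_mul, hFF, hGG, hFG, hGF,
      Matrix.mul_zero]
    abel
  have hπ' : ((π⁻¹ : (Matrix κ κ R)ˣ) : Matrix κ κ R)ᴴ = P := by
    change (((1 - embMat R f * 1 * (embMat R g)ᴴ) : Matrix κ κ R)
      * ((1 - embMat R g * -1 * (embMat R f)ᴴ) * (1 - embMat R f * 1 * (embMat R g)ᴴ)))ᴴ = _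
    simp only [P, conjTranspose_mul, conjTranspose_sub, conjTranspose_one, conjTranspose_neg,
      conjTranspose_zero,
      conjTranspose_conjTranspose, Matrix.mul_add, Matrix.add_mul, Matrix.mul_assoc,
      Matrix.mul_sub, Matrix.sub_mul,
      Matrix.mul_one, Matrix.one_mul, Matrix.mul_neg, Matrix.neg_mul, hFF, hGG, hFG, hGF,
      Matrix.mul_zero]
    abel
  refine ⟨F.hyp κ π, F.hyp_mem_EQ (mul_mem (mul_mem (transv_mem f g h' _) (transv_mem g f h _))
    (transv_mem f g h' _)), fun σ => GQ.ext_mat ?_⟩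
  rw [GQ.mat_mul, GQ.mat_mul, GQ.mat_hyp, hπ, hπ', GQ.mat_stab, GQ.mat_stab,
    ← fromBlocks_toBlocks (GQ.mat σ), extend_fromBlocks, extend_fromBlocks, fromBlocks_multiply,
    fromBlocks_multiply]
  have e1 : ∀ X : Matrix ι ι R, P * extend f X = extend g X * P := by
    intro X
    simp only [P, extend_apply, Matrix.mul_add, Matrix.add_mul, Matrix.mul_assoc,
      Matrix.mul_sub, Matrix.sub_mul, Matrix.mul_one, Matrix.one_mul, hFF, hGG, hFG, hGF,
      Matrix.mul_zero]
    abel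
  have e2 : ∀ X : Matrix ι ι R, P * (embMat R f * X * (embMat R f)ᴴ)
      = embMat R g * X * (embMat R g)ᴴ * P := by
    intro X
    simp only [P, Matrix.mul_add, Matrix.add_mul, Matrix.mul_assoc,
      Matrix.mul_sub, Matrix.sub_mul, Matrix.mul_one, Matrix.one_mul, hFF, hGG, hFG, hGF,
      Matrix.mul_zero]
    simp [embMat_star_mul_of_disjoint _ _ h', embMat_star_mul_of_disjoint _ _ h, embMat_star_mul]
  simp only [Matrix.zero_mul, Matrix.mul_zero, add_zero, zero_add, e1, e2]

theorem stab_comm {F : FormRing R} {ι μ κ : Type*} [Fintype ι] [DecidableEq ι] [Fintype κ]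
    [DecidableEq κ] [Fintype μ] [DecidableEq μ] (f : ι ↪ κ) (g : μ ↪ κ) (h : ∀ i j, f i ≠ g j)
    (σ : F.GQ ι) (τ : F.GQ μ) : F.stab f σ * F.stab g τ = F.stab g τ * F.stab f σ := by
  apply GQ.ext_mat
  rw [GQ.mat_mul, GQ.mat_mul, GQ.mat_stab, GQ.mat_stab, extend_apply, extend_apply]
  have d1 : (embMat R (f.sumMap f))ᴴ * embMat R (g.sumMap g) = 0 :=
    embMat_star_mul_of_disjoint _ _ (by rintro (i | i) (j | j) <;> simp [h])
  have d2 : (embMat R (g.sumMap g))ᴴ * embMat R (f.sumMap f) = 0 :=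
    embMat_star_mul_of_disjoint _ _ (by rintro (i | i) (j | j) <;> simp [(h _ _).symm])
  have e1 : ∀ X : Matrix (μ ⊕ μ) (κ ⊕ κ) R,
      (embMat R (f.sumMap f))ᴴ * (embMat R (g.sumMap g) * X) = 0 := fun X => by
    rw [← Matrix.mul_assoc, d1, Matrix.zero_mul]
  have e2 : ∀ X : Matrix (ι ⊕ ι) (κ ⊕ κ) R,
      (embMat R (g.sumMap g))ᴴ * (embMat R (f.sumMap f) * X) = 0 := fun X => by
    rw [← Matrix.mul_assoc, d2, Matrix.zero_mul]
  simp only [Matrix.mul_add, Matrix.add_mul, Matrix.mul_one, Matrix.one_mul, Matrix.mul_assoc,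
    e1, e2, Matrix.mul_zero]
  abel

end StableHom

section K1

variable {R : Type*} [Ring R] [StarRing R] (F : FormRing R)

theorem cls_eq_one {n : ℕ} {σ : F.GQ (Fin n)} (h : σ ∈ F.EQ (Fin n)) : F.cls n σ = 1 :=
  (QuotientGroup.eq_one_iff _).2 ⟨n, σ, h, rfl⟩

theorem cls_castLE {n m : ℕ} (h : n ≤ m) (σ : F.GQ (Fin n)) :
    F.cls m (F.stab (Fin.castLEEmb h) σ) = F.cls n σ := by
  simp only [cls, MonoidHom.comp_apply, toStable_stab]

variable {F}

theorem cls_stab_of_disjoint {ι : Type*} [Fintype ι] [DecidableEq ι] {n : ℕ} (f g : ι ↪ Fin n)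
    (h : ∀ i j, f i ≠ g j) (σ : F.GQ ι) : F.cls n (F.stab f σ) = F.cls n (F.stab g σ) := by
  obtain ⟨ε, hε, he⟩ := exists_mem_EQ_swap (F := F) f g h
  have := congrArg (F.cls n) (he σ)
  rwa [map_mul, map_mul, F.cls_eq_one hε, one_mul, mul_one] at this

/-- Both embeddings are compared with a third one whose image lies beyond theirs, to which the
disjoint case applies. -/
theorem cls_stab_eq {ι : Type*} [Fintype ι] [DecidableEq ι] {n m : ℕ} (f : ι ↪ Fin n)
    (g : ι ↪ Fin m) (σ : F.GQ ι) : F.cls n (F.stab f σ) = F.cls m (F.stab g σ) := by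
  let N := max n m
  let f' : ι ↪ Fin (N + Fintype.card ι) :=
    f.trans (Fin.castLEEmb ((le_max_left n m).trans (Nat.le_add_right _ _)))
  let g' : ι ↪ Fin (N + Fintype.card ι) :=
    g.trans (Fin.castLEEmb ((le_max_right n m).trans (Nat.le_add_right _ _)))
  let e : ι ↪ Fin (N + Fintype.card ι) := (Fintype.equivFin ι).toEmbedding.trans (Fin.natAddEmb N)
  have h1 : ∀ i j, f' i ≠ e j := by
    intro i j hij
    have := congrArg Fin.val hij
    simp [f', e] at this
    have := (f i).2
    omega
  have h2 : ∀ i j, g' i ≠ e j := by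
    intro i j hij
    have := congrArg Fin.val hij
    simp [g', e] at this
    have := (g i).2
    omega
  have e1 := cls_stab_of_disjoint f' e h1 σ
  have e2 := cls_stab_of_disjoint g' e h2 σ
  rw [stab_trans, cls_castLE] at e1 e2
  rw [e1, e2]

/-- Placed on disjoint sets of indices, the two matrices commute. -/
theorem cls_comm {n m : ℕ} (σ : F.GQ (Fin n)) (τ : F.GQ (Fin m)) :
    F.cls n σ * F.cls m τ = F.cls m τ * F.cls n σ := by
  have e1 := cls_stab_eq (Function.Embedding.refl _) (Fin.castAddEmb m) σ
  have e2 := cls_stab_eq (Function.Embedding.refl _) (Fin.natAddEmb n) τ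
  rw [stab_refl] at e1 e2
  rw [e1, e2, ← map_mul, ← map_mul, stab_comm]
  intro i j hij
  have := congrArg Fin.val hij
  simp at this
  omega

variable (F)

theorem exists_eq_cls (x : F.K1GQ) : ∃ (n : ℕ) (σ : F.GQ (Fin n)), x = F.cls n σ := by
  obtain ⟨y, rfl⟩ := QuotientGroup.mk'_surjective F.StableEQ x
  obtain ⟨n, σ, rfl⟩ : ∃ (n : ℕ) (σ : F.GQ (Fin n)), y = F.toStable n σ :=
    DirectLimit.exists_eq_mk (F := fun n : ℕ => F.GQ (Fin n))
      (f := fun _ _ h => F.stab (Fin.castLEEmb h)) y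
  exact ⟨n, σ, rfl⟩

/-- The group `K₁GQ` is commutative. -/
noncomputable abbrev commGroupK1 : CommGroup F.K1GQ :=
  { (inferInstance : Group F.K1GQ) with
    mul_comm := fun x y => by
      obtain ⟨n, σ, rfl⟩ := F.exists_eq_cls x
      obtain ⟨m, τ, rfl⟩ := F.exists_eq_cls y
      exact cls_comm σ τ }

attribute [local instance] commGroupK1

/-- The canonical maps to `K₁GQ^λ`. -/
noncomputable def toK1 : F.StableHom F.K1GQ where
  hom ι _ _ := (F.cls (Fintype.card ι)).comp (F.stab (Fintype.equivFin ι).toEmbedding)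
  map_EQ ι _ _ σ hσ := F.cls_eq_one (stab_EQ _ hσ)
  map_stab ι κ _ _ _ _ f σ := by
    simp only [MonoidHom.comp_apply]
    rw [← stab_trans]
    exact cls_stab_eq _ _ σ

theorem toK1_hom_fin (n : ℕ) (σ : F.GQ (Fin n)) : F.toK1.hom (Fin n) σ = F.cls n σ := by
  have := cls_stab_eq (Fintype.equivFin (Fin n)).toEmbedding (Function.Embedding.refl _) σ
  rwa [stab_refl] at this

end K1

end FormRing

/-! ### Functoriality in the form ring. -/

namespace FormRing

theorem map_elemGroup {R S : Type*} [Ring R] [Ring S] {ι : Type*} [Fintype ι] [DecidableEq ι]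
    (θ : R →+* S) {u : (Matrix ι ι R)ˣ} (hu : u ∈ elemGroup R ι) :
    Units.map θ.mapMatrix.toMonoidHom u ∈ elemGroup S ι := by
  have : elemGroup R ι ≤ (elemGroup S ι).comap (Units.map θ.mapMatrix.toMonoidHom) := by
    conv_lhs => unfold elemGroup
    rw [Subgroup.closure_le]
    rintro u ⟨i, j, r, hij, hu⟩
    refine Subgroup.subset_closure ⟨i, j, θ r, hij, ?_⟩
    change (u : Matrix ι ι R).map θ = _
    rw [hu]
    rw [Matrix.map_add _ (map_add θ), Matrix.map_one θ (map_zero θ) (map_one θ)]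
    congr 1
    exact Matrix.map_single i j r θ
  exact this hu

section Functoriality

variable {R S : Type*} [Ring R] [StarRing R] [Ring S] [StarRing S]

/-- Ring homomorphisms compatible with the form ring structures. -/
structure IsHom (F : FormRing R) (F' : FormRing S) (θ : R →+* S) : Prop where
  map_star : ∀ x, θ (star x) = star (θ x)
  map_lam : θ F.lam = F'.lam
  map_mem : ∀ x ∈ F.Lam, θ x ∈ F'.Lam

variable {F : FormRing R} {F' : FormRing S} {θ : R →+* S}

namespace IsHom

theorem map_conjTranspose (h : IsHom F F' θ) {m n : Type*} (M : Matrix m n R) :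
    (Mᴴ).map θ = (M.map θ)ᴴ := by
  ext i j
  simp [h.map_star]

theorem isHerm (h : IsHom F F' θ) {n : Type*} {M : Matrix n n R} (hM : F.IsHerm M) :
    F'.IsHerm (M.map θ) := by
  refine ⟨?_, fun i => h.map_mem _ (hM.2 i)⟩
  conv_lhs => rw [hM.1]
  ext i j
  simp [h.map_star, h.map_lam]

variable {ι κ : Type*} [Fintype ι] [DecidableEq ι] [Fintype κ] [DecidableEq κ]

theorem isQuad (h : IsHom F F' θ) {σ : Matrix (ι ⊕ ι) (ι ⊕ ι) R} (hσ : F.IsQuad σ) :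
    F'.IsQuad (σ.map θ) := by
  rw [isQuad_iff] at *
  have := h.isHerm hσ
  have e : (halfForm R ι).map θ = halfForm S ι := by
    simp [halfForm, fromBlocks_map]
  rw [Matrix.map_sub _ (map_sub θ), Matrix.map_mul, Matrix.map_mul, e,
    h.map_conjTranspose] at this
  exact this

/-- The homomorphism of quadratic groups induced by a homomorphism of form rings. -/
def mapGQ (h : IsHom F F' θ) (ι : Type*) [Fintype ι] [DecidableEq ι] : F.GQ ι →* F'.GQ ι :=
  MonoidHom.mk' (fun σ => ⟨⟨(GQ.mat σ).map θ, (GQ.mat σ⁻¹).map θ,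
      by rw [← Matrix.map_mul, GQ.mat_mul_inv, Matrix.map_one θ (map_zero θ) (map_one θ)],
      by
        have := GQ.mat_mul_inv σ⁻¹
        rw [inv_inv] at this
        rw [← Matrix.map_mul, this, Matrix.map_one θ (map_zero θ) (map_one θ)]⟩,
      h.isQuad (GQ.isQuad_mat σ)⟩)
    (fun _ _ => GQ.ext_mat Matrix.map_mul)

theorem mat_mapGQ (h : IsHom F F' θ) (σ : F.GQ ι) :
    GQ.mat (h.mapGQ ι σ) = (GQ.mat σ).map θ := rfl

theorem map_embMat (θ : R →+* S) (f : ι ↪ κ) : (embMat R f).map θ = embMat S f := by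
  ext i j
  simp only [embMat, map_apply, of_apply]
  split_ifs <;> simp

theorem mapGQ_stab (h : IsHom F F' θ) (f : ι ↪ κ) (σ : F.GQ ι) :
    h.mapGQ κ (F.stab f σ) = F'.stab f (h.mapGQ ι σ) := by
  apply GQ.ext_mat
  rw [mat_mapGQ, GQ.mat_stab, GQ.mat_stab, mat_mapGQ, extend_apply, extend_apply,
    Matrix.map_add _ (map_add θ), Matrix.map_mul, Matrix.map_mul, h.map_conjTranspose,
    map_embMat, Matrix.map_sub _ (map_sub θ), Matrix.map_one θ (map_zero θ) (map_one θ),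
    Matrix.map_one θ (map_zero θ) (map_one θ)]

theorem mapGQ_hyp (h : IsHom F F' θ) (u : (Matrix ι ι R)ˣ) :
    h.mapGQ ι (F.hyp ι u) = F'.hyp ι (Units.map θ.mapMatrix.toMonoidHom u) := by
  apply GQ.ext_mat
  rw [mat_mapGQ, GQ.mat_hyp, GQ.mat_hyp, fromBlocks_map, h.map_conjTranspose, ← map_inv]
  simp

theorem mapGQ_mem_EQ (h : IsHom F F' θ) {σ : F.GQ ι} (hσ : σ ∈ F.EQ ι) :
    h.mapGQ ι σ ∈ F'.EQ ι := by
  have : F.EQ ι ≤ (F'.EQ ι).comap (h.mapGQ ι) := by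
    conv_lhs => unfold EQ
    rw [Subgroup.closure_le]
    rintro σ ((⟨α, hα, rfl⟩ | ⟨β, hβ, hσ⟩) | ⟨γ, hγ, hσ⟩)
    · exact Subgroup.subset_closure (Or.inl (Or.inl ⟨_, map_elemGroup θ hα, h.mapGQ_hyp α⟩))
    · refine Subgroup.subset_closure (Or.inl (Or.inr ⟨β.map θ, ?_, ?_⟩))
      · rw [isHermBar_iff] at *
        rw [← h.map_conjTranspose]
        exact h.isHerm hβ
      · rw [mat_mapGQ, hσ, fromBlocks_map]; simp
    · refine Subgroup.subset_closure (Or.inr ⟨γ.map θ, h.isHerm hγ, ?_⟩)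
      rw [mat_mapGQ, hσ, fromBlocks_map]; simp
  exact this hσ

end IsHom

/-- The map of stable quadratic groups to `K₁` induced by a homomorphism of form rings. -/
noncomputable def IsHom.mapStableFun (h : IsHom F F' θ) : F.StableGQ → F'.K1GQ :=
  DirectLimit.lift (F := fun n : ℕ => F.GQ (Fin n))
    (fun _ _ h => F.stab (Fin.castLEEmb h)) (fun n σ => F'.cls n (h.mapGQ (Fin n) σ))
    (fun _ _ hij _ => by rw [h.mapGQ_stab]; exact (F'.cls_castLE hij _).symm)

theorem IsHom.mapStableFun_toStable (h : IsHom F F' θ) (n : ℕ) (σ : F.GQ (Fin n)) :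
    h.mapStableFun (F.toStable n σ) = F'.cls n (h.mapGQ (Fin n) σ) := rfl

theorem exists_eq_toStable (F : FormRing R) (x : F.StableGQ) :
    ∃ (n : ℕ) (σ : F.GQ (Fin n)), x = F.toStable n σ :=
  DirectLimit.exists_eq_mk (F := fun n : ℕ => F.GQ (Fin n))
    (f := fun _ _ h => F.stab (Fin.castLEEmb h)) x

/-- The homomorphism of stable quadratic groups to `K₁` induced by a homomorphism of form
rings. -/
noncomputable def IsHom.mapStable (h : IsHom F F' θ) : F.StableGQ →* F'.K1GQ :=
  MonoidHom.mk' h.mapStableFun (by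
    intro x y
    obtain ⟨n, σ, rfl⟩ := F.exists_eq_toStable x
    obtain ⟨m, τ, rfl⟩ := F.exists_eq_toStable y
    rw [← toStable_stab (le_max_left n m) σ, ← toStable_stab (le_max_right n m) τ, ← map_mul,
      h.mapStableFun_toStable, h.mapStableFun_toStable, h.mapStableFun_toStable, map_mul,
      map_mul])

/-- The homomorphism of `K₁`-groups induced by a homomorphism of form rings. -/
noncomputable def IsHom.mapK1 (h : IsHom F F' θ) : F.K1GQ →* F'.K1GQ :=
  QuotientGroup.lift F.StableEQ h.mapStable (by
      rintro _ ⟨n, ε, hε, rfl⟩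
      exact F'.cls_eq_one (h.mapGQ_mem_EQ hε))

theorem IsHom.mapK1_cls (h : IsHom F F' θ) (n : ℕ) (σ : F.GQ (Fin n)) :
    h.mapK1 (F.cls n σ) = F'.cls n (h.mapGQ (Fin n) σ) := rfl

attribute [local instance] commGroupK1

theorem IsHom.mapK1_toK1 (h : IsHom F F' θ) (ι : Type) [Fintype ι] [DecidableEq ι]
    (σ : F.GQ ι) : h.mapK1 (F.toK1.hom ι σ) = F'.toK1.hom ι (h.mapGQ ι σ) := by
  change h.mapK1 (F.cls _ (F.stab _ σ)) = F'.cls _ (F'.stab _ _)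
  rw [h.mapK1_cls, h.mapGQ_stab]

end Functoriality

/-! ### Form rings of matrices and flattening of block matrices. -/

section MatrixRing

variable {R : Type*} [Ring R] [StarRing R] (F : FormRing R)

/-- The form ring structure on the ring of square matrices. -/
def matrix (ι : Type*) [Fintype ι] [DecidableEq ι] : FormRing (Matrix ι ι R) where
  lam := F.lam • 1
  lam_central x := by rw [F.mul_lam_smul, Matrix.smul_mul, Matrix.one_mul, Matrix.mul_one]
  lam_mul_star := by
    rw [star_eq_conjTranspose, F.conjTranspose_lam_smul, Matrix.smul_mul, Matrix.one_mul,
      conjTranspose_one, smul_smul, F.lam_mul_star, one_smul]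
  Lam :=
    { carrier := {M | F.IsHerm M}
      zero_mem' := by simp [IsHerm]
      add_mem' := fun h h' => h.add h'
      neg_mem' := fun h => h.neg }
  min_le A := by
    change F.IsHerm _
    rw [Matrix.smul_mul, Matrix.one_mul, star_eq_conjTranspose]
    refine ⟨?_, fun i => by simpa using F.min_le (A i i)⟩
    rw [conjTranspose_sub, F.conjTranspose_lam_smul, conjTranspose_conjTranspose, smul_sub,
      smul_smul, F.lam_mul_star, one_smul, neg_sub]
  le_max A hA := by
    change F.IsHerm A at hA
    rw [Matrix.smul_mul, Matrix.one_mul, star_eq_conjTranspose, ← hA.1]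
  conj_mem X A hA := IsHerm.conj hA X

theorem matrix_mem {ι : Type*} [Fintype ι] [DecidableEq ι] {M : Matrix ι ι R} :
    M ∈ (F.matrix ι).Lam ↔ F.IsHerm M := Iff.rfl

theorem matrix_lam_mul {ι : Type*} [Fintype ι] [DecidableEq ι] (M : Matrix ι ι R) :
    (F.matrix ι).lam * M = F.lam • M := by
  change (F.lam • (1 : Matrix ι ι R)) * M = _
  rw [Matrix.smul_mul, Matrix.one_mul]

variable {F} {ι s t : Type*} [Fintype ι] [DecidableEq ι] [Fintype s] [DecidableEq s] [Fintype t]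
  [DecidableEq t]

/-- The equivalence flattening a block matrix with two by two block structure. -/
def sumProdFlatten (M : Matrix (s ⊕ s) (t ⊕ t) (Matrix ι ι R)) :
    Matrix (s × ι ⊕ s × ι) (t × ι ⊕ t × ι) R :=
  fromBlocks (comp _ _ _ _ _ M.toBlocks₁₁) (comp _ _ _ _ _ M.toBlocks₁₂)
    (comp _ _ _ _ _ M.toBlocks₂₁) (comp _ _ _ _ _ M.toBlocks₂₂)

theorem sumProdFlatten_eq (M : Matrix (s ⊕ s) (t ⊕ t) (Matrix ι ι R)) :
    sumProdFlatten M = (comp _ _ _ _ _ M).submatrix (Equiv.sumProdDistrib s s ι).symm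
      (Equiv.sumProdDistrib t t ι).symm := by
  ext (i | i) (j | j) <;> rfl

theorem comp_mul {l : Type*} (A : Matrix s t (Matrix ι ι R)) (B : Matrix t l (Matrix ι ι R)) :
    comp _ _ _ _ _ (A * B) = comp _ _ _ _ _ A * comp _ _ _ _ _ B := by
  ext i j
  simp [Matrix.mul_apply, Matrix.sum_apply, Fintype.sum_prod_type]

theorem comp_conjTranspose (A : Matrix s t (Matrix ι ι R)) :
    comp _ _ _ _ _ Aᴴ = (comp _ _ _ _ _ A)ᴴ := by
  ext i j
  simp [conjTranspose_apply, star_eq_conjTranspose]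

theorem isHerm_comp {M : Matrix s s (Matrix ι ι R)} (hM : (F.matrix ι).IsHerm M) :
    F.IsHerm (comp _ _ _ _ _ M) := by
  constructor
  · conv_lhs => rw [hM.1]
    ext i j
    simp only [comp_apply, Matrix.neg_apply, Matrix.smul_apply, smul_eq_mul, matrix_lam_mul,
      conjTranspose_apply, star_eq_conjTranspose]
  · rintro ⟨i, a⟩
    exact ((F.matrix_mem).1 (hM.2 i)).2 a

end MatrixRing

end FormRing

namespace FormRing

section Flatten

variable {R : Type*} [Ring R] [StarRing R] {F : FormRing R}
  {ι s t : Type*} [Fintype ι] [DecidableEq ι] [Fintype s] [DecidableEq s] [Fintype t]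
  [DecidableEq t]

theorem comp_one : comp _ _ _ _ _ (1 : Matrix s s (Matrix ι ι R)) = 1 := by
  ext ⟨i, a⟩ ⟨j, b⟩
  by_cases h : i = j <;> simp [one_apply, h]

theorem comp_add {l : Type*} (A B : Matrix s l (Matrix ι ι R)) :
    comp _ _ _ _ _ (A + B) = comp _ _ _ _ _ A + comp _ _ _ _ _ B := rfl

theorem comp_sub {l : Type*} (A B : Matrix s l (Matrix ι ι R)) :
    comp _ _ _ _ _ (A - B) = comp _ _ _ _ _ A - comp _ _ _ _ _ B := rfl

theorem comp_zero {l : Type*} : comp _ _ _ _ _ (0 : Matrix s l (Matrix ι ι R)) = 0 := rfl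

theorem sumProdFlatten_fromBlocks (a b c d : Matrix s s (Matrix ι ι R)) :
    sumProdFlatten (fromBlocks a b c d) = fromBlocks (comp _ _ _ _ _ a) (comp _ _ _ _ _ b)
      (comp _ _ _ _ _ c) (comp _ _ _ _ _ d) := rfl

theorem sumProdFlatten_one : sumProdFlatten (1 : Matrix (s ⊕ s) (s ⊕ s) (Matrix ι ι R)) = 1 := by
  rw [← fromBlocks_one, sumProdFlatten_fromBlocks, comp_one, comp_zero, fromBlocks_one]

theorem sumProdFlatten_sub (M N : Matrix (s ⊕ s) (s ⊕ s) (Matrix ι ι R)) :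
    sumProdFlatten (M - N) = sumProdFlatten M - sumProdFlatten N := by
  ext (i | i) (j | j) <;> rfl

theorem sumProdFlatten_mul (M N : Matrix (s ⊕ s) (s ⊕ s) (Matrix ι ι R)) :
    sumProdFlatten (M * N) = sumProdFlatten M * sumProdFlatten N := by
  rw [sumProdFlatten_eq, sumProdFlatten_eq, sumProdFlatten_eq, comp_mul, submatrix_mul_equiv]

theorem sumProdFlatten_conjTranspose (M : Matrix (s ⊕ s) (s ⊕ s) (Matrix ι ι R)) :
    sumProdFlatten Mᴴ = (sumProdFlatten M)ᴴ := by
  rw [sumProdFlatten_eq, sumProdFlatten_eq, comp_conjTranspose, conjTranspose_submatrix]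

theorem sumProdFlatten_halfForm :
    sumProdFlatten (halfForm (Matrix ι ι R) s) = halfForm R (s × ι) := by
  rw [halfForm, sumProdFlatten_fromBlocks, comp_one, comp_zero]
  rfl

theorem isHerm_sumProdFlatten {M : Matrix (s ⊕ s) (s ⊕ s) (Matrix ι ι R)}
    (hM : (F.matrix ι).IsHerm M) : F.IsHerm (sumProdFlatten M) := by
  obtain ⟨h1, h2⟩ := isHerm_comp hM
  rw [sumProdFlatten_eq]
  refine ⟨?_, fun i => h2 _⟩
  conv_lhs => rw [h1]
  rfl

theorem isQuad_sumProdFlatten {M : Matrix (s ⊕ s) (s ⊕ s) (Matrix ι ι R)}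
    (hM : (F.matrix ι).IsQuad M) : F.IsQuad (sumProdFlatten M) := by
  rw [isQuad_iff] at *
  have := isHerm_sumProdFlatten hM
  rw [← sumProdFlatten_conjTranspose, ← sumProdFlatten_halfForm, ← sumProdFlatten_mul,
    ← sumProdFlatten_mul, ← sumProdFlatten_sub]
  exact this

/-- The quadratic group over a matrix ring as a quadratic group over the ring. -/
def flatten (F : FormRing R) (ι s : Type*) [Fintype ι] [DecidableEq ι] [Fintype s]
    [DecidableEq s] : (F.matrix ι).GQ s →* F.GQ (s × ι) :=
  MonoidHom.mk' (fun σ => ⟨⟨sumProdFlatten (GQ.mat σ), sumProdFlatten (GQ.mat σ⁻¹),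
      by rw [← sumProdFlatten_mul, GQ.mat_mul_inv, sumProdFlatten_one],
      by
        have := GQ.mat_mul_inv σ⁻¹
        rw [inv_inv] at this
        rw [← sumProdFlatten_mul, this, sumProdFlatten_one]⟩,
      isQuad_sumProdFlatten (GQ.isQuad_mat σ)⟩)
    (fun _ _ => GQ.ext_mat (sumProdFlatten_mul _ _))

theorem mat_flatten (σ : (F.matrix ι).GQ s) :
    GQ.mat (F.flatten ι s σ) = sumProdFlatten (GQ.mat σ) := rfl

theorem comp_embMat (f : s ↪ t) :
    comp _ _ _ _ _ (embMat (Matrix ι ι R) f)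
      = embMat R (f.prodMap (Function.Embedding.refl ι)) := by
  ext ⟨i, a⟩ ⟨j, b⟩
  by_cases h : i = f j <;> simp [embMat, one_apply, h]

theorem comp_extend (f : s ↪ t) (A : Matrix s s (Matrix ι ι R)) :
    comp _ _ _ _ _ (extend f A)
      = extend (f.prodMap (Function.Embedding.refl ι)) (comp _ _ _ _ _ A) := by
  rw [extend_apply, extend_apply, comp_add, comp_one, comp_mul, comp_mul, comp_conjTranspose,
    comp_embMat, comp_sub, comp_one]

theorem flatten_stab (f : s ↪ t) (σ : (F.matrix ι).GQ s) :
    F.flatten ι t ((F.matrix ι).stab f σ)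
      = F.stab (f.prodMap (Function.Embedding.refl ι)) (F.flatten ι s σ) := by
  apply GQ.ext_mat
  rw [mat_flatten, GQ.mat_stab, GQ.mat_stab, mat_flatten, ← fromBlocks_toBlocks (GQ.mat σ),
    extend_fromBlocks, sumProdFlatten_fromBlocks, sumProdFlatten_fromBlocks, extend_fromBlocks]
  simp only [comp_mul, comp_conjTranspose, comp_embMat, comp_extend]

/-- Flattening of invertible matrices. -/
def compUnits (R ι s : Type*) [Ring R] [StarRing R] [Fintype ι] [DecidableEq ι] [Fintype s]
    [DecidableEq s] : (Matrix s s (Matrix ι ι R))ˣ →* (Matrix (s × ι) (s × ι) R)ˣ :=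
  Units.map
    { toFun := comp _ _ _ _ _
      map_one' := comp_one
      map_mul' := comp_mul }

theorem compUnits_mem_elemGroup {u : (Matrix s s (Matrix ι ι R))ˣ}
    (hu : u ∈ elemGroup (Matrix ι ι R) s) : compUnits R ι s u ∈ elemGroup R (s × ι) := by
  have : elemGroup (Matrix ι ι R) s ≤ (elemGroup R (s × ι)).comap (compUnits R ι s) := by
    conv_lhs => unfold elemGroup
    rw [Subgroup.closure_le]
    rintro u ⟨i, j, r, hij, hu⟩
    have h : ∀ a b : ι, Function.Embedding.sectR j ι a ≠ Function.Embedding.sectR i ι b := by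
      intro a b h
      exact hij (congrArg Prod.fst h).symm
    -- A transvection over the matrix ring is a block transvection over `R`, hence a product of
    -- ordinary ones.
    have e : compUnits R ι s u
        = transv (Function.Embedding.sectR i ι) (Function.Embedding.sectR j ι) h r := by
      apply Units.ext
      change comp _ _ _ _ _ (u : Matrix s s (Matrix ι ι R)) = 1 + _
      rw [hu, comp_add, comp_one]
      congr 1
      ext ⟨p, a⟩ ⟨q, b⟩
      simp only [comp_apply, single_apply, embMat, mul_apply, of_apply, conjTranspose_apply,
        Function.Embedding.sectR_apply, Prod.mk.injEq]
      by_cases hp : p = i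
      · by_cases hq : q = j
        · subst hp hq
          simp [apply_ite]
        · simp [hp, hq, Ne.symm hq]
      · simp [hp, Ne.symm hp]
    change compUnits R ι s u ∈ elemGroup R (s × ι)
    rw [e]
    exact transv_mem _ _ _ _
  exact this hu

theorem flatten_mem_EQ {σ : (F.matrix ι).GQ s} (hσ : σ ∈ (F.matrix ι).EQ s) :
    F.flatten ι s σ ∈ F.EQ (s × ι) := by
  have : (F.matrix ι).EQ s ≤ (F.EQ (s × ι)).comap (F.flatten ι s) := by
    conv_lhs => unfold EQ
    rw [Subgroup.closure_le]
    rintro σ ((⟨α, hα, rfl⟩ | ⟨β, hβ, hσ⟩) | ⟨γ, hγ, hσ⟩)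
    · refine Subgroup.subset_closure (Or.inl (Or.inl ⟨_, compUnits_mem_elemGroup hα, ?_⟩))
      apply GQ.ext_mat
      rw [mat_flatten, GQ.mat_hyp, GQ.mat_hyp, sumProdFlatten_fromBlocks, comp_conjTranspose,
        comp_zero, ← map_inv]
      rfl
    · refine Subgroup.subset_closure (Or.inl (Or.inr ⟨comp _ _ _ _ _ β, ?_, ?_⟩))
      · rw [isHermBar_iff] at *
        rw [← comp_conjTranspose]
        exact isHerm_comp hβ
      · rw [mat_flatten, hσ, sumProdFlatten_fromBlocks, comp_one, comp_zero]
    · refine Subgroup.subset_closure (Or.inr ⟨comp _ _ _ _ _ γ, isHerm_comp hγ, ?_⟩)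
      rw [mat_flatten, hσ, sumProdFlatten_fromBlocks, comp_one, comp_zero]
  exact this hσ

end Flatten

variable {R : Type*} [Ring R] [StarRing R] {F : FormRing R}

/-- The restriction of a stable homomorphism to the quadratic groups over a matrix ring. -/
def StableHom.matrix {K : Type*} [CommGroup K] (q : F.StableHom K) (ι : Type) [Fintype ι]
    [DecidableEq ι] : (F.matrix ι).StableHom K where
  hom s _ _ := (q.hom (s × ι)).comp (F.flatten ι s)
  map_EQ s _ _ _ hσ := q.map_EQ (s × ι) _ (flatten_mem_EQ hσ)
  map_stab s t _ _ _ _ f σ := by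
    rw [MonoidHom.comp_apply, MonoidHom.comp_apply, flatten_stab, q.map_stab]

end FormRing

/-! ### Approximating matrices of power series by matrices of polynomials. -/

section Truncation

open Polynomial PowerSeries

variable {s t : Type*}

/-- A matrix of polynomials agrees with a matrix of power series modulo `X ^ m`. -/
def Matrix.Approx (m : ℕ) (P : Matrix s t ℤ[X]) (S : Matrix s t ℤ⟦X⟧) : Prop :=
  ∃ U : Matrix s t ℤ⟦X⟧, P.map Polynomial.coeToPowerSeries.ringHom
    = S + (PowerSeries.X ^ m : ℤ⟦X⟧) • U

namespace Matrix.Approx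

variable {m : ℕ}

theorem sub_eq {P Q : Matrix s t ℤ[X]} {S : Matrix s t ℤ⟦X⟧} (hP : P.Approx m S)
    (hQ : Q.Approx m S) : ∃ Z : Matrix s t ℤ[X], Q = P + (Polynomial.X ^ m : ℤ[X]) • Z := by
  obtain ⟨U, hU⟩ := hP
  obtain ⟨V, hV⟩ := hQ
  have h : ∀ i j, ∃ z : ℤ[X], Q i j = P i j + Polynomial.X ^ m * z := by
    intro i j
    have h1 := congrFun (congrFun hU i) j
    have h2 := congrFun (congrFun hV i) j
    simp only [map_apply, add_apply, smul_apply, smul_eq_mul,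
      Polynomial.coeToPowerSeries.ringHom_apply] at h1 h2
    have h3 : (PowerSeries.X ^ m : ℤ⟦X⟧) ∣ ((Q i j - P i j : ℤ[X]) : ℤ⟦X⟧) :=
      ⟨V i j - U i j, by rw [Polynomial.coe_sub, h1, h2]; ring⟩
    obtain ⟨z, hz⟩ : (Polynomial.X ^ m : ℤ[X]) ∣ Q i j - P i j := by
      rw [PowerSeries.X_pow_dvd_iff] at h3
      rw [Polynomial.X_pow_dvd_iff]
      intro d hd
      rw [← Polynomial.coeff_coe]
      exact h3 d hd
    exact ⟨z, by rw [← hz]; ring⟩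
  choose Z hZ using h
  exact ⟨of Z, by ext1 i j; exact hZ i j⟩

theorem exists_approx (m : ℕ) (S : Matrix s t ℤ⟦X⟧) :
    (S.map (PowerSeries.trunc m)).Approx m S := by
  have h : ∀ i j, ∃ u : ℤ⟦X⟧, ((PowerSeries.trunc m (S i j) : ℤ[X]) : ℤ⟦X⟧)
      = S i j + PowerSeries.X ^ m * u := by
    intro i j
    have : (PowerSeries.X ^ m : ℤ⟦X⟧) ∣
        ((PowerSeries.trunc m (S i j) : ℤ[X]) : ℤ⟦X⟧) - S i j := by
      rw [PowerSeries.X_pow_dvd_iff]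
      intro d hd
      rw [map_sub, Polynomial.coeff_coe, PowerSeries.coeff_trunc, if_pos hd, sub_self]
    obtain ⟨u, hu⟩ := this
    exact ⟨u, by rw [← hu]; ring⟩
  choose U hU using h
  exact ⟨of U, by ext1 i j; exact hU i j⟩

theorem mul [Fintype t] {r : Type*} {P : Matrix s t ℤ[X]} {S : Matrix s t ℤ⟦X⟧}
    {Q : Matrix t r ℤ[X]} {T : Matrix t r ℤ⟦X⟧} (hP : P.Approx m S) (hQ : Q.Approx m T) :
    (P * Q).Approx m (S * T) := by
  obtain ⟨U, hU⟩ := hP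
  obtain ⟨V, hV⟩ := hQ
  refine ⟨U * T + S * V + (PowerSeries.X ^ m : ℤ⟦X⟧) • (U * V), ?_⟩
  rw [Matrix.map_mul, hU, hV]
  simp only [Matrix.add_mul, Matrix.mul_add, Matrix.smul_mul, Matrix.mul_smul, smul_add]
  abel

theorem transpose {P : Matrix s t ℤ[X]} {S : Matrix s t ℤ⟦X⟧} (hP : P.Approx m S) :
    Pᵀ.Approx m Sᵀ := by
  obtain ⟨U, hU⟩ := hP
  exact ⟨Uᵀ, by rw [transpose_map, hU]; rfl⟩

theorem one [DecidableEq s] : (1 : Matrix s s ℤ[X]).Approx m 1 :=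
  ⟨0, by rw [Matrix.map_one _ (map_zero _) (map_one _), smul_zero, add_zero]⟩

theorem inv [Fintype s] [DecidableEq s] {P Q : Matrix s s ℤ[X]} {S T : Matrix s s ℤ⟦X⟧}
    (hP : P.Approx m S) (hQP : Q * P = 1) (hST : S * T = 1) : Q.Approx m T := by
  obtain ⟨U, hU⟩ := hP
  let Q' := Q.map Polynomial.coeToPowerSeries.ringHom
  have h1 : Q' * P.map Polynomial.coeToPowerSeries.ringHom = 1 := by
    rw [← Matrix.map_mul, hQP, Matrix.map_one _ (map_zero _) (map_one _)]
  refine ⟨-(Q' * U * T), ?_⟩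
  rw [hU, Matrix.mul_add] at h1
  have h2 : Q' * S = 1 - Q' * ((PowerSeries.X ^ m : ℤ⟦X⟧) • U) := eq_sub_of_add_eq h1
  calc Q' = Q' * S * T := by rw [Matrix.mul_assoc, hST, Matrix.mul_one]
    _ = _ := by
      rw [h2, Matrix.sub_mul, Matrix.one_mul, Matrix.mul_smul, Matrix.smul_mul, smul_neg,
        sub_eq_add_neg]

theorem congr_right {P : Matrix s t ℤ[X]} {S T : Matrix s t ℤ⟦X⟧} (hP : P.Approx m S)
    (hST : ∀ i j, (PowerSeries.X ^ m : ℤ⟦X⟧) ∣ S i j - T i j) : P.Approx m T := by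
  obtain ⟨U, hU⟩ := hP
  choose V hV using hST
  refine ⟨U + of V, ?_⟩
  rw [hU]
  ext1 i j
  simp only [add_apply, smul_apply, of_apply, smul_eq_mul, mul_add, ← hV]
  ring

/-- Truncating an invertible matrix need not give an invertible polynomial matrix, but a
transvection truncates to a transvection, and products and inverses respect approximation. -/
theorem exists_elem [Fintype s] [DecidableEq s] (m : ℕ) {E : (Matrix s s ℤ⟦X⟧)ˣ}
    (hE : E ∈ FormRing.elemGroup ℤ⟦X⟧ s) : ∃ F ∈ FormRing.elemGroup ℤ[X] s,
      (F : Matrix s s ℤ[X]).Approx m (E : Matrix s s ℤ⟦X⟧) := by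
  unfold FormRing.elemGroup at hE
  induction hE using Subgroup.closure_induction with
  | mem E hE =>
    obtain ⟨i, j, r, hij, h⟩ := hE
    have hm : ∀ x y : ℤ[X], ((1 : Matrix s s ℤ[X]) + single i j x) * (1 + single i j y)
        = 1 + single i j (x + y) := by
      intro x y
      rw [Matrix.mul_add, Matrix.add_mul, Matrix.add_mul,
        single_mul_single_of_ne (h := hij.symm), single_add]
      simp only [Matrix.mul_one, Matrix.one_mul, add_zero]
      abel
    refine ⟨⟨1 + single i j (PowerSeries.trunc m r), 1 + single i j (-PowerSeries.trunc m r),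
      by rw [hm]; simp, by rw [hm]; simp⟩, Subgroup.subset_closure ⟨i, j, _, hij, rfl⟩, ?_⟩
    obtain ⟨U, hU⟩ := exists_approx m (single i j r)
    refine ⟨U, ?_⟩
    have e : (single i j r : Matrix s s ℤ⟦X⟧).map (PowerSeries.trunc m)
        = single i j (PowerSeries.trunc m r) := by
      ext1 a b
      simp only [map_apply, single_apply]
      split_ifs <;> simp
    rw [e] at hU
    rw [h, add_assoc, ← hU, Matrix.map_add _ (map_add _),
      Matrix.map_one _ (map_zero _) (map_one _)]
  | one => exact ⟨1, one_mem _, one⟩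
  | mul E E' _ _ h h' =>
    obtain ⟨F, hF, h⟩ := h
    obtain ⟨F', hF', h'⟩ := h'
    exact ⟨F * F', mul_mem hF hF', h.mul h'⟩
  | inv E _ h =>
    obtain ⟨F, hF, h⟩ := h
    exact ⟨F⁻¹, inv_mem hF, h.inv F.inv_mul E.mul_inv⟩

end Matrix.Approx

theorem FormRing.exists_elem_transpose {C : Type*} [CommRing C] [Fintype s] [DecidableEq s]
    {E : (Matrix s s C)ˣ} (hE : E ∈ FormRing.elemGroup C s) :
    ∃ F ∈ FormRing.elemGroup C s, (F : Matrix s s C) = (E : Matrix s s C)ᵀ := by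
  have h : ∀ E : (Matrix s s C)ˣ, ∃ F : (Matrix s s C)ˣ, (F : Matrix s s C) = (E : Matrix s s C)ᵀ :=
    fun E => ⟨⟨(E : Matrix s s C)ᵀ, ((E⁻¹ : (Matrix s s C)ˣ) : Matrix s s C)ᵀ,
      by rw [← transpose_mul, Units.inv_mul, transpose_one],
      by rw [← transpose_mul, Units.mul_inv, transpose_one]⟩, rfl⟩
  unfold FormRing.elemGroup at hE
  induction hE using Subgroup.closure_induction with
  | mem E hE =>
    obtain ⟨i, j, r, hij, hE⟩ := hE
    obtain ⟨F, hF⟩ := h E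
    refine ⟨F, Subgroup.subset_closure ⟨j, i, r, hij.symm, ?_⟩, hF⟩
    rw [hF, hE, transpose_add, transpose_one, transpose_single]
  | one => exact ⟨1, one_mem _, by simp⟩
  | mul E E' _ _ h h' =>
    obtain ⟨F, hF, h⟩ := h
    obtain ⟨F', hF', h'⟩ := h'
    exact ⟨F' * F, mul_mem hF' hF, by rw [Units.val_mul, h, h', Units.val_mul, transpose_mul]⟩
  | inv E _ h =>
    obtain ⟨F, hF, h⟩ := h
    refine ⟨F⁻¹, inv_mem hF, ?_⟩
    have h1 : ((E⁻¹ : (Matrix s s C)ˣ) : Matrix s s C)ᵀ * F = 1 := by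
      rw [h, ← transpose_mul, Units.mul_inv, transpose_one]
    exact Units.inv_eq_of_mul_eq_one_left h1

end Truncation

/-! ### Hermitian blocks and triangular quadratic matrices. -/

namespace FormRing

section Blocks

variable {A : Type*} [Ring A] [StarRing A] {G : FormRing A}

theorem isHerm_of_isSymm {s : Type*} {M : Matrix s s A} (hM : M.IsSymm)
    (h : ∀ i j, M i j ∈ G.Lam) : G.IsHerm M := by
  refine ⟨?_, fun i => h i i⟩
  ext i j
  have := G.le_max _ (h i j)
  rw [Matrix.neg_apply, Matrix.smul_apply, conjTranspose_apply, hM.apply i j]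
  exact this

theorem isHerm_fromBlocks {s t : Type*} {P : Matrix s s A} {Q : Matrix s t A} {S : Matrix t s A}
    {T : Matrix t t A} (hP : G.IsHerm P) (hT : G.IsHerm T) (hQ : Q = -(G.lam • Sᴴ)) :
    G.IsHerm (fromBlocks P Q S T) := by
  refine ⟨?_, by rintro (i | i); exacts [hP.2 i, hT.2 i]⟩
  have hS : S = -(G.lam • Qᴴ) := by
    rw [hQ, conjTranspose_neg, G.conjTranspose_lam_smul, conjTranspose_conjTranspose, smul_neg,
      smul_smul, G.lam_mul_star, one_smul, neg_neg]
  rw [fromBlocks_conjTranspose, fromBlocks_smul, fromBlocks_neg, ← hP.1, ← hT.1, ← hQ, ← hS]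

variable {s : Type*} [Fintype s] [DecidableEq s]

theorem isQuad_fromBlocks {P Q S T : Matrix s s A} (h₁ : G.IsHerm (Pᴴ * S))
    (h₂ : G.IsHerm (Qᴴ * T)) (h₃ : Pᴴ * T - 1 = -(G.lam • (Qᴴ * S)ᴴ)) :
    G.IsQuad (fromBlocks P Q S T) := by
  rw [isQuad_iff]
  have := isHerm_fromBlocks h₁ h₂ h₃
  simpa [halfForm, fromBlocks_conjTranspose, fromBlocks_multiply, sub_eq_add_neg,
    fromBlocks_neg, fromBlocks_add] using this

/-- The matrix `T₂₁(γ)`. -/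
def lowerT (G : FormRing A) (γ : Matrix s s A) (hγ : G.IsHerm γ) : G.GQ s :=
  ⟨⟨fromBlocks 1 0 γ 1, fromBlocks 1 0 (-γ) 1, by simp [fromBlocks_multiply],
    by simp [fromBlocks_multiply]⟩,
    isQuad_fromBlocks (by simpa using hγ) (by simp [IsHerm]) (by simp)⟩

theorem mat_lowerT (γ : Matrix s s A) (hγ : G.IsHerm γ) :
    GQ.mat (G.lowerT γ hγ) = fromBlocks 1 0 γ 1 := rfl

theorem lowerT_mem (γ : Matrix s s A) (hγ : G.IsHerm γ) : G.lowerT γ hγ ∈ G.EQ s :=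
  Subgroup.subset_closure (Or.inr ⟨γ, hγ, rfl⟩)

/-- The matrix `T₁₂(β)`. -/
def upperT (G : FormRing A) (β : Matrix s s A) (hβ : G.IsHerm βᴴ) : G.GQ s :=
  ⟨⟨fromBlocks 1 β 0 1, fromBlocks 1 (-β) 0 1, by simp [fromBlocks_multiply],
    by simp [fromBlocks_multiply]⟩,
    isQuad_fromBlocks (by simp [IsHerm]) (by simpa using hβ) (by simp)⟩

theorem mat_upperT (β : Matrix s s A) (hβ : G.IsHerm βᴴ) :
    GQ.mat (G.upperT β hβ) = fromBlocks 1 β 0 1 := rfl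

theorem upperT_mem (β : Matrix s s A) (hβ : G.IsHerm βᴴ) : G.upperT β hβ ∈ G.EQ s :=
  Subgroup.subset_closure (Or.inl (Or.inr ⟨β, isHermBar_iff.2 hβ, rfl⟩))

end Blocks

end FormRing

namespace FormRing

section Sum

variable {A : Type*} [Ring A] [StarRing A] {s t : Type*} [Fintype s] [DecidableEq s] [Fintype t]
  [DecidableEq t]

theorem embMat_inl_eq : embMat A (Function.Embedding.inl : s ↪ s ⊕ t) = fromRows 1 0 := by
  ext (i | i) j <;> simp [embMat, one_apply]

theorem embMat_inr_eq : embMat A (Function.Embedding.inr : t ↪ s ⊕ t) = fromRows 0 1 := by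
  ext (i | i) j <;> simp [embMat, one_apply]

theorem extend_inl (X : Matrix s s A) :
    extend (Function.Embedding.inl : s ↪ s ⊕ t) X = fromBlocks X 0 0 1 := by
  rw [extend_apply, embMat_inl_eq, conjTranspose_fromRows_eq_fromCols_conjTranspose,
    fromRows_mul, fromRows_mul_fromCols, ← fromBlocks_one, fromBlocks_add]
  simp

theorem extend_inr (X : Matrix t t A) :
    extend (Function.Embedding.inr : t ↪ s ⊕ t) X = fromBlocks 1 0 0 X := by
  rw [extend_apply, embMat_inr_eq, conjTranspose_fromRows_eq_fromCols_conjTranspose,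
    fromRows_mul, fromRows_mul_fromCols, ← fromBlocks_one, fromBlocks_add]
  simp

end Sum

/-! ### The form invariant attached to a row of Mennicke type. -/

/-- Elements `a`, `b`, `c` such that `(1 - a, b)` is the first row of a quadratic matrix of
Mennicke type. -/
structure MennickeRow {A : Type*} [Ring A] [StarRing A] (G : FormRing A) where
  a : A
  b : A
  c : A
  m : ℕ
  b_mem : ∀ i : ℕ, star (a ^ i * b) ∈ G.Lam
  c_mem : ∀ i : ℕ, c * a ^ i ∈ G.Lam
  b_mul_c : b * c = a ^ m

namespace MennickeRow

open Polynomial PowerSeries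

variable {A : Type*} [Ring A] [StarRing A] {G : FormRing A} (D : G.MennickeRow)

theorem star_b : star D.b = -(G.lam * D.b) := by
  simpa using G.le_max _ (D.b_mem 0)

theorem star_c : star D.c = -(star G.lam * D.c) := by
  have h := G.le_max _ (D.c_mem 0)
  rw [pow_zero, mul_one] at h
  conv_rhs => rw [h]
  rw [mul_neg, neg_neg, ← mul_assoc, G.star_lam_mul, one_mul]

theorem lam_mul_cancel {x y : A} (h : G.lam * x = G.lam * y) : x = y := by
  have := congrArg (star G.lam * ·) h
  simpa only [← mul_assoc, G.star_lam_mul, one_mul] using this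

/-- Both `b` and `a b` satisfy `x* = -λ x`, and comparing the two gives the intertwining relation.
It is what moves polynomials in `a` past `b`, turning them into polynomials in `a*`. -/
theorem a_mul_b : D.a * D.b = D.b * star D.a := by
  have h := G.le_max _ (D.b_mem 1)
  rw [pow_one, star_star, star_mul, D.star_b, neg_mul, neg_inj, mul_assoc] at h
  exact (lam_mul_cancel h).symm

theorem c_mul_a : D.c * D.a = star D.a * D.c := by
  have h := G.le_max _ (D.c_mem 1)
  rw [pow_one, star_mul, D.star_c, mul_neg, mul_neg, neg_neg, ← mul_assoc (star D.a),
    ← G.star_lam_central, mul_assoc (star G.lam), ← mul_assoc, G.lam_mul_star, one_mul] at h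
  exact h

theorem c_mul_b : D.c * D.b = star D.a ^ D.m := by
  have h := congrArg star D.b_mul_c
  rw [star_mul, star_pow, D.star_b, D.star_c, neg_mul_neg, G.star_lam_central, mul_assoc,
    ← mul_assoc (star G.lam), G.star_lam_mul, one_mul] at h
  exact h

/-- Evaluation of a matrix of polynomials at `a`. -/
noncomputable def ev {s : Type*} [Fintype s] [DecidableEq s] : Matrix s s ℤ[X] →+* Matrix s s A :=
  (aeval (R := ℤ) D.a).toRingHom.mapMatrix

/-- Evaluation of a matrix of polynomials at `star a`. -/
noncomputable def evStar {s : Type*} [Fintype s] [DecidableEq s] :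
    Matrix s s ℤ[X] →+* Matrix s s A :=
  (aeval (R := ℤ) (star D.a)).toRingHom.mapMatrix

theorem star_aeval (p : ℤ[X]) : star (aeval D.a p) = aeval (star D.a) p := by
  induction p using Polynomial.induction_on' with
  | add p q hp hq => simp [hp, hq]
  | monomial n r =>
    simp only [aeval_monomial, star_mul, star_pow, eq_intCast, star_intCast]
    exact (Int.cast_commute r _).eq.symm

theorem aeval_mul_b (p : ℤ[X]) : aeval D.a p * D.b = D.b * aeval (star D.a) p := by
  have h : ∀ n : ℕ, D.a ^ n * D.b = D.b * star D.a ^ n := fun n =>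
    (SemiconjBy.pow_right (show SemiconjBy D.b (star D.a) D.a from D.a_mul_b.symm) n).eq.symm
  induction p using Polynomial.induction_on' with
  | add p q hp hq => simp [hp, hq, add_mul, mul_add]
  | monomial n r =>
    simp only [aeval_monomial, eq_intCast]
    rw [mul_assoc, h, ← mul_assoc, ← mul_assoc, (Int.cast_commute r D.b).eq]

theorem c_mul_aeval (p : ℤ[X]) : D.c * aeval D.a p = aeval (star D.a) p * D.c := by
  have h : ∀ n : ℕ, D.c * D.a ^ n = star D.a ^ n * D.c := fun n =>
    (SemiconjBy.pow_right (show SemiconjBy D.c D.a (star D.a) from D.c_mul_a) n).eq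
  induction p using Polynomial.induction_on' with
  | add p q hp hq => simp [hp, hq, add_mul, mul_add]
  | monomial n r =>
    simp only [aeval_monomial, eq_intCast]
    rw [mul_assoc, ← h, ← mul_assoc, ← mul_assoc, (Int.cast_commute r D.c).eq]

theorem star_aeval_mul_b_mem (p : ℤ[X]) : star (aeval D.a p * D.b) ∈ G.Lam := by
  induction p using Polynomial.induction_on' with
  | add p q hp hq => rw [map_add, add_mul, star_add]; exact G.Lam.add_mem hp hq
  | monomial n r =>
    have : star (aeval D.a (monomial n r) * D.b) = r • star (D.a ^ n * D.b) := by
      simp only [aeval_monomial, eq_intCast, zsmul_eq_mul, mul_assoc]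
      rw [star_mul, star_intCast]
      exact (Int.cast_commute r _).eq.symm
    rw [this]
    exact G.Lam.zsmul_mem (D.b_mem n) r

theorem c_mul_aeval_mem (p : ℤ[X]) : D.c * aeval D.a p ∈ G.Lam := by
  induction p using Polynomial.induction_on' with
  | add p q hp hq => rw [map_add, mul_add]; exact G.Lam.add_mem hp hq
  | monomial n r =>
    have : D.c * aeval D.a (monomial n r) = r • (D.c * D.a ^ n) := by
      simp only [aeval_monomial, eq_intCast, zsmul_eq_mul]
      rw [← mul_assoc, ← (Int.cast_commute r D.c).eq, mul_assoc]
    rw [this]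
    exact G.Lam.zsmul_mem (D.c_mem n) r

variable {s t : Type*} [Fintype s] [DecidableEq s] [Fintype t] [DecidableEq t]

/-- The scalar matrix `b`. -/
def diagB (s : Type*) [DecidableEq s] : Matrix s s A := diagonal fun _ => D.b

/-- The scalar matrix `c`. -/
def diagC (s : Type*) [DecidableEq s] : Matrix s s A := diagonal fun _ => D.c

theorem ev_apply (P : Matrix s s ℤ[X]) (i j : s) : D.ev P i j = aeval D.a (P i j) := rfl

theorem evStar_apply (P : Matrix s s ℤ[X]) (i j : s) :
    D.evStar P i j = aeval (star D.a) (P i j) := rfl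

theorem conjTranspose_ev (P : Matrix s s ℤ[X]) : (D.ev P)ᴴ = D.evStar Pᵀ := by
  ext i j
  rw [conjTranspose_apply, ev_apply, evStar_apply, star_aeval, transpose_apply]

theorem ev_mul_diagB (P : Matrix s s ℤ[X]) : D.ev P * D.diagB s = D.diagB s * D.evStar P := by
  ext i j
  rw [diagB, mul_diagonal, diagonal_mul, ev_apply, evStar_apply, aeval_mul_b]

theorem diagC_mul_ev (P : Matrix s s ℤ[X]) : D.diagC s * D.ev P = D.evStar P * D.diagC s := by
  ext i j
  rw [diagC, mul_diagonal, diagonal_mul, ev_apply, evStar_apply, c_mul_aeval]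

theorem ev_smul (Y : Matrix s s ℤ[X]) :
    D.ev ((Polynomial.X ^ D.m : ℤ[X]) • Y) = D.diagB s * D.diagC s * D.ev Y := by
  ext i j
  rw [diagB, diagC, diagonal_mul_diagonal, diagonal_mul, ev_apply, ev_apply, D.b_mul_c,
    Matrix.smul_apply, smul_eq_mul, map_mul, map_pow, aeval_X]

theorem evStar_smul (Y : Matrix s s ℤ[X]) :
    D.evStar ((Polynomial.X ^ D.m : ℤ[X]) • Y) = D.diagC s * D.diagB s * D.evStar Y := by
  ext i j
  rw [diagB, diagC, diagonal_mul_diagonal, diagonal_mul, evStar_apply, evStar_apply, D.c_mul_b,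
    Matrix.smul_apply, smul_eq_mul, map_mul, map_pow, aeval_X]

theorem isHerm_diagC_mul_ev {P : Matrix s s ℤ[X]} (hP : P.IsSymm) :
    G.IsHerm (D.diagC s * D.ev P) := by
  refine isHerm_of_isSymm ?_ fun i j => ?_
  · ext i j
    rw [transpose_apply, diagC, diagonal_mul, diagonal_mul, ev_apply, ev_apply, hP.apply]
  · rw [diagC, diagonal_mul, ev_apply]
    exact D.c_mul_aeval_mem _

theorem isHerm_conjTranspose_diagB_mul {P : Matrix s s ℤ[X]} (hP : P.IsSymm) :
    G.IsHerm ((D.diagB s)ᴴ * D.evStar P) := by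
  have e : ∀ i j, ((D.diagB s)ᴴ * D.evStar P) i j = star (aeval D.a (P i j) * D.b) := by
    intro i j
    rw [diagB, diagonal_conjTranspose, diagonal_mul, evStar_apply, ← star_aeval, star_mul]
    rfl
  refine isHerm_of_isSymm ?_ fun i j => ?_
  · ext i j
    rw [transpose_apply, e, e, hP.apply]
  · rw [e]
    exact D.star_aeval_mul_b_mem _

/-- The completed matrix has rows `(P(a), b)` and `(c Y(a), H(a*))`. As `H` inverts `P` only modulo
`X ^ m`, the error `X ^ m Y` evaluates to `b c Y(a)`, which the lower left corner compensates. -/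
theorem exists_GQ {P H Y : Matrix s s ℤ[X]} (hP : P.IsSymm) (hH : H.IsSymm)
    (hY : H * P = 1 + (Polynomial.X ^ D.m : ℤ[X]) • Y) :
    -- The lower half is left out of the conclusion because the class does not depend on it.
    ∃ σ : G.GQ s, (GQ.mat σ).toBlocks₁₁ = D.ev P ∧ (GQ.mat σ).toBlocks₁₂ = D.diagB s := by
  -- Since `X ^ m` is not a zero divisor in `ℤ[X]`, the identities for `Y` follow from associativity
  -- of `P H P` and `H P H`.
  have hX : ∀ {M N : Matrix s s ℤ[X]},
      (Polynomial.X ^ D.m : ℤ[X]) • M = (Polynomial.X ^ D.m : ℤ[X]) • N → M = N := by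
    intro M N h
    ext1 i j
    exact mul_left_cancel₀ (pow_ne_zero _ Polynomial.X_ne_zero) (congrFun (congrFun h i) j)
  have hY' : P * H = 1 + (Polynomial.X ^ D.m : ℤ[X]) • Yᵀ := by
    have := congrArg Matrix.transpose hY
    rwa [transpose_mul, hP.eq, hH.eq, transpose_add, transpose_one, transpose_smul] at this
  have hPY : P * Y = Yᵀ * P := by
    apply hX
    have h1 : P * (H * P) = P * H * P := (Matrix.mul_assoc _ _ _).symm
    rw [hY, hY'] at h1
    simpa [Matrix.mul_add, Matrix.add_mul] using h1
  have hYH : Y * H = H * Yᵀ := by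
    apply hX
    have h1 : H * P * H = H * (P * H) := Matrix.mul_assoc _ _ _
    rw [hY, hY'] at h1
    simpa [Matrix.mul_add, Matrix.add_mul] using h1
  have hPYs : (P * Y).IsSymm := by
    rw [IsSymm, transpose_mul, hP.eq, hPY]
  have e1 : D.ev P * D.ev H = 1 + D.diagB s * D.diagC s * D.ev Yᵀ := by
    rw [← map_mul, hY', map_add, map_one, ev_smul]
  have e2 : D.ev H * D.ev P = 1 + D.diagB s * D.diagC s * D.ev Y := by
    rw [← map_mul, hY, map_add, map_one, ev_smul]
  have e3 : D.evStar P * D.evStar H = 1 + D.diagC s * D.diagB s * D.evStar Yᵀ := by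
    rw [← map_mul, hY', map_add, map_one, evStar_smul]
  have e4 : D.evStar H * D.evStar P = 1 + D.diagC s * D.diagB s * D.evStar Y := by
    rw [← map_mul, hY, map_add, map_one, evStar_smul]
  have c1 : D.evStar H * (D.diagC s * D.ev Yᵀ) = D.diagC s * D.ev Y * D.ev H := by
    rw [← Matrix.mul_assoc, ← diagC_mul_ev, Matrix.mul_assoc, Matrix.mul_assoc, ← map_mul,
      ← map_mul, hYH]
  have c2 : D.evStar P * (D.diagC s * D.ev Y) = D.diagC s * D.ev Yᵀ * D.ev P := by
    rw [← Matrix.mul_assoc, ← diagC_mul_ev, Matrix.mul_assoc, Matrix.mul_assoc, ← map_mul,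
      ← map_mul, hPY]
  have c3 : ∀ Z : Matrix s s ℤ[X],
      D.diagC s * D.ev Z * D.diagB s = D.diagC s * D.diagB s * D.evStar Z := by
    intro Z
    rw [Matrix.mul_assoc, ev_mul_diagB, Matrix.mul_assoc]
  refine ⟨⟨⟨fromBlocks (D.ev P) (D.diagB s) (D.diagC s * D.ev Y) (D.evStar H),
    fromBlocks (D.ev H) (-D.diagB s) (-(D.diagC s * D.ev Yᵀ)) (D.evStar P), ?_, ?_⟩, ?_⟩,
    toBlocks_fromBlocks₁₁ _ _ _ _, toBlocks_fromBlocks₁₂ _ _ _ _⟩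
  · rw [fromBlocks_multiply, ← fromBlocks_one]
    congr 1
    · rw [e1, Matrix.mul_neg, Matrix.mul_assoc]; abel
    · rw [Matrix.mul_neg, ev_mul_diagB]; abel
    · rw [Matrix.mul_neg, c1]; abel
    · rw [Matrix.mul_neg, c3, e4]; abel
  · rw [fromBlocks_multiply, ← fromBlocks_one]
    congr 1
    · rw [e2, Matrix.neg_mul, Matrix.mul_assoc]; abel
    · rw [Matrix.neg_mul, ev_mul_diagB]; abel
    · rw [Matrix.neg_mul, c2]; abel
    · rw [Matrix.neg_mul, c3, e3]; abel
  · refine isQuad_fromBlocks ?_ (D.isHerm_conjTranspose_diagB_mul hH) ?_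
    · rw [conjTranspose_ev, hP.eq, ← Matrix.mul_assoc, ← diagC_mul_ev, Matrix.mul_assoc,
        ← map_mul]
      exact D.isHerm_diagC_mul_ev hPYs
    · have h : (D.diagB s)ᴴ * (D.diagC s * D.ev Y)
          = -(G.lam • D.ev ((Polynomial.X ^ D.m : ℤ[X]) • Y)) := by
        rw [ev_smul, diagB, diagC, diagonal_conjTranspose, ← Matrix.mul_assoc,
          diagonal_mul_diagonal, diagonal_mul_diagonal]
        ext i j
        simp only [diagonal_mul, Matrix.neg_apply, Matrix.smul_apply, smul_eq_mul, Pi.star_apply,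
          D.star_b]
        simp only [neg_mul, mul_assoc]
      rw [h, conjTranspose_neg, G.conjTranspose_lam_smul, smul_neg, smul_smul, G.lam_mul_star,
        one_smul, neg_neg, conjTranspose_ev, conjTranspose_ev, hP.eq, e3, transpose_smul, evStar_smul]
      abel

/-- The matrix `σ` has first row `(P(a), b)` with `P` symmetric and `P` congruent to `S`. -/
def Rep (σ : G.GQ s) (S : Matrix s s ℤ⟦X⟧) : Prop :=
  ∃ P : Matrix s s ℤ[X], P.IsSymm ∧ P.Approx D.m S ∧
    (GQ.mat σ).toBlocks₁₁ = D.ev P ∧ (GQ.mat σ).toBlocks₁₂ = D.diagB s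

theorem exists_rep {S : Matrix s s ℤ⟦X⟧} (hS : S.IsSymm) (hu : IsUnit S.det) :
    ∃ σ : G.GQ s, D.Rep σ S := by
  have hT : S⁻¹.IsSymm := by rw [IsSymm, transpose_nonsing_inv, hS.eq]
  -- `S⁻¹` and `S` are truncated separately; the truncations are inverse to each other modulo `X ^
  -- m`, which is all that `exists_GQ` needs.
  have h := (Approx.exists_approx D.m S⁻¹).mul (Approx.exists_approx D.m S)
  rw [nonsing_inv_mul _ hu] at h
  obtain ⟨Y, hY⟩ := Approx.one.sub_eq h
  have hs : ∀ {T : Matrix s s ℤ⟦X⟧}, T.IsSymm → (T.map (PowerSeries.trunc D.m)).IsSymm := by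
    intro T h
    rw [IsSymm, ← transpose_map, h.eq]
  obtain ⟨σ, h1, h2⟩ := D.exists_GQ (hs hS) (hs hT) hY
  exact ⟨σ, _, hs hS, Approx.exists_approx D.m S, h1, h2⟩

variable {D}

theorem Rep.congr_right {σ : G.GQ s} {S T : Matrix s s ℤ⟦X⟧} (h : D.Rep σ S)
    (hST : ∀ i j, (PowerSeries.X ^ D.m : ℤ⟦X⟧) ∣ S i j - T i j) : D.Rep σ T := by
  obtain ⟨P, h1, h2, h3⟩ := h
  exact ⟨P, h1, h2.congr_right hST, h3⟩

/-- Since `a ^ m = b c`, adding `X ^ m Z` to the polynomial matrix adds `b` times the Hermitian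
matrix `c Z(a)` to the block, which is right multiplication by a `T₂₁`. -/
theorem Rep.exists_row {σ : G.GQ s} {S : Matrix s s ℤ⟦X⟧} (hσ : D.Rep σ S)
    {Q : Matrix s s ℤ[X]} (hQ : Q.IsSymm) (hQS : Q.Approx D.m S) :
    ∃ ε ∈ G.EQ s, (GQ.mat (σ * ε)).toBlocks₁₁ = D.ev Q ∧
      (GQ.mat (σ * ε)).toBlocks₁₂ = D.diagB s := by
  obtain ⟨P, hP, hPS, h1, h2⟩ := hσ
  obtain ⟨Z, hZ⟩ := hPS.sub_eq hQS
  have hZs : Z.IsSymm := by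
    ext1 i j
    have e1 := congrFun (congrFun hZ i) j
    have e2 := congrFun (congrFun hZ j) i
    rw [Matrix.add_apply, Matrix.smul_apply, smul_eq_mul] at e1 e2
    rw [hQ.apply, hP.apply, e1] at e2
    exact (mul_left_cancel₀ (pow_ne_zero _ Polynomial.X_ne_zero) (add_left_cancel e2)).symm
  have hγ := D.isHerm_diagC_mul_ev hZs
  refine ⟨_, lowerT_mem _ hγ, ?_, ?_⟩
  · rw [GQ.mat_mul, mat_lowerT, ← fromBlocks_toBlocks (GQ.mat σ), fromBlocks_multiply,
      toBlocks_fromBlocks₁₁, h1, h2, hZ, map_add, ev_smul, Matrix.mul_one, Matrix.mul_assoc]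
  · rw [GQ.mat_mul, mat_lowerT, ← fromBlocks_toBlocks (GQ.mat σ), fromBlocks_multiply,
      toBlocks_fromBlocks₁₂, h1, h2, Matrix.mul_zero, Matrix.mul_one, zero_add]

theorem Rep.eq {K : Type*} [CommGroup K] (q : G.StableHom K) {s : Type} [Fintype s]
    [DecidableEq s] {σ τ : G.GQ s} {S : Matrix s s ℤ⟦X⟧} (hσ : D.Rep σ S) (hτ : D.Rep τ S) :
    q.hom s σ = q.hom s τ := by
  obtain ⟨Q, hQ, hQS, h3, h4⟩ := hτ
  obtain ⟨ε, hε, h1, h2⟩ := hσ.exists_row hQ hQS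
  have := q.eq_of_upper_eq (h1.trans h3.symm) (h2.trans h4.symm)
  rwa [map_mul, q.map_EQ _ _ hε, mul_one] at this

/-- Let `F` be an elementary polynomial approximation of `E`. Multiplying by `H(Fᵀ(a))` on the left
and `H(F(a))` on the right replaces `P` by `Fᵀ P F`, while the corner becomes `Fᵀ(a) b (F(a)*)⁻¹ =
b` because `b` intertwines `a` and `a*`. -/
theorem Rep.congr {K : Type*} [CommGroup K] (q : G.StableHom K) {s : Type} [Fintype s]
    [DecidableEq s] {σ : G.GQ s} {S : Matrix s s ℤ⟦X⟧} (hσ : D.Rep σ S) {E : (Matrix s s ℤ⟦X⟧)ˣ}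
    (hE : E ∈ elemGroup ℤ⟦X⟧ s) :
    ∃ τ : G.GQ s, D.Rep τ ((E : Matrix s s ℤ⟦X⟧)ᵀ * S * (E : Matrix s s ℤ⟦X⟧)) ∧
      q.hom s τ = q.hom s σ := by
  obtain ⟨P, hP, hPS, h1, h2⟩ := hσ
  obtain ⟨F, hF, hFE⟩ := Approx.exists_elem D.m hE
  obtain ⟨F', hF', hFF'⟩ := exists_elem_transpose hF
  let φ : (Matrix s s ℤ[X])ˣ →* (Matrix s s A)ˣ :=
    Units.map (aeval (R := ℤ) D.a).toRingHom.mapMatrix.toMonoidHom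
  have hφ : ∀ {u}, u ∈ elemGroup ℤ[X] s → q.hom s (G.hyp s (φ u)) = 1 := fun hu =>
    q.map_EQ _ _ (G.hyp_mem_EQ (map_elemGroup _ hu))
  have hφv : ∀ u, ((φ u : (Matrix s s A)ˣ) : Matrix s s A) = D.ev (u : Matrix s s ℤ[X]) :=
    fun _ => rfl
  refine ⟨G.hyp s (φ F') * σ * G.hyp s (φ F), ⟨(F : Matrix s s ℤ[X])ᵀ * P * F, ?_,
    (hFE.transpose.mul hPS).mul hFE, ?_, ?_⟩, ?_⟩
  · rw [IsSymm, transpose_mul, transpose_mul, transpose_transpose, hP.eq, Matrix.mul_assoc]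
  · rw [GQ.mat_mul, GQ.mat_mul, GQ.mat_hyp, GQ.mat_hyp, ← fromBlocks_toBlocks (GQ.mat σ),
      fromBlocks_multiply, fromBlocks_multiply, toBlocks_fromBlocks₁₁, h1, hφv, hφv, hFF',
      map_mul, map_mul]
    simp
  · have e : D.evStar (F : Matrix s s ℤ[X])ᵀ
        * (((φ F)⁻¹ : (Matrix s s A)ˣ) : Matrix s s A)ᴴ = 1 := by
      rw [← conjTranspose_ev, ← hφv, ← conjTranspose_mul, Units.inv_mul, conjTranspose_one]
    rw [GQ.mat_mul, GQ.mat_mul, GQ.mat_hyp, GQ.mat_hyp, ← fromBlocks_toBlocks (GQ.mat σ),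
      fromBlocks_multiply, fromBlocks_multiply, toBlocks_fromBlocks₁₂, h2, hφv, hFF']
    simp only [Matrix.zero_mul, Matrix.mul_zero, add_zero, zero_add]
    rw [ev_mul_diagB, Matrix.mul_assoc, e, Matrix.mul_one]
  · rw [map_mul, map_mul, hφ hF, hφ hF', one_mul, mul_one]

theorem ev_fromBlocks (P : Matrix s s ℤ[X]) (Q : Matrix t t ℤ[X]) :
    D.ev (fromBlocks P 0 0 Q) = fromBlocks (D.ev P) 0 0 (D.ev Q) := by
  ext (i | i) (j | j) <;> simp [ev_apply]

theorem Rep.sum {σ : G.GQ s} {τ : G.GQ t} {S : Matrix s s ℤ⟦X⟧} {T : Matrix t t ℤ⟦X⟧}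
    (hσ : D.Rep σ S) (hτ : D.Rep τ T) :
    D.Rep (G.stab Function.Embedding.inl σ * G.stab Function.Embedding.inr τ)
      (fromBlocks S 0 0 T) := by
  obtain ⟨P, hP, ⟨U, hU⟩, h1, h2⟩ := hσ
  obtain ⟨Q, hQ, ⟨V, hV⟩, h3, h4⟩ := hτ
  have e1 := extend_inl (A := A) (s := s) (t := t)
  have e2 := extend_inr (A := A) (s := s) (t := t)
  have e3 : ∀ X : Matrix s s A, embMat A (Function.Embedding.inl : s ↪ s ⊕ t) * X
      * (embMat A (Function.Embedding.inl : s ↪ s ⊕ t))ᴴ = fromBlocks X 0 0 0 := by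
    intro X
    rw [embMat_inl_eq, conjTranspose_fromRows_eq_fromCols_conjTranspose, fromRows_mul,
      fromRows_mul_fromCols]
    simp
  have e4 : ∀ X : Matrix t t A, embMat A (Function.Embedding.inr : t ↪ s ⊕ t) * X
      * (embMat A (Function.Embedding.inr : t ↪ s ⊕ t))ᴴ = fromBlocks 0 0 0 X := by
    intro X
    rw [embMat_inr_eq, conjTranspose_fromRows_eq_fromCols_conjTranspose, fromRows_mul,
      fromRows_mul_fromCols]
    simp
  refine ⟨fromBlocks P 0 0 Q, ?_, ⟨fromBlocks U 0 0 V, ?_⟩, ?_, ?_⟩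
  · rw [IsSymm, fromBlocks_transpose, hP.eq, hQ.eq, transpose_zero, transpose_zero]
  · rw [fromBlocks_map, hU, hV, fromBlocks_smul, fromBlocks_add,
      Matrix.map_zero _ (map_zero _), Matrix.map_zero _ (map_zero _)]
    simp
  · rw [GQ.mat_mul, GQ.mat_stab, GQ.mat_stab, ← fromBlocks_toBlocks (GQ.mat σ),
      ← fromBlocks_toBlocks (GQ.mat τ), extend_fromBlocks, extend_fromBlocks, fromBlocks_multiply,
      toBlocks_fromBlocks₁₁, e1, e2, e3, e4, h1, h3, ev_fromBlocks]
    simp [fromBlocks_multiply, fromBlocks_add]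
  · rw [GQ.mat_mul, GQ.mat_stab, GQ.mat_stab, ← fromBlocks_toBlocks (GQ.mat σ),
      ← fromBlocks_toBlocks (GQ.mat τ), extend_fromBlocks, extend_fromBlocks, fromBlocks_multiply,
      toBlocks_fromBlocks₁₂, e1, e2, e3, e4, h2, h4]
    have : D.diagB (s ⊕ t) = fromBlocks (D.diagB s) 0 0 (D.diagB t) := by
      rw [diagB, diagB, diagB, fromBlocks_diagonal]
      congr 1
      ext (i | i) <;> rfl
    rw [this]
    simp [fromBlocks_multiply, fromBlocks_add]

variable (D)

open Classical in
/-- The invariant of symmetric matrices over `ℤ⟦X⟧` attached to a row of Mennicke type: the class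
of any quadratic matrix representing the given symmetric matrix. -/
noncomputable def invariant {K : Type*} [CommGroup K] (q : G.StableHom K) :
    FormInvariant ℤ⟦X⟧ (Additive K) where
  toFun s _ _ S := if h : ∃ σ : G.GQ s, D.Rep σ S then Additive.ofMul (q.hom s h.choose) else 0
  sum s t _ _ _ _ P Q hP hQ hp hq := by
    have h1 := D.exists_rep hP hp
    have h2 := D.exists_rep hQ hq
    have h3 := h1.choose_spec.sum h2.choose_spec
    have h4 : ∃ σ : G.GQ (s ⊕ t), D.Rep σ (fromBlocks P 0 0 Q) := ⟨_, h3⟩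
    rw [dif_pos h1, dif_pos h2, dif_pos h4, h4.choose_spec.eq q h3, map_mul, q.map_stab,
      q.map_stab]
    rfl
  congr s _ _ P hP hp E hE := by
    have h1 := D.exists_rep hP hp
    obtain ⟨τ, hτ, h⟩ := h1.choose_spec.congr q hE
    have h2 : ∃ σ : G.GQ s, D.Rep σ ((E : Matrix s s ℤ⟦X⟧)ᵀ * P * (E : Matrix s s ℤ⟦X⟧)) :=
      ⟨_, hτ⟩
    rw [dif_pos h1, dif_pos h2, h2.choose_spec.eq q hτ, h]

variable {K : Type*} [CommGroup K] (q : G.StableHom K)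

theorem invariant_toFun {s : Type} [Fintype s] [DecidableEq s] {σ : G.GQ s}
    {S : Matrix s s ℤ⟦X⟧} (h : D.Rep σ S) :
    (D.invariant q).toFun s S = Additive.ofMul (q.hom s σ) := by
  have h' : ∃ σ : G.GQ s, D.Rep σ S := ⟨σ, h⟩
  exact (dif_pos h').trans (by rw [h'.choose_spec.eq q h])

theorem invariant_rankOne_one : (D.invariant q).rankOne 1 = 0 := by
  have hb : G.IsHerm (D.diagB Unit)ᴴ := by
    simpa using D.isHerm_conjTranspose_diagB_mul (s := Unit) (P := 1) transpose_one
  have : D.Rep (G.upperT _ hb) (diagonal fun _ : Unit => (1 : ℤ⟦X⟧)) :=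
    ⟨1, transpose_one, by rw [diagonal_one]; exact Approx.one, by
      rw [mat_upperT, toBlocks_fromBlocks₁₁, map_one], by
      rw [mat_upperT, toBlocks_fromBlocks₁₂]⟩
  rw [FormInvariant.rankOne, D.invariant_toFun q this, q.map_EQ _ _ (upperT_mem _ hb)]
  rfl

theorem isUnit_det_rankOne (u : ℤ⟦X⟧ˣ) : IsUnit (diagonal fun _ : Unit => (u : ℤ⟦X⟧)).det := by
  simp

theorem invariant_rankOne_congr (u v : ℤ⟦X⟧ˣ) (h : (PowerSeries.X ^ D.m : ℤ⟦X⟧) ∣ (u - v : ℤ⟦X⟧)) :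
    (D.invariant q).rankOne u = (D.invariant q).rankOne v := by
  obtain ⟨σ, hσ⟩ := D.exists_rep (diagonal_transpose _) (isUnit_det_rankOne u)
  have : D.Rep σ (diagonal fun _ : Unit => (v : ℤ⟦X⟧)) :=
    hσ.congr_right (by rintro ⟨⟩ ⟨⟩; simpa using h)
  rw [FormInvariant.rankOne, FormInvariant.rankOne, D.invariant_toFun q hσ,
    D.invariant_toFun q this]

end MennickeRow

end FormRing

/-! ### The polynomial form ring, its specialisations and the grading. -/

namespace Polynomial

variable {R : Type*} [Ring R] [StarRing R]

/-- The coefficientwise involution of the polynomial ring. -/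
noncomputable instance instStarCoeff : Star R[X] where
  star p := ∑ i ∈ p.support, monomial i (star (p.coeff i))

theorem coeff_star (p : R[X]) (n : ℕ) : (star p).coeff n = star (p.coeff n) := by
  change (∑ i ∈ p.support, monomial i (star (p.coeff i))).coeff n = _
  rw [finsetSum_coeff]
  simp only [coeff_monomial, Finset.sum_ite_eq']
  split_ifs with h
  · rfl
  · rw [notMem_support_iff.1 h, star_zero]

noncomputable instance instStarRingCoeff : StarRing R[X] where
  star_involutive p := by
    ext n
    rw [coeff_star, coeff_star, star_star]
  star_mul p q := by
    ext n
    rw [coeff_star, coeff_mul, coeff_mul, star_sum, ← Finset.Nat.sum_antidiagonal_swap]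
    exact Finset.sum_congr rfl fun x _ => by rw [star_mul, coeff_star, coeff_star]; rfl
  star_add p q := by
    ext n
    rw [coeff_star, coeff_add, coeff_add, coeff_star, coeff_star, star_add]

theorem star_C (r : R) : star (C r : R[X]) = C (star r) := by
  ext n
  rw [coeff_star, coeff_C, coeff_C]
  split_ifs <;> simp

theorem star_monomial (n : ℕ) (r : R) : star (monomial n r) = monomial n (star r) := by
  ext i
  rw [coeff_star, coeff_monomial, coeff_monomial]
  split_ifs <;> simp

end Polynomial

namespace FormRing

open Polynomial

variable {R : Type*} [Ring R] [StarRing R] (F : FormRing R)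

/-- The form ring structure on the polynomial ring. -/
noncomputable def poly : FormRing R[X] where
  lam := C F.lam
  lam_central p := by
    ext n
    rw [coeff_C_mul, coeff_mul_C, F.lam_central]
  lam_mul_star := by rw [star_C, ← C_mul, F.lam_mul_star, C_1]
  Lam :=
    { carrier := {p | ∀ n, p.coeff n ∈ F.Lam}
      zero_mem' := fun n => by rw [coeff_zero]; exact F.Lam.zero_mem
      add_mem' := fun hp hq n => by rw [coeff_add]; exact F.Lam.add_mem (hp n) (hq n)
      neg_mem' := fun hp n => by rw [coeff_neg]; exact F.Lam.neg_mem (hp n) }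
  min_le p n := by
    rw [coeff_sub, coeff_C_mul, coeff_star]
    exact F.min_le _
  le_max p hp := by
    ext n
    rw [coeff_neg, coeff_C_mul, coeff_star]
    exact F.le_max _ (hp n)
  conj_mem x a ha := by
    have hmax : a = -(C F.lam * star a) := by
      ext n
      rw [coeff_neg, coeff_C_mul, coeff_star]
      exact F.le_max _ (ha n)
    have hcentral : ∀ p : R[X], C F.lam * p = p * C F.lam := by
      intro p
      ext n
      rw [coeff_C_mul, coeff_mul_C, F.lam_central]
    induction x using Polynomial.induction_on' with
    | add x y hx hy =>
      intro n
      -- The cross terms have the form `z - λ z*`, so they lie in every form parameter and the claim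
      -- reduces to monomials.
      have e : star (x + y) * a * (x + y) = star x * a * x + star y * a * y
          + (star x * a * y - C F.lam * star (star x * a * y)) := by
        have : C F.lam * star (star x * a * y) = -(star y * a * x) := by
          conv_rhs => rw [hmax]
          simp only [star_mul, star_star, mul_neg, neg_mul, neg_neg, mul_assoc]
          rw [← mul_assoc, hcentral, mul_assoc]
        rw [this, star_add]
        noncomm_ring
      rw [e, coeff_add, coeff_add, coeff_sub, coeff_C_mul, coeff_star]
      exact F.Lam.add_mem (F.Lam.add_mem (hx n) (hy n)) (F.min_le _)
    | monomial i r =>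
      intro n
      have e : star (monomial i r) * a * monomial i r = C (star r) * a * C r * X ^ (i + i) := by
        rw [star_monomial, ← C_mul_X_pow_eq_monomial, ← C_mul_X_pow_eq_monomial, pow_add]
        calc _ = C (star r) * (X ^ i * (a * C r)) * X ^ i := by simp only [mul_assoc]
          _ = _ := by rw [X_pow_mul]; simp only [mul_assoc]
      rw [e, coeff_mul_X_pow']
      split_ifs
      · rw [coeff_mul_C, coeff_C_mul]
        exact F.conj_mem _ _ (ha _)
      · exact F.Lam.zero_mem

theorem poly_lam : F.poly.lam = C F.lam := rfl

theorem isHom_C : IsHom F F.poly (C : R →+* R[X]) where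
  map_star x := (star_C x).symm
  map_lam := rfl
  map_mem x hx n := by
    rw [coeff_C]
    split_ifs
    exacts [hx, F.Lam.zero_mem]

/-- Central elements along which polynomials over a form ring can be evaluated. -/
structure Scalar (z : R) : Prop where
  central : ∀ x : R, Commute x z
  star_eq : star z = z
  mul_mem : ∀ x ∈ F.Lam, x * z ∈ F.Lam

variable {F}

theorem Scalar.zero : F.Scalar 0 :=
  ⟨Commute.zero_right, star_zero R, fun x _ => by rw [mul_zero]; exact F.Lam.zero_mem⟩

theorem Scalar.natCast (k : ℕ) : F.Scalar (k : R) :=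
  ⟨fun x => Nat.commute_cast x k, star_natCast k, fun x hx => by
    rw [← nsmul_eq_mul']; exact F.Lam.nsmul_mem hx k⟩

/-- An inverse of a natural number is central and self-adjoint; `Λ` is stable under it because `x v
= k (v* x v)`. -/
theorem Scalar.of_natCast_mul_eq_one {k : ℕ} {v : R} (h : (k : R) * v = 1) : F.Scalar v := by
  have h' : v * k = 1 := by rw [← (Nat.cast_commute k v).eq, h]
  have hc : ∀ x : R, Commute x v := fun x => by
    change x * v = v * x
    calc x * v = v * k * (x * v) := by rw [h', one_mul]
      _ = v * x * (k * v) := by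
        rw [mul_assoc, ← mul_assoc (k : R), (Nat.cast_commute k x).eq]; simp only [mul_assoc]
      _ = v * x := by rw [h, mul_one]
  have hs : star v = v := by
    have : star v * k = 1 := by
      have := congrArg star h
      rwa [star_mul, star_natCast, star_one] at this
    calc star v = star v * (k * v) := by rw [h, mul_one]
      _ = v := by rw [← mul_assoc, this, one_mul]
  refine ⟨hc, hs, fun x hx => ?_⟩
  have : x * v = k • (star v * x * v) := by
    rw [hs, nsmul_eq_mul, ← mul_assoc, ← mul_assoc, h, one_mul]
  rw [this]
  exact F.Lam.nsmul_mem (F.conj_mem _ _ hx) k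

theorem Scalar.pow {z : R} (hz : F.Scalar z) (n : ℕ) : F.Scalar (z ^ n) := by
  induction n with
  | zero => exact ⟨fun x => by simp, by simp, fun x hx => by simpa⟩
  | succ n ih =>
    refine ⟨fun x => (hz.central x).pow_right _, by rw [star_pow, hz.star_eq], fun x hx => ?_⟩
    rw [pow_succ, ← mul_assoc]
    exact hz.mul_mem _ (ih.mul_mem _ hx)

/-- Evaluation at a scalar. -/
noncomputable def Scalar.eval {z : R} (hz : F.Scalar z) : R[X] →+* R :=
  eval₂RingHom' (RingHom.id R) z hz.central

theorem Scalar.eval_monomial {z : R} (hz : F.Scalar z) (n : ℕ) (r : R) :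
    hz.eval (monomial n r) = r * z ^ n := by
  change eval₂ _ _ _ = _
  rw [eval₂_monomial]
  rfl

theorem Scalar.eval_C {z : R} (hz : F.Scalar z) (r : R) : hz.eval (C r) = r := by
  rw [← monomial_zero_left, hz.eval_monomial, pow_zero, mul_one]

theorem Scalar.isHom_eval {z : R} (hz : F.Scalar z) : IsHom F.poly F hz.eval where
  map_star p := by
    induction p using Polynomial.induction_on' with
    | add p q hp hq => rw [star_add, map_add, map_add, star_add, hp, hq]
    | monomial n r =>
      rw [star_monomial, hz.eval_monomial, hz.eval_monomial, star_mul, star_pow, hz.star_eq,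
        ((hz.central _).pow_right n).eq]
  map_lam := hz.eval_C _
  map_mem p hp := by
    change eval₂ _ _ _ ∈ _
    rw [eval₂_eq_sum_range]
    exact F.Lam.sum_mem fun n _ => (hz.pow n).mul_mem _ (hp n)

theorem IsHom.comp {S T : Type*} [Ring S] [StarRing S] [Ring T] [StarRing T] {F' : FormRing S}
    {F'' : FormRing T} {θ : R →+* S} {θ' : S →+* T} (h' : IsHom F' F'' θ') (h : IsHom F F' θ) :
    IsHom F F'' (θ'.comp θ) where
  map_star x := by simp [h.map_star, h'.map_star]
  map_lam := by simp [h.map_lam, h'.map_lam]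
  map_mem x hx := h'.map_mem _ (h.map_mem _ hx)

section Graded

variable (𝒜 : ℕ → AddSubgroup R) [GradedRing 𝒜]

/-- The homomorphism `∑ rᵢ ↦ ∑ rᵢ Xⁱ`. -/
noncomputable def gradedHom : R →+* R[X] :=
  (DirectSum.toSemiring (fun i => (monomial i).toAddMonoidHom.comp (𝒜 i).subtype)
    (by rw [← C_1, ← monomial_zero_left]; rfl)
    (fun {i j} a b => (monomial_mul_monomial i j (a : R) (b : R)).symm)).comp
    (DirectSum.decomposeRingEquiv 𝒜).toRingHom

theorem gradedHom_of_mem {i : ℕ} {r : R} (hr : r ∈ 𝒜 i) : gradedHom 𝒜 r = monomial i r := by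
  change DirectSum.toAddMonoid (fun i => (monomial i).toAddMonoidHom.comp (𝒜 i).subtype)
    (DirectSum.decompose 𝒜 r) = _
  rw [DirectSum.decompose_of_mem 𝒜 hr]
  exact DirectSum.toAddMonoid_of _ _ _

theorem coeff_gradedHom (r : R) (n : ℕ) :
    (gradedHom 𝒜 r).coeff n = (DirectSum.decompose 𝒜 r n : R) := by
  induction r using DirectSum.Decomposition.inductionOn 𝒜 with
  | zero => simp
  | @homogeneous i r =>
    rw [gradedHom_of_mem 𝒜 r.2, coeff_monomial, DirectSum.decompose_coe, DirectSum.coe_of_apply]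
    split_ifs <;> rfl
  | add r s hr hs => rw [map_add, coeff_add, hr, hs, DirectSum.decompose_add]; rfl

variable {𝒜}

theorem IsGraded.isHom_gradedHom (hF : F.IsGraded 𝒜) : IsHom F F.poly (gradedHom 𝒜) where
  map_star r := by
    induction r using DirectSum.Decomposition.inductionOn 𝒜 with
    | zero => simp
    | @homogeneous i r =>
      rw [gradedHom_of_mem 𝒜 r.2, gradedHom_of_mem 𝒜 (hF.star_mem i _ r.2), star_monomial]
    | add r s hr hs => rw [star_add, map_add, map_add, star_add, hr, hs]
  map_lam := by
    rw [gradedHom_of_mem 𝒜 hF.lam_mem]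
    rfl
  map_mem x hx n := by
    rw [coeff_gradedHom]
    exact hF.proj_mem x hx n

/-- The endomorphism of a graded form ring multiplying the component of degree `i` by `z ^ i`. -/
noncomputable def Scalar.gradedEnd (𝒜 : ℕ → AddSubgroup R) [GradedRing 𝒜] {z : R}
    (hz : F.Scalar z) : R →+* R :=
  hz.eval.comp (gradedHom 𝒜)

theorem Scalar.gradedEnd_of_mem {z : R} (hz : F.Scalar z) {i : ℕ} {r : R} (hr : r ∈ 𝒜 i) :
    hz.gradedEnd 𝒜 r = r * z ^ i := by
  change hz.eval (gradedHom 𝒜 r) = _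
  rw [gradedHom_of_mem 𝒜 hr, hz.eval_monomial]

theorem Scalar.gradedEnd_gradedEnd {z w : R} (hz : F.Scalar z) (hw : F.Scalar w) (hw0 : w ∈ 𝒜 0)
    (h : w * z = 1) (r : R) : hz.gradedEnd 𝒜 (hw.gradedEnd 𝒜 r) = r := by
  induction r using DirectSum.Decomposition.inductionOn 𝒜 with
  | zero => simp
  | @homogeneous i r =>
    have : (r : R) * w ^ i ∈ 𝒜 i := by
      have := SetLike.mul_mem_graded r.2 (SetLike.pow_mem_graded i hw0)
      simpa using this
    rw [hw.gradedEnd_of_mem r.2, hz.gradedEnd_of_mem this, mul_assoc,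
      ← (hz.central w).mul_pow, h, one_pow, mul_one]
  | add r s hr hs => rw [map_add, map_add, hr, hs]

/-- Specialisation at `0` retains only degree zero, where rescaling by powers of `z` does nothing.
-/
theorem Scalar.gradedEnd_zero_mem {z : R} (hz : F.Scalar z) (h0 : F.Scalar (0 : R)) (r : R) :
    hz.gradedEnd 𝒜 (h0.gradedEnd 𝒜 r) = h0.gradedEnd 𝒜 r := by
  induction r using DirectSum.Decomposition.inductionOn 𝒜 with
  | zero => simp
  | @homogeneous i r =>
    rw [h0.gradedEnd_of_mem r.2]
    by_cases hi : i = 0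
    · subst hi
      rw [pow_zero, mul_one, hz.gradedEnd_of_mem r.2, pow_zero, mul_one]
    · rw [zero_pow hi, mul_zero, map_zero]
  | add r s hr hs => rw [map_add, map_add, hr, hs]

end Graded

end FormRing

/-! ### Coefficients of polynomial matrices and division by `1 - y X`. -/

namespace Matrix

open Polynomial

variable {R : Type*} [Ring R] {m n l : Type*}

/-- The matrix of coefficients of degree `d`. -/
def polyCoeff (M : Matrix m n R[X]) (d : ℕ) : Matrix m n R := M.map fun p => p.coeff d

/-- The matrix `M X ^ d`. -/
noncomputable def monom (d : ℕ) (M : Matrix m n R) : Matrix m n R[X] := M.map (monomial d)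

theorem polyCoeff_add (M N : Matrix m n R[X]) (d : ℕ) :
    (M + N).polyCoeff d = M.polyCoeff d + N.polyCoeff d := by
  ext i j
  simp [polyCoeff]

theorem polyCoeff_sub (M N : Matrix m n R[X]) (d : ℕ) :
    (M - N).polyCoeff d = M.polyCoeff d - N.polyCoeff d := by
  ext i j
  simp [polyCoeff]

theorem polyCoeff_zero (d : ℕ) : (0 : Matrix m n R[X]).polyCoeff d = 0 := by
  ext i j
  simp [polyCoeff]

theorem polyCoeff_one [DecidableEq n] (d : ℕ) :
    (1 : Matrix n n R[X]).polyCoeff d = if d = 0 then 1 else 0 := by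
  ext i j
  by_cases h : i = j <;> by_cases hd : d = 0 <;> simp [polyCoeff, one_apply, h, hd, coeff_one]

theorem polyCoeff_monom (d e : ℕ) (M : Matrix m n R) :
    (monom d M).polyCoeff e = if d = e then M else 0 := by
  ext i j
  simp only [polyCoeff, monom, map_apply, coeff_monomial]
  split_ifs <;> rfl

theorem polyCoeff_monom_one_mul_zero [Fintype n] (y : Matrix m n R) (M : Matrix n l R[X]) :
    (monom 1 y * M).polyCoeff 0 = 0 := by
  ext i j
  simp [polyCoeff, monom, mul_apply, finsetSum_coeff, ← C_mul_X_pow_eq_monomial, mul_assoc]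

theorem polyCoeff_monom_one_mul_succ [Fintype n] (y : Matrix m n R) (M : Matrix n l R[X])
    (d : ℕ) : (monom 1 y * M).polyCoeff (d + 1) = y * M.polyCoeff d := by
  ext i j
  simp [polyCoeff, monom, mul_apply, finsetSum_coeff, ← C_mul_X_pow_eq_monomial, mul_assoc]

theorem monom_mul [Fintype n] (d e : ℕ) (M : Matrix m n R) (N : Matrix n l R) :
    monom d M * monom e N = monom (d + e) (M * N) := by
  ext1 i j
  simp only [monom, mul_apply, map_apply, map_sum, monomial_mul_monomial]

theorem monom_add (d : ℕ) (M N : Matrix m n R) : monom d (M + N) = monom d M + monom d N := by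
  ext1 i j
  simp [monom]

theorem monom_neg (d : ℕ) (M : Matrix m n R) : monom d (-M) = -monom d M := by
  ext1 i j
  simp [monom]

theorem monom_zero (d : ℕ) : monom d (0 : Matrix m n R) = 0 := by
  ext1 i j
  simp [monom]

theorem conjTranspose_monom [StarRing R] (d : ℕ) (M : Matrix m n R) :
    (monom d M)ᴴ = monom d Mᴴ := by
  ext1 i j
  simp [monom, star_monomial]

theorem exists_polyCoeff_eq_zero [Finite m] [Finite n] (M : Matrix m n R[X]) :
    ∃ N, ∀ d, N ≤ d → M.polyCoeff d = 0 := by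
  cases nonempty_fintype m
  cases nonempty_fintype n
  refine ⟨(∑ i, ∑ j, (M i j).natDegree) + 1, fun d hd => ?_⟩
  ext i j
  apply coeff_eq_zero_of_natDegree_lt
  have h1 : (M i j).natDegree ≤ ∑ j, (M i j).natDegree := Finset.single_le_sum (f := fun j => (M i j).natDegree) (fun _ _ => Nat.zero_le _)
    (Finset.mem_univ j)
  have h2 : ∑ j, (M i j).natDegree ≤ ∑ i, ∑ j, (M i j).natDegree := Finset.single_le_sum (f := fun i => ∑ j, (M i j).natDegree)
    (fun _ _ => Nat.zero_le _) (Finset.mem_univ i)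
  omega

theorem ext_polyCoeff {M N : Matrix m n R[X]} (h : ∀ d, M.polyCoeff d = N.polyCoeff d) :
    M = N := by
  ext i j d
  exact congrFun (congrFun (h d) i) j

theorem sum_monom_polyCoeff {M : Matrix m n R[X]} {p : ℕ} (h : ∀ d, p ≤ d → M.polyCoeff d = 0) :
    ∑ d ∈ Finset.range p, monom d (M.polyCoeff d) = M := by
  apply ext_polyCoeff
  intro e
  have : ∀ s : Finset ℕ, (∑ d ∈ s, monom d (M.polyCoeff d)).polyCoeff e
      = if e ∈ s then M.polyCoeff e else 0 := by
    intro s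
    induction s using Finset.induction_on with
    | empty => simp [polyCoeff_zero]
    | insert a s ha ih =>
      rw [Finset.sum_insert ha, polyCoeff_add, ih, polyCoeff_monom]
      by_cases hae : a = e
      · subst hae
        simp [ha]
      · simp [hae, Ne.symm hae]
  rw [this]
  split_ifs with he
  · rfl
  · exact (h e (by simpa using he)).symm

end Matrix

namespace FormRing

open Polynomial

variable {R : Type*} [Ring R] [StarRing R] {F : FormRing R}

section Geometric

variable {n : Type*}

theorem IsHerm.monom {M : Matrix n n R} (hM : F.IsHerm M) (d : ℕ) :
    F.poly.IsHerm (monom d M) := by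
  constructor
  · ext1 i j
    have := congrFun (congrFun hM.1 i) j
    simp only [Matrix.monom, map_apply, Matrix.neg_apply, Matrix.smul_apply, conjTranspose_apply,
      smul_eq_mul, poly_lam, star_monomial, C_mul_monomial] at this ⊢
    rw [← map_neg, ← this]
  · intro i e
    simp only [Matrix.monom, map_apply, coeff_monomial]
    split_ifs
    exacts [hM.2 i, F.Lam.zero_mem]

theorem IsHerm.polyCoeff {M : Matrix n n R[X]} (hM : F.poly.IsHerm M) (d : ℕ) :
    F.IsHerm (M.polyCoeff d) := by
  constructor
  · ext i j
    have := congrArg (fun p => p.coeff d) (congrFun (congrFun hM.1 i) j)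
    simpa [poly_lam, coeff_star, Matrix.polyCoeff] using this
  · intro i
    exact hM.2 i d

variable [Fintype n] [DecidableEq n]

theorem IsHerm.conj_add {S : Matrix n n R} (hS : F.IsHerm S) (y : Matrix n n R) :
    F.IsHerm (yᴴ * S + S * y) := by
  have e : yᴴ * S = -(F.lam • (S * y)ᴴ) := by
    conv_lhs => rw [hS.1]
    rw [Matrix.mul_neg, F.mul_lam_smul, conjTranspose_mul]
  rw [e, add_comm, ← sub_eq_add_neg]
  refine ⟨?_, fun i => by simpa [-conjTranspose_mul] using F.min_le ((S * y) i i)⟩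
  rw [conjTranspose_sub, F.conjTranspose_lam_smul, conjTranspose_conjTranspose, smul_sub,
    smul_smul, F.lam_mul_star, one_smul, neg_sub]

/-- The coefficients of `T (1 - y X)⁻¹`. -/
def geomCoeff (T : ℕ → Matrix n n R) (y : Matrix n n R) : ℕ → Matrix n n R
  | 0 => T 0
  | d + 1 => T (d + 1) + geomCoeff T y d * y

/-- Formally `T (1 - y X)⁻¹` is the conjugate of the Hermitian series `(1 - y X)* T` by `(1 - y
X)⁻¹`. On coefficients this is a two-step recursion, so two consecutive ones are carried through the
induction. -/
theorem isHerm_geomCoeff {T : ℕ → Matrix n n R} {y : Matrix n n R} (h0 : F.IsHerm (T 0))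
    (hT : ∀ d, F.IsHerm (T (d + 1) - yᴴ * T d)) (d : ℕ) : F.IsHerm (geomCoeff T y d) := by
  have h1 : ∀ d, F.IsHerm (geomCoeff T y d) ∧ F.IsHerm (geomCoeff T y (d + 1)) := by
    intro d
    induction d with
    | zero =>
      refine ⟨h0, ?_⟩
      have := (hT 0).add (h0.conj_add y)
      convert this using 1
      simp only [geomCoeff]
      abel
    | succ d ih =>
      refine ⟨ih.2, ?_⟩
      have := ((hT (d + 1)).add (ih.2.conj_add y)).add (ih.1.conj y).neg
      convert this using 1
      simp only [geomCoeff, Matrix.mul_add, Matrix.mul_assoc]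
      abel
  exact (h1 d).1

theorem sum_monom_geomCoeff (T : ℕ → Matrix n n R) (y : Matrix n n R) (p : ℕ) :
    ∑ d ∈ Finset.range p, monom d (T d)
      = (∑ d ∈ Finset.range p, monom d (geomCoeff T y d)) * (1 - monom 1 y)
        + monom p (geomCoeff T y p) - monom p (T p) := by
  induction p with
  | zero => simp [geomCoeff]
  | succ p ih =>
    rw [Finset.sum_range_succ, Finset.sum_range_succ, ih, Matrix.add_mul, Matrix.mul_sub (monom _ _),
      monom_mul, Matrix.mul_one]
    simp only [geomCoeff, monom_add]
    abel

theorem geomCoeff_add {T : ℕ → Matrix n n R} {p : ℕ} (hT : ∀ d, p ≤ d → T d = 0)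
    (y : Matrix n n R) (i : ℕ) : geomCoeff T y (p + i) = geomCoeff T y p * y ^ i := by
  induction i with
  | zero => simp
  | succ i ih =>
    rw [← add_assoc, geomCoeff, ih, hT _ (by omega), zero_add, pow_succ, Matrix.mul_assoc]

/-- `P` is the truncation at degree `p` of the Hermitian series `M (1 - y X)⁻¹`. From degree `p` on
the coefficients of this series are `s`, `s y`, `s y²`, and so on, which accounts for the last
clause. -/
theorem exists_isHerm_sub_mul {M : Matrix n n R[X]} {y : Matrix n n R}
    (hM : F.poly.IsHerm ((1 - monom 1 y)ᴴ * M)) {p : ℕ} (hp : ∀ d, p ≤ d → M.polyCoeff d = 0) :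
    ∃ (P : Matrix n n R[X]) (s : Matrix n n R), F.poly.IsHerm P ∧
      M - P * (1 - monom 1 y) = monom p s ∧ ∀ i : ℕ, F.IsHerm (s * y ^ i) := by
  have e : (1 - monom 1 y)ᴴ * M = M - monom 1 yᴴ * M := by
    rw [conjTranspose_sub, conjTranspose_one, conjTranspose_monom, Matrix.sub_mul, Matrix.one_mul]
  rw [e] at hM
  have h0 : F.IsHerm (M.polyCoeff 0) := by
    have := hM.polyCoeff 0
    rwa [polyCoeff_sub, polyCoeff_monom_one_mul_zero, sub_zero] at this
  have h1 : ∀ d, F.IsHerm (M.polyCoeff (d + 1) - yᴴ * M.polyCoeff d) := by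
    intro d
    have := hM.polyCoeff (d + 1)
    rwa [polyCoeff_sub, polyCoeff_monom_one_mul_succ] at this
  have hS := isHerm_geomCoeff h0 h1
  refine ⟨∑ d ∈ Finset.range p, monom d (geomCoeff M.polyCoeff y d), geomCoeff M.polyCoeff y p,
    ?_, ?_, fun i => ?_⟩
  · induction p with
    | zero => simp [IsHerm]
    | succ p ih =>
      have : ∀ s : Finset ℕ, F.poly.IsHerm (∑ d ∈ s, monom d (geomCoeff M.polyCoeff y d)) := by
        intro s
        induction s using Finset.induction_on with
        | empty => simp [IsHerm]
        | insert a s ha ih =>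
          rw [Finset.sum_insert ha]
          exact ((hS a).monom a).add ih
      exact this _
  · have := sum_monom_geomCoeff M.polyCoeff y p
    rw [sum_monom_polyCoeff hp, hp p le_rfl, monom_zero, sub_zero] at this
    rw [sub_eq_iff_eq_add', ← this]
  · rw [← geomCoeff_add hp]
    exact hS _

end Geometric

section Relations

variable {A : Type*} [Ring A] [StarRing A] {G : FormRing A} {ι : Type*} [Fintype ι]
  [DecidableEq ι]

theorem GQ.relations (σ : G.GQ ι) :
    G.IsHerm ((GQ.mat σ).toBlocks₁₁ᴴ * (GQ.mat σ).toBlocks₂₁) ∧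
    G.IsHerm ((GQ.mat σ).toBlocks₁₂ᴴ * (GQ.mat σ).toBlocks₂₂) ∧
    (GQ.mat σ).toBlocks₁₁ᴴ * (GQ.mat σ).toBlocks₂₂
      + G.lam • ((GQ.mat σ).toBlocks₂₁ᴴ * (GQ.mat σ).toBlocks₁₂) = 1 := by
  have hq := GQ.isQuad_mat σ
  rw [isQuad_iff, ← fromBlocks_toBlocks (GQ.mat σ)] at hq
  simp only [halfForm, fromBlocks_conjTranspose, fromBlocks_multiply, sub_eq_add_neg,
    fromBlocks_neg, fromBlocks_add] at hq
  obtain ⟨h1, h2, h3⟩ := hq.blocks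
  refine ⟨by simpa using h1, by simpa using h2, ?_⟩
  simp only [Matrix.mul_zero, Matrix.mul_one, Matrix.zero_mul, zero_add, add_zero, neg_zero,
    conjTranspose_mul, conjTranspose_conjTranspose] at h3
  rw [← sub_eq_add_neg, sub_eq_iff_eq_add] at h3
  rw [h3]
  abel

/-- From `σ* ψ σ = ψ` one gets `σ⁻¹ = ψ⁻¹ σ* ψ`. -/
theorem GQ.mat_inv (σ : G.GQ ι) : GQ.mat σ⁻¹
    = fromBlocks (GQ.mat σ).toBlocks₂₂ᴴ (star G.lam • (GQ.mat σ).toBlocks₁₂ᴴ)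
      (G.lam • (GQ.mat σ).toBlocks₂₁ᴴ) (GQ.mat σ).toBlocks₁₁ᴴ := by
  have h := (GQ.isQuad_mat σ).1
  have hW : fromBlocks (0 : Matrix ι ι A) (star G.lam • (1 : Matrix ι ι A)) (1 : Matrix ι ι A) 0 * G.psi ι = 1 := by
    rw [psi, fromBlocks_multiply, ← fromBlocks_one]
    simp [smul_smul, G.star_lam_mul]
  have h' := congrArg (fromBlocks (0 : Matrix ι ι A) (star G.lam • (1 : Matrix ι ι A)) (1 : Matrix ι ι A) 0 * ·) h
  simp only [hW, ← Matrix.mul_assoc] at h'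
  calc GQ.mat σ⁻¹ = fromBlocks (0 : Matrix ι ι A) (star G.lam • (1 : Matrix ι ι A)) (1 : Matrix ι ι A) 0
        * (GQ.mat σ)ᴴ * G.psi ι * (GQ.mat σ * GQ.mat σ⁻¹) := by
        rw [← Matrix.mul_assoc, h', Matrix.one_mul]
    _ = _ := by
      rw [GQ.mat_mul_inv, Matrix.mul_one]
      conv_lhs => rw [← fromBlocks_toBlocks (GQ.mat σ)]
      rw [psi, fromBlocks_conjTranspose, fromBlocks_multiply, fromBlocks_multiply]
      simp only [Matrix.mul_zero, Matrix.mul_one, Matrix.zero_mul, zero_add, add_zero,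
        Matrix.one_mul, Matrix.smul_mul, G.mul_lam_smul, smul_smul, G.lam_mul_star,
        G.star_lam_mul, one_smul]

theorem GQ.isHerm_mul_conjTranspose (σ : G.GQ ι) :
    G.IsHerm ((GQ.mat σ).toBlocks₁₁ * (GQ.mat σ).toBlocks₁₂ᴴ) := by
  have h := (GQ.relations σ⁻¹).2.1
  rw [GQ.mat_inv, toBlocks_fromBlocks₁₂, toBlocks_fromBlocks₂₂] at h
  have e : (star G.lam • (GQ.mat σ).toBlocks₁₂ᴴ)ᴴ * (GQ.mat σ).toBlocks₁₁ᴴ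
      = G.lam • ((GQ.mat σ).toBlocks₁₁ * (GQ.mat σ).toBlocks₁₂ᴴ)ᴴ := by
    rw [conjTranspose_mul, conjTranspose_conjTranspose, ← Matrix.smul_mul]
    congr 1
    ext i j
    simp [conjTranspose_apply, G.lam_central]
  rw [e] at h
  have h' := h.neg
  rw [h.1, neg_neg, G.conjTranspose_lam_smul, conjTranspose_conjTranspose, smul_smul,
    G.lam_mul_star, one_smul] at h'
  exact h'

end Relations

end FormRing

/-! ### Reduction to a first row of Mennicke type. -/

namespace FormRing

open Polynomial

variable {R : Type*} [Ring R] [StarRing R] {F : FormRing R}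

theorem polyCoeff_fromBlocks {m n : Type*} (A : Matrix m m R[X]) (B : Matrix m n R[X])
    (C : Matrix n m R[X]) (D : Matrix n n R[X]) (d : ℕ) :
    (fromBlocks A B C D).polyCoeff d
      = fromBlocks (A.polyCoeff d) (B.polyCoeff d) (C.polyCoeff d) (D.polyCoeff d) := by
  ext (i | i) (j | j) <;> rfl

/-- Reduction of the upper left block to a linear one by stabilization. -/
theorem StableHom.exists_linear {K : Type*} [CommGroup K] (q : F.poly.StableHom K) (r : ℕ) :
    ∀ (ι : Type) [Fintype ι] [DecidableEq ι] (τ : F.poly.GQ ι),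
      (GQ.mat τ).toBlocks₁₁.polyCoeff 0 = 1 →
      (∀ d, r + 1 < d → (GQ.mat τ).toBlocks₁₁.polyCoeff d = 0) →
      ∃ (κ : Type) (_ : Fintype κ) (_ : DecidableEq κ) (τ' : F.poly.GQ κ) (a : Matrix κ κ R),
        (GQ.mat τ').toBlocks₁₁ = 1 - monom 1 a ∧ q.hom κ τ' = q.hom ι τ := by
  induction r with
  | zero =>
    intro ι _ _ τ h0 h1
    refine ⟨ι, inferInstance, inferInstance, τ, -(GQ.mat τ).toBlocks₁₁.polyCoeff 1, ?_, rfl⟩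
    apply ext_polyCoeff
    intro d
    rw [polyCoeff_sub, polyCoeff_one, polyCoeff_monom]
    rcases d with _ | _ | d
    · simp [h0]
    · simp
    · simp [h1 (d + 2) (by omega)]
  | succ r ih =>
    intro ι _ _ τ h0 h1
    let N := (GQ.mat τ).toBlocks₁₁.polyCoeff (r + 2)
    -- Higman's trick: multiplying `diag(A, 1)` by these two matrices subtracts the top term `N X ^
    -- (r + 2)` from `A`, at the cost of new entries `N X ^ (r + 1)` and `-X` of lower degree.
    obtain ⟨E, hE, hE'⟩ := exists_elem_upper (monom (r + 1) N)
    obtain ⟨L, hL, hL'⟩ := exists_elem_lower (monom 1 (-1 : Matrix ι ι R))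
    let τ' := F.poly.hyp _ E * F.poly.stab Function.Embedding.inl τ * F.poly.hyp _ L
    have hb : (GQ.mat τ').toBlocks₁₁ = fromBlocks ((GQ.mat τ).toBlocks₁₁ - monom (r + 2) N)
        (monom (r + 1) N) (monom 1 (-1)) 1 := by
      rw [GQ.mat_mul, GQ.mat_mul, GQ.mat_hyp, GQ.mat_hyp, GQ.mat_stab,
        ← fromBlocks_toBlocks (GQ.mat τ), extend_fromBlocks, fromBlocks_multiply,
        fromBlocks_multiply, toBlocks_fromBlocks₁₁, hE', hL', extend_inl]
      simp [fromBlocks_multiply, monom_mul, monom_neg, sub_eq_add_neg]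
    obtain ⟨κ, i1, i2, σ, a, h2, h3⟩ := ih (ι ⊕ ι) τ' (by
      rw [hb, polyCoeff_fromBlocks, polyCoeff_sub, h0, polyCoeff_monom, polyCoeff_monom,
        polyCoeff_monom, polyCoeff_one]
      simp) (by
      intro d hd
      rw [hb, polyCoeff_fromBlocks, polyCoeff_sub, polyCoeff_monom, polyCoeff_monom,
        polyCoeff_monom, polyCoeff_one, if_neg (show ¬ r + 1 = d by omega),
        if_neg (show ¬ 1 = d by omega), if_neg (show ¬ d = 0 by omega)]
      rcases eq_or_ne d (r + 2) with rfl | hd'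
      · simp [N]
      · rw [if_neg hd'.symm, h1 d (by omega)]
        simp)
    refine ⟨κ, i1, i2, σ, a, h2, h3.trans ?_⟩
    rw [map_mul, map_mul, q.map_EQ _ _ (F.poly.hyp_mem_EQ hE),
      q.map_EQ _ _ (F.poly.hyp_mem_EQ hL), one_mul, mul_one, q.map_stab]

theorem IsHerm.symm_apply {n : Type*} {M : Matrix n n R} (hM : F.IsHerm M) :
    Mᴴ = -(star F.lam • M) := by
  conv_lhs => rw [hM.1]
  rw [conjTranspose_neg, F.conjTranspose_lam_smul, conjTranspose_conjTranspose]

theorem mul_star_lam_smul {l m n : Type*} [Fintype m] (A : Matrix l m R) (B : Matrix m n R) :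
    A * (star F.lam • B) = star F.lam • (A * B) := by
  ext i j
  simp only [Matrix.mul_apply, Matrix.smul_apply, smul_eq_mul, Finset.mul_sum]
  refine Finset.sum_congr rfl fun k _ => ?_
  rw [← mul_assoc, ← F.star_lam_central, mul_assoc]

section

variable {ι : Type*} [Fintype ι] [DecidableEq ι]

/-- Solving for the coefficients of `D` gives `y ^ d` up to degree `e` and `y ^ l (y ^ (e + 1) + s)`
in degree `e + 1 + l`; as `D` is a polynomial, the latter vanish for large `l`. -/
theorem pow_mul_add_eq_zero {y s : Matrix ι ι R} {D : Matrix ι ι R[X]} {e : ℕ}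
    (h : (1 - monom 1 y) * D = 1 + monom (e + 1) s) : ∃ l, y ^ l * (y ^ (e + 1) + s) = 0 := by
  rw [Matrix.sub_mul, Matrix.one_mul] at h
  have h0 : D.polyCoeff 0 = 1 := by
    have := congrArg (polyCoeff · 0) h
    simpa [polyCoeff_sub, polyCoeff_monom_one_mul_zero, polyCoeff_add, polyCoeff_one,
      polyCoeff_monom] using this
  have hs : ∀ d, D.polyCoeff (d + 1) = y * D.polyCoeff d + if e = d then s else 0 := by
    intro d
    have := congrArg (polyCoeff · (d + 1)) h
    simp only [polyCoeff_sub, polyCoeff_monom_one_mul_succ, polyCoeff_add, polyCoeff_one,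
      polyCoeff_monom, Nat.add_right_cancel_iff, Nat.succ_ne_zero, if_false, zero_add] at this
    rw [← this]
    abel
  have h1 : ∀ d, d ≤ e → D.polyCoeff d = y ^ d := by
    intro d
    induction d with
    | zero => intro _; rw [h0, pow_zero]
    | succ d ih =>
      intro hd
      rw [hs, ih (by omega), if_neg (by omega), add_zero, pow_succ']
  have h2 : ∀ l, D.polyCoeff (e + 1 + l) = y ^ l * (y ^ (e + 1) + s) := by
    intro l
    induction l with
    | zero => rw [add_zero, hs, if_pos rfl, h1 e le_rfl, pow_zero, Matrix.one_mul, pow_succ']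
    | succ l ih =>
      rw [← add_assoc, hs, ih, if_neg (by omega), add_zero, pow_succ' y l, Matrix.mul_assoc]
  obtain ⟨N, hN⟩ := exists_polyCoeff_eq_zero D
  exact ⟨N, by rw [← h2]; exact hN _ (by omega)⟩

/-- A quadratic matrix with linear upper left block can be modified by elementary matrices so that
the first row becomes of Mennicke type. -/
theorem exists_mennickeRow {τ : F.poly.GQ ι} {a : Matrix ι ι R}
    (hA : (GQ.mat τ).toBlocks₁₁ = 1 - monom 1 a) :
    ∃ (D : (F.matrix ι).MennickeRow) (p : ℕ), D.a = a ∧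
      ∃ ε ∈ F.poly.EQ ι, (GQ.mat (τ * ε)).toBlocks₁₁ = 1 - monom 1 a ∧
        (GQ.mat (τ * ε)).toBlocks₁₂ = monom (2 * p) D.b := by
  obtain ⟨N, hN⟩ := exists_polyCoeff_eq_zero (GQ.mat τ).toBlocks₁₂ᴴ
  have hB := GQ.isHerm_mul_conjTranspose τ
  have hy : (1 - monom 1 aᴴ)ᴴ = (1 - monom 1 a : Matrix ι ι R[X]) := by
    rw [conjTranspose_sub, conjTranspose_one, conjTranspose_monom, conjTranspose_conjTranspose]
  have hy' : (1 - monom 1 a)ᴴ = (1 - monom 1 aᴴ : Matrix ι ι R[X]) := by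
    rw [conjTranspose_sub, conjTranspose_one, conjTranspose_monom]
  rw [hA, ← hy] at hB
  -- Any exponent at least `N` would do for the division; an even one can later be shared between
  -- the two sides of a hyperbolic conjugation.
  obtain ⟨P, s, hP, hPs, hs⟩ := exists_isHerm_sub_mul hB (p := 2 * (N + 1))
    (fun d hd => hN d (by omega))
  have hβ : F.poly.IsHerm (-Pᴴ)ᴴ := by
    rw [conjTranspose_neg, conjTranspose_conjTranspose]
    exact hP.neg
  let ρ := τ * F.poly.upperT (-Pᴴ) hβ
  have hρ : GQ.mat ρ = fromBlocks (1 - monom 1 a) (monom (2 * (N + 1)) sᴴ)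
      (GQ.mat ρ).toBlocks₂₁ (GQ.mat ρ).toBlocks₂₂ := by
    conv_lhs => rw [← fromBlocks_toBlocks (GQ.mat ρ)]
    have e : GQ.mat ρ = GQ.mat τ * fromBlocks 1 (-Pᴴ) 0 1 := GQ.mat_mul _ _
    rw [← fromBlocks_toBlocks (GQ.mat τ), fromBlocks_multiply] at e
    congr 1
    · rw [e, toBlocks_fromBlocks₁₁, hA, Matrix.mul_one, Matrix.mul_zero, add_zero]
    · have := congrArg conjTranspose hPs
      rw [conjTranspose_sub, conjTranspose_conjTranspose, conjTranspose_mul, hy,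
        conjTranspose_monom] at this
      rw [e, toBlocks_fromBlocks₁₂, hA, Matrix.mul_one, ← this, Matrix.mul_neg]
      abel
  obtain ⟨h1, -, h2⟩ := GQ.relations ρ
  rw [hρ, toBlocks_fromBlocks₁₁, toBlocks_fromBlocks₂₁] at h1
  rw [hρ, toBlocks_fromBlocks₁₁, toBlocks_fromBlocks₂₁, toBlocks_fromBlocks₁₂,
    toBlocks_fromBlocks₂₂] at h2
  obtain ⟨M, hM⟩ := exists_polyCoeff_eq_zero (GQ.mat ρ).toBlocks₂₁
  obtain ⟨Q, t, hQ, hQt, ht⟩ := exists_isHerm_sub_mul h1 hM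
  have ht0 : F.IsHerm t := by simpa using ht 0
  have hs0 : F.IsHerm s := by simpa using hs 0
  -- `υ` serves only to extract a relation. With both off-diagonal blocks monomial, the unit
  -- relation of its blocks becomes `(1 - a* X) D = 1 + X ^ (e + 1) t s*`.
  let υ := F.poly.lowerT (-Q) hQ.neg * ρ
  have hυ : GQ.mat υ = fromBlocks (1 - monom 1 a) (monom (2 * (N + 1)) sᴴ)
      (monom M t) (GQ.mat υ).toBlocks₂₂ := by
    conv_lhs => rw [← fromBlocks_toBlocks (GQ.mat υ)]
    have e : GQ.mat υ = fromBlocks 1 0 (-Q) 1 * GQ.mat ρ := GQ.mat_mul _ _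
    rw [hρ, fromBlocks_multiply] at e
    congr 1
    · rw [e, toBlocks_fromBlocks₁₁, Matrix.one_mul, Matrix.zero_mul, add_zero]
    · rw [e, toBlocks_fromBlocks₁₂, Matrix.one_mul, Matrix.zero_mul, add_zero]
    · rw [e, toBlocks_fromBlocks₂₁, Matrix.one_mul, ← hQt, Matrix.neg_mul]
      abel
  obtain ⟨-, -, h3⟩ := GQ.relations υ
  rw [hυ, toBlocks_fromBlocks₁₁, toBlocks_fromBlocks₂₁, toBlocks_fromBlocks₁₂,
    toBlocks_fromBlocks₂₂, hy', conjTranspose_monom, monom_mul] at h3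
  have h4 : F.poly.lam • monom (M + 2 * (N + 1)) (tᴴ * sᴴ)
      = -monom (M + 2 * (N + 1)) (t * sᴴ) := by
    rw [ht0.symm_apply, Matrix.neg_mul, Matrix.smul_mul, monom_neg, smul_neg]
    congr 1
    ext1 i j
    simp only [monom, Matrix.smul_apply, map_apply, smul_eq_mul, poly_lam, C_mul_monomial]
    rw [← mul_assoc, F.lam_mul_star, one_mul]
  rw [h4, add_neg_eq_iff_eq_add] at h3
  obtain ⟨l, hl⟩ := pow_mul_add_eq_zero (e := M + 2 * N + 1) h3
  have hcomm : t * a ^ l = aᴴ ^ l * t := by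
    have := (ht l).1
    rw [conjTranspose_mul, ht0.symm_apply, conjTranspose_pow, Matrix.mul_neg, smul_neg, neg_neg,
      mul_star_lam_smul, smul_smul, F.lam_mul_star, one_smul] at this
    exact this
  -- The choice `b = s*`, `c = -t a ^ l` turns the relation `hl` into `c b = (a*) ^ m`, whose
  -- adjoint is `b c = a ^ m`.
  refine ⟨⟨a, sᴴ, -(t * a ^ l), l + (M + 2 * N + 1 + 1), fun i => ?_, fun i => ?_, ?_⟩, N + 1,
    rfl, _, upperT_mem _ hβ, ?_, ?_⟩
  · change F.IsHerm (a ^ i * sᴴ)ᴴ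
    rw [conjTranspose_mul, conjTranspose_conjTranspose, conjTranspose_pow]
    exact hs i
  · change F.IsHerm (-(t * a ^ l) * a ^ i)
    rw [Matrix.neg_mul, Matrix.mul_assoc, ← pow_add]
    exact (ht _).neg
  · have e1 : -(t * a ^ l) * sᴴ = aᴴ ^ (l + (M + 2 * N + 1 + 1)) := by
      rw [Matrix.neg_mul, hcomm, pow_add, Matrix.mul_assoc]
      rw [Matrix.mul_add] at hl
      exact (eq_neg_of_add_eq_zero_left hl).symm
    have e2 := congrArg conjTranspose e1
    rw [conjTranspose_mul, conjTranspose_conjTranspose, conjTranspose_pow,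
      conjTranspose_conjTranspose, conjTranspose_neg, (ht l).symm_apply, neg_neg,
      mul_star_lam_smul] at e2
    rw [hs0.symm_apply, neg_mul_neg, Matrix.smul_mul, e2]
  · change (GQ.mat ρ).toBlocks₁₁ = _
    rw [hρ, toBlocks_fromBlocks₁₁]
  · change (GQ.mat ρ).toBlocks₁₂ = _
    rw [hρ, toBlocks_fromBlocks₁₂]

end

end FormRing

/-! ### All rescalings of an invariant at once. -/

namespace FormInvariant

open PowerSeries

variable {K : Type*} [AddCommGroup K]

/-- The family of the invariants of all rescalings of a form by powers of `k`. -/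
noncomputable def rescaleSeq (Φ : FormInvariant ℤ⟦X⟧ K) (k : ℕ) :
    FormInvariant ℤ⟦X⟧ (ℕ → K) where
  toFun s _ _ S i := Φ.toFun s (S.map (rescale ((k ^ i : ℕ) : ℤ)))
  sum s t _ _ _ _ P Q hP hQ hp hq := by
    funext i
    have h : ∀ {r : Type} [Fintype r] [DecidableEq r] {M : Matrix r r ℤ⟦X⟧}, IsUnit M.det →
        IsUnit (M.map (rescale ((k ^ i : ℕ) : ℤ))).det := by
      intro r _ _ M hM
      have := hM.map (rescale ((k ^ i : ℕ) : ℤ))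
      rwa [RingHom.map_det] at this
    rw [fromBlocks_map, Matrix.map_zero _ (map_zero _), Matrix.map_zero _ (map_zero _)]
    exact Φ.sum s t _ _ (by rw [IsSymm, ← transpose_map, hP.eq])
      (by rw [IsSymm, ← transpose_map, hQ.eq]) (h hp) (h hq)
  congr s _ _ P hP hp E hE := by
    funext i
    have h : IsUnit (P.map (rescale ((k ^ i : ℕ) : ℤ))).det := by
      have := hp.map (rescale ((k ^ i : ℕ) : ℤ))
      rwa [RingHom.map_det] at this
    have := Φ.congr s _ (by rw [IsSymm, ← transpose_map, hP.eq]) h _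
      (FormRing.map_elemGroup (rescale ((k ^ i : ℕ) : ℤ)) hE)
    rw [Matrix.map_mul, Matrix.map_mul, ← this, transpose_map]
    rfl

theorem rescaleSeq_rankOne (Φ : FormInvariant ℤ⟦X⟧ K) (k : ℕ) (u : ℤ⟦X⟧) (i : ℕ) :
    (Φ.rescaleSeq k).rankOne u i = Φ.rankOne (rescale ((k ^ i : ℕ) : ℤ) u) := by
  change Φ.toFun Unit _ = Φ.toFun Unit _
  rw [diagonal_map (map_zero _)]

/-- Rescaling `X ↦ k X` need not come from an endomorphism of the group of values. On the sequence
of all rescaled values it is the shift, so `exists_iterate_eq_zero` is applied to sequences. -/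
theorem exists_rankOne_rescale_eq_zero (Φ : FormInvariant ℤ⟦X⟧ K) (h1 : Φ.rankOne 1 = 0) {m : ℕ}
    (hm : ∀ u u' : ℤ⟦X⟧ˣ, (X : ℤ⟦X⟧) ^ m ∣ (u - u' : ℤ⟦X⟧) → Φ.rankOne u = Φ.rankOne u') {k : ℕ}
    (hk : ∀ i : ℕ, k • Φ.rankOne (rescale ((k ^ i : ℕ) : ℤ) (1 - X)) = 0) :
    ∃ n : ℕ, Φ.rankOne (rescale ((k ^ n : ℕ) : ℤ) (1 - X)) = 0 := by
  let ψ : (ℕ → K) →+ (ℕ → K) :=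
    { toFun := fun f i => f (i + 1)
      map_zero' := rfl
      map_add' := fun _ _ => rfl }
  have hψ : ∀ (n : ℕ) (f : ℕ → K) (i : ℕ), ψ^[n] f i = f (i + n) := by
    intro n
    induction n with
    | zero => intro f i; rfl
    | succ n ih =>
      intro f i
      rw [Function.iterate_succ_apply, ih]
      rfl
  obtain ⟨n, hn⟩ := (Φ.rescaleSeq k).exists_iterate_eq_zero (m := m) (k := k) (ψ := ψ)
    (by funext i; rw [rescaleSeq_rankOne, map_one, h1]; rfl)
    (by
      intro u u' h
      funext i
      rw [rescaleSeq_rankOne, rescaleSeq_rankOne]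
      refine hm (Units.map (rescale ((k ^ i : ℕ) : ℤ)).toMonoidHom u)
        (Units.map (rescale ((k ^ i : ℕ) : ℤ)).toMonoidHom u') ?_
      obtain ⟨v, hv⟩ := h
      change X ^ m ∣ rescale _ (u : ℤ⟦X⟧) - rescale _ (u' : ℤ⟦X⟧)
      rw [← map_sub, hv, map_mul, map_pow, rescale_X, mul_pow]
      exact (dvd_mul_left _ _).mul_right _)
    (by
      intro u
      funext i
      change (Φ.rescaleSeq k).rankOne u (i + 1) = _
      rw [rescaleSeq_rankOne, rescaleSeq_rankOne, rescale_rescale]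
      push_cast
      rw [pow_succ'])
    (by
      funext i
      rw [Pi.smul_apply, rescaleSeq_rankOne, hk]
      rfl)
  refine ⟨n, ?_⟩
  have := congrFun hn 0
  rwa [hψ, rescaleSeq_rankOne, zero_add] at this

end FormInvariant

/-! ### Specialisation at powers of `k` and conclusion. -/

namespace FormRing

variable {R : Type*} [Ring R] [StarRing R] {F : FormRing R}

section Evaluation

open Polynomial

/-- At `X = n` the upper half is `(1 - n a, n ^ (2 p) b)`. Conjugation by the hyperbolic matrix of
the scalar `n ^ (-p)` makes it `(1 - n a, b)`, the upper half of a matrix representing `⟨1 - n X⟩`.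
-/
theorem MennickeRow.invariant_eq {K : Type*} [CommGroup K] (q : F.StableHom K) {κ : Type}
    [Fintype κ] [DecidableEq κ] (D : (F.matrix κ).MennickeRow) {p : ℕ} {υ : F.poly.GQ κ}
    (h₁ : (GQ.mat υ).toBlocks₁₁ = 1 - monom 1 D.a)
    (h₂ : (GQ.mat υ).toBlocks₁₂ = monom (2 * p) D.b) {n : ℕ} {v : R} (hv : (n : R) * v = 1) :
    (D.invariant (q.matrix κ)).rankOne (PowerSeries.rescale (n : ℤ) (1 - PowerSeries.X))
      = Additive.ofMul (q.hom κ ((Scalar.natCast (F := F) n).isHom_eval.mapGQ κ υ)) := by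
  have hsv : F.Scalar v := Scalar.of_natCast_mul_eq_one hv
  have hv' : v * n = 1 := by rw [← (Nat.cast_commute n v).eq, hv]
  have hu : IsUnit (diagonal fun _ : Unit =>
      PowerSeries.rescale (n : ℤ) (1 - PowerSeries.X : PowerSeries ℤ)).det := by
    rw [det_unique, diagonal_apply_eq]
    exact (FormInvariant.isUnit_of_X_dvd_sub_one (by simp)).map _
  obtain ⟨σ, hσ⟩ := D.exists_rep (diagonal_transpose _) hu
  -- The exact polynomial `1 - n X` is used instead of a truncation, so that the block is `1 - n a`
  -- whatever the value of `D.m`.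
  obtain ⟨ε, hε, e1, e2⟩ := hσ.exists_row
    (Q := diagonal fun _ : Unit => (1 - (n : ℤ[X]) * X)) (diagonal_transpose _)
    ⟨0, by
      rw [diagonal_map (map_zero _), smul_zero, add_zero]
      congr 1
      funext i
      simp [PowerSeries.rescale_X]
      exact map_natCast coeToPowerSeries.ringHom n⟩
  rw [FormInvariant.rankOne, D.invariant_toFun _ hσ]
  congr 1
  have h3 : (q.matrix κ).hom Unit σ = q.hom (Unit × κ) (F.flatten κ Unit (σ * ε)) := by
    have := (q.matrix κ).map_EQ _ _ hε
    rw [← mul_one ((q.matrix κ).hom Unit σ), ← this, ← map_mul]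
    rfl
  let V : (Matrix κ κ R)ˣ := ⟨diagonal fun _ => v ^ p, diagonal fun _ => (n : R) ^ p, by
      rw [diagonal_mul_diagonal, ← (Nat.cast_commute n v).symm.mul_pow, hv']; simp, by
      rw [diagonal_mul_diagonal, ← (Nat.cast_commute n v).mul_pow, hv]; simp⟩
  let f : κ ↪ Unit × κ := Function.Embedding.sectR () κ
  let θ := (Scalar.natCast (F := F) n).isHom_eval.mapGQ κ υ
  have h4 : q.hom κ θ = q.hom (Unit × κ) (F.stab f (F.hyp κ V * θ * F.hyp κ V⁻¹)) := by
    rw [q.map_stab, map_mul, map_mul, map_inv, map_inv, mul_right_comm, mul_inv_cancel, one_mul]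
  rw [h3, h4]
  have hE : ∀ (M : Matrix κ κ R) (i j : κ),
      (embMat R f * M * (embMat R f)ᴴ) ((), i) ((), j) = M i j := by
    intro M i j
    have h : ∀ x, (embMat R f)ᴴ x ((), j) = if j = x then 1 else 0 := by
      intro x
      simp only [embMat, f, conjTranspose_apply, of_apply, Function.Embedding.sectR_apply,
        Prod.mk.injEq, true_and]
      split_ifs <;> simp
    simp only [mul_apply, h]
    simp [embMat, f]
  have hE' : ∀ (M : Matrix κ κ R) (i j : κ), extend f M ((), i) ((), j) = M i j := by
    intro M i j
    rw [extend_apply, Matrix.add_apply, hE, Matrix.sub_apply]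
    by_cases hij : i = j <;> simp [one_apply, hij]
  have hθ : GQ.mat (F.hyp κ V * θ * F.hyp κ V⁻¹)
      = fromBlocks (1 - (n : ℕ) • D.a) D.b
        (GQ.mat (F.hyp κ V * θ * F.hyp κ V⁻¹)).toBlocks₂₁
        (GQ.mat (F.hyp κ V * θ * F.hyp κ V⁻¹)).toBlocks₂₂ := by
    conv_lhs => rw [← fromBlocks_toBlocks (GQ.mat (F.hyp κ V * θ * F.hyp κ V⁻¹))]
    have e : GQ.mat (F.hyp κ V * θ * F.hyp κ V⁻¹)
        = GQ.mat (F.hyp κ V) * (GQ.mat υ).map (Scalar.natCast (F := F) n).eval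
          * GQ.mat (F.hyp κ V⁻¹) := by
      rw [GQ.mat_mul, GQ.mat_mul]
      rfl
    rw [← fromBlocks_toBlocks (GQ.mat υ), fromBlocks_map, h₁, h₂, GQ.mat_hyp, GQ.mat_hyp,
      fromBlocks_multiply, fromBlocks_multiply] at e
    rw [e]
    congr 1
    · rw [toBlocks_fromBlocks₁₁]
      simp only [Matrix.zero_mul, Matrix.mul_zero, add_zero, zero_add]
      ext i j
      change ((diagonal (fun _ => v ^ p) : Matrix κ κ R) * (_ : Matrix κ κ R)
        * (diagonal (fun _ => (n : R) ^ p) : Matrix κ κ R)) i j = _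
      rw [mul_diagonal, diagonal_mul, map_apply, Matrix.sub_apply, monom, map_apply, map_sub,
        Scalar.eval_monomial, pow_one, Matrix.sub_apply, Matrix.smul_apply, nsmul_eq_mul',
        ← ((hsv.pow p).central _).eq, mul_assoc, ← (Nat.cast_commute n v).symm.mul_pow, hv',
        one_pow, mul_one]
      by_cases hij : i = j <;> simp [one_apply, hij]
    · rw [toBlocks_fromBlocks₁₂]
      simp only [Matrix.zero_mul, Matrix.mul_zero, add_zero, zero_add, inv_inv]
      ext i j
      change ((diagonal (fun _ => v ^ p) : Matrix κ κ R) * (_ : Matrix κ κ R)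
        * (diagonal (fun _ => v ^ p) : Matrix κ κ R)ᴴ) i j = _
      rw [diagonal_conjTranspose, mul_diagonal, diagonal_mul, map_apply, monom, map_apply,
        Scalar.eval_monomial, Pi.star_apply, (hsv.pow p).star_eq,
        ← ((hsv.pow p).central _).eq, mul_assoc, mul_assoc, ← pow_add, ← two_mul,
        ← (Nat.cast_commute n v).mul_pow, hv, one_pow, mul_one]
  apply q.eq_of_upper_eq
  · rw [mat_flatten, GQ.mat_stab, hθ, extend_fromBlocks, toBlocks_fromBlocks₁₁, sumProdFlatten,
      toBlocks_fromBlocks₁₁, e1]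
    ext ⟨_, i⟩ ⟨_, j⟩
    rw [hE', comp_apply, D.ev_apply, diagonal_apply_eq]
    simp
  · rw [mat_flatten, GQ.mat_stab, hθ, extend_fromBlocks, toBlocks_fromBlocks₁₂, sumProdFlatten,
      toBlocks_fromBlocks₁₂, e2]
    ext ⟨_, i⟩ ⟨_, j⟩
    rw [hE, comp_apply, MennickeRow.diagB, diagonal_apply_eq]

theorem Scalar.eval_zero (h0 : F.Scalar (0 : R)) (p : R[X]) : h0.eval p = p.coeff 0 :=
  eval₂_at_zero _

end Evaluation

variable {𝒜 : ℕ → AddSubgroup R} [GradedRing 𝒜]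

theorem IsGraded.isHom_gradedEnd (hgr : F.IsGraded 𝒜) {z : R} (hz : F.Scalar z) :
    IsHom F F (hz.gradedEnd 𝒜) :=
  hz.isHom_eval.comp hgr.isHom_gradedHom

attribute [local instance] commGroupK1

/-- A class of order dividing `k` in `K₁GQ`, for `k` invertible, comes from degree zero. -/
theorem IsGraded.cls_eq_cls_degree_zero (hgr : F.IsGraded 𝒜) {k : ℕ} {w : R}
    (hw : (k : R) * w = 1) {n : ℕ} (σ : F.GQ (Fin n)) (hσ : F.cls n σ ^ k = 1) :
    F.cls n σ = F.cls n ((hgr.isHom_gradedEnd Scalar.zero).mapGQ (Fin n) σ) := by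
  let σ₀ := (hgr.isHom_gradedEnd Scalar.zero).mapGQ (Fin n) σ
  -- `τ(X) = σ(X) σ₀⁻¹`, normalised to `τ(0) = 1` as the reduction to a linear block requires.
  let τ : F.poly.GQ (Fin n) :=
    hgr.isHom_gradedHom.mapGQ (Fin n) σ * (F.isHom_C.mapGQ (Fin n) σ₀)⁻¹
  have hτ : ∀ {z : R} (hz : F.Scalar z), hz.isHom_eval.mapGQ (Fin n) τ
      = (hgr.isHom_gradedEnd hz).mapGQ (Fin n) σ * σ₀⁻¹ := by
    intro z hz
    have : hz.isHom_eval.mapGQ (Fin n) (F.isHom_C.mapGQ (Fin n) σ₀) = σ₀ := by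
      apply GQ.ext_mat
      ext i j
      exact hz.eval_C _
    rw [map_mul, map_inv, this]
    rfl
  have h0 : (GQ.mat τ).polyCoeff 0 = 1 := by
    have h : Scalar.zero.isHom_eval.mapGQ (Fin n) τ = 1 := (hτ _).trans (mul_inv_cancel _)
    have h' := congrArg GQ.mat h
    rw [IsHom.mat_mapGQ] at h'
    refine Eq.trans ?_ h'
    ext i j
    exact (Scalar.eval_zero (Scalar.zero (F := F)) (GQ.mat τ i j)).symm
  obtain ⟨r, hr⟩ := exists_polyCoeff_eq_zero (GQ.mat τ).toBlocks₁₁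
  obtain ⟨κ, _, _, τ', a, ha, hτ'⟩ := F.poly.toK1.exists_linear r (Fin n) τ
    (by
      have := congrArg toBlocks₁₁ h0
      rw [← fromBlocks_one, toBlocks_fromBlocks₁₁] at this
      exact this)
    (fun d hd => hr d (by omega))
  obtain ⟨D, p, rfl, ε, hε, h1, h2⟩ := exists_mennickeRow ha
  have hυ : ∀ {z : R} (hz : F.Scalar z), F.toK1.hom κ (hz.isHom_eval.mapGQ κ (τ' * ε))
      = F.cls n ((hgr.isHom_gradedEnd hz).mapGQ (Fin n) σ) * (F.cls n σ₀)⁻¹ := by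
    intro z hz
    rw [← hz.isHom_eval.mapK1_toK1, map_mul, F.poly.toK1.map_EQ _ _ hε, mul_one, hτ',
      hz.isHom_eval.mapK1_toK1, toK1_hom_fin, hτ, map_mul, map_inv]
  have hpow : ∀ i : ℕ, ((k ^ i : ℕ) : R) * w ^ i = 1 := by
    intro i
    rw [Nat.cast_pow, ← (Nat.cast_commute k w).mul_pow, hw, one_pow]
  let Φ := D.invariant (F.toK1.matrix κ)
  have hΦ : ∀ i : ℕ, Φ.rankOne (PowerSeries.rescale ((k ^ i : ℕ) : ℤ) (1 - PowerSeries.X))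
      = Additive.ofMul (F.cls n ((hgr.isHom_gradedEnd (Scalar.natCast (k ^ i))).mapGQ (Fin n) σ)
        * (F.cls n σ₀)⁻¹) := by
    intro i
    rw [← hυ]
    exact D.invariant_eq F.toK1 h1 h2 (hpow i)
  -- Each specialisation is the image of `σ` under an endomorphism of the form ring, so its class
  -- also has order dividing `k`.
  have hk : ∀ {z : R} (hz : F.Scalar z),
      F.cls n ((hgr.isHom_gradedEnd hz).mapGQ (Fin n) σ) ^ k = 1 := by
    intro z hz
    rw [← IsHom.mapK1_cls, ← map_pow, hσ, map_one]
  obtain ⟨N, hN⟩ := Φ.exists_rankOne_rescale_eq_zero (D.invariant_rankOne_one _)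
    (D.invariant_rankOne_congr _) (k := k) (by
      intro i
      rw [hΦ, ← ofMul_pow, mul_pow, inv_pow, hk, hk, inv_one, one_mul]
      rfl)
  rw [hΦ] at hN
  have hN' : F.cls n ((hgr.isHom_gradedEnd (Scalar.natCast (k ^ N))).mapGQ (Fin n) σ)
      = F.cls n σ₀ := mul_inv_eq_one.1 hN
  have hz : F.Scalar (w ^ N) := Scalar.of_natCast_mul_eq_one (hpow N)
  -- The endomorphism attached to `w ^ N` undoes the one attached to `k ^ N` and fixes `σ₀`.
  have := congrArg (hgr.isHom_gradedEnd hz).mapK1 hN'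
  rw [IsHom.mapK1_cls, IsHom.mapK1_cls] at this
  convert this using 2
  · apply GQ.ext_mat
    ext i j
    refine (Scalar.gradedEnd_gradedEnd (𝒜 := 𝒜) hz (Scalar.natCast (k ^ N)) ?_ (hpow N) _).symm
    exact SetLike.natCast_mem_graded 𝒜 _
  · apply GQ.ext_mat
    ext i j
    exact (Scalar.gradedEnd_zero_mem (𝒜 := 𝒜) hz Scalar.zero _).symm

theorem IsGraded.gradedEnd_zero_sum (h0 : F.Scalar (0 : R)) {N : ℕ → R} (hN : ∀ i, N i ∈ 𝒜 i)
    (r : ℕ) : h0.gradedEnd 𝒜 (∑ i ∈ Finset.range (r + 1), N i) = N 0 := by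
  rw [map_sum, Finset.sum_range_succ', h0.gradedEnd_of_mem (hN 0), pow_zero, mul_one,
    Finset.sum_eq_zero, zero_add]
  intro i _
  rw [h0.gradedEnd_of_mem (hN _), zero_pow (Nat.succ_ne_zero i), mul_zero]

theorem IsGraded.gradedEnd_zero_map {ι : Type*} [DecidableEq ι] (h0 : F.Scalar (0 : R))
    {N : ℕ → Matrix ι ι R} (hN : ∀ i a b, N i a b ∈ 𝒜 i) (r : ℕ) :
    (1 + ∑ i ∈ Finset.range (r + 1), N i).map (h0.gradedEnd 𝒜) = 1 + N 0 := by
  rw [Matrix.map_add _ (map_add _), Matrix.map_one _ (map_zero _) (map_one _)]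
  congr 1
  ext a b
  rw [map_apply, Matrix.sum_apply]
  exact gradedEnd_zero_sum h0 (fun i => hN i a b) r

end FormRing

theorem theorem1p2 {R : Type*} [Ring R] [StarRing R] (F : FormRing R)
    (𝒜 : ℕ → AddSubgroup R) [GradedRing 𝒜] (hgr : F.IsGraded 𝒜)
    (k : ℕ) (hk : IsUnit (k : 𝒜 0)) :
    (∀ (n r : ℕ) (N : ℕ → Matrix (Fin n ⊕ Fin n) (Fin n ⊕ Fin n) R)
      (σ : F.GQ (Fin n)),
      (∀ i a b, N i a b ∈ 𝒜 i) →
      IsNilpotent (∑ i ∈ Finset.range (r + 1), N i) →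
      FormRing.GQ.mat σ = 1 + ∑ i ∈ Finset.range (r + 1), N i →
      F.cls n σ ^ k = 1 →
      ∃ σ₀ : F.GQ (Fin n), FormRing.GQ.mat σ₀ = 1 + N 0 ∧ F.cls n σ = F.cls n σ₀) ∧
    (∀ (n r : ℕ) (N : ℕ → Matrix (Fin n) (Fin n) R) (u : (Matrix (Fin n) (Fin n) R)ˣ),
      (∀ i a b, N i a b ∈ 𝒜 i) →
      IsNilpotent (∑ i ∈ Finset.range (r + 1), N i) →
      (u : Matrix (Fin n) (Fin n) R) = 1 + ∑ i ∈ Finset.range (r + 1), N i →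
      F.cls n (F.hyp (Fin n) u) ^ k = 1 →
      ∃ u₀ : (Matrix (Fin n) (Fin n) R)ˣ, (u₀ : Matrix (Fin n) (Fin n) R) = 1 + N 0 ∧
        F.cls n (F.hyp (Fin n) u) = F.cls n (F.hyp (Fin n) u₀)) := by
  obtain ⟨w, hw⟩ : ∃ w : R, (k : R) * w = 1 := by
    obtain ⟨w, hw⟩ := hk.exists_right_inv
    exact ⟨w, congrArg Subtype.val hw⟩
  -- The projection onto degree zero is an endomorphism of the form ring, so the images of `σ` and
  -- `u` under it are automatically quadratic, respectively invertible.
  let h0 := hgr.isHom_gradedEnd (FormRing.Scalar.zero (F := F))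
  constructor
  · intro n r N σ hN _ hσ hk
    refine ⟨h0.mapGQ (Fin n) σ, ?_, hgr.cls_eq_cls_degree_zero hw σ hk⟩
    rw [FormRing.IsHom.mat_mapGQ, hσ]
    exact FormRing.IsGraded.gradedEnd_zero_map _ hN r
  · intro n r N u hN _ hu hk
    refine ⟨_, ?_, (hgr.cls_eq_cls_degree_zero hw _ hk).trans
      (congrArg (F.cls n) (h0.mapGQ_hyp u))⟩
    change (u : Matrix (Fin n) (Fin n) R).map _ = _
    rw [hu]
    exact FormRing.IsGraded.gradedEnd_zero_map _ hN r
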